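/- Fix $m\ge 1$. Let $A_m$ be the graded ring obtained from the path ring over $\mathbb Z$ of the quiver with vertices $0,\dots,m$ and arrows $(i|i+1)$ from $i$ to $i+1$ and $(i+1|i)$ from $i+1$ to $i$ (for $0\le i<m$) by imposing, for $0<i<m$, $$(i-1|i|i+1)=0=(i+1|i|i-1),\qquad (i|i+1|i)=(i|i-1|i),$$ and $(0|1|0)=0$; here $(i_1|\dots|i_l)$ is the path through $i_1,\dots,i_l$, products are concatenations, and the grading is $\deg(i)=\deg(i|i+1)=0$, $\deg(i+1|i)=1$. Let $A_m\text{-mod}$ be the category of finitely generated graded left $A_m$-modules and grading-preserving homomorphisms, and let $\mathcal C_m$ be the homotopy category of bounded complexes of projective objects of $A_m\text{-mod}$. Write $\{k\}$ for the shift raising the grading by $k$. Put $P_i=A_m(i)$ and ${}_iP=(i)A_m$. For $1\le i\le m$ let $$\beta_i:P_i\otimes_{\mathbb Z}{}_iP\to A_m,\qquad \gamma_i:A_m\to P_i\otimes_{\mathbb Z}{}_iP\{-1\}$$ be the homomorphisms of graded $A_m$-bimodules with $\beta_i((i)\otimes(i))=(i)$ and $$\gamma_i(1)=(i-1|i)\otimes(i|i-1)+(i+1|i)\otimes(i|i+1)+(i)\otimes(i|i-1|i)+(i|i-1|i)\otimes(i),$$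 where the second term is omitted if $i=m$. Let $\mathcal R_i,\mathcal R_i':\mathcal C_m\to\mathcal C_m$ be the functors of tensoring over $A_m$ with the complexes of bimodules $$R_i=\{0\to P_i\otimes{}_iP\xrightarrow{\ \beta_i\ }A_m\to0\},\qquad R_i'=\{0\to A_m\xrightarrow{\ \gamma_i\ }P_i\otimes{}_iP\{-1\}\to0\},$$ in both of which $A_m$ is placed in degree $0$. (Thus $\mathcal R_i(M)$ is the cone of $\beta_i\otimes M$, and $\mathcal R'_i(M)$ is the cone of $-\gamma_i\otimes M$ shifted by $[-1]$.) Theorem. There are isomorphisms of functors $$\mathcal R_i\mathcal R_{i+1}\mathcal R_i\cong\mathcal R_{i+1}\mathcal R_i\mathcal R_{i+1}\quad(1\le i<m),\qquad \mathcal R_i\mathcal R_j\cong\mathcal R_j\mathcal R_i\quad(1\le i,j\le m,\ |i-j|>1),$$ $$\mathcal R_i\mathcal R_i'\cong\mathrm{Id}\cong\mathcal R_i'\mathcal R_i\quad(1\le i\le m).$$ Moreover, there is a weak action of the braid group $B_{m+1}$ (with standard generators $\sigma_1,\dots,\sigma_m$) on $\mathcal C_m$, that is, a choice of functors $\mathcal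 F_g:\mathcal C_m\to\mathcal C_m$ for $g\in B_{m+1}$ with $\mathcal F_1=\mathrm{Id}$ and $\mathcal F_{gh}\cong\mathcal F_g\mathcal F_h$ for all $g,h$, such that $\mathcal F_{\sigma_i}\cong\mathcal R_i$ and $\mathcal F_{\sigma_i^{-1}}\cong\mathcal R_i'$ for all $i$. -/

import Mathlib

open CategoryTheory

noncomputable section

open CategoryTheory.Limits
open scoped TensorProduct

namespace KS

/-! ### Gradings of abelian groups by `ℤ` -/

section Gradings

variable {M N : Type} [AddCommGroup M] [AddCommGroup N]

lemma isInternal_of_proj {deg : ℤ → Submodule ℤ M} (htop : ∀ x, x ∈ ⨆ n, deg n)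
    (hproj : ∀ n, ∃ p : M →ₗ[ℤ] M, (∀ x ∈ deg n, p x = x) ∧ ∀ k, k ≠ n → ∀ x ∈ deg k, p x = 0) :
    DirectSum.IsInternal deg := by
  apply DirectSum.isInternal_submodule_of_iSupIndep_of_iSup_eq_top
  · rw [iSupIndep_def]
    intro n
    obtain ⟨p, h1, h2⟩ := hproj n
    rw [Submodule.disjoint_def]
    intro x hx hx'
    have : (⨆ j, ⨆ (_ : j ≠ n), deg j) ≤ LinearMap.ker p :=
      iSup_le fun j => iSup_le fun hj => fun y hy => h2 j hj y hy
    rw [← h1 x hx]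
    exact this hx'
  · exact eq_top_iff.2 fun x _ => htop x

lemma mem_iSup_of_isInternal {deg : ℤ → Submodule ℤ M} (h : DirectSum.IsInternal deg) (x : M) :
    x ∈ ⨆ n, deg n := by
  rw [h.submodule_iSup_eq_top]; trivial

/-- Induction over the homogeneous components. -/
lemma grading_induction {deg : ℤ → Submodule ℤ M} (h : DirectSum.IsInternal deg)
    {C : M → Prop} (hom : ∀ n, ∀ x ∈ deg n, C x) (zero : C 0)
    (add : ∀ x y, C x → C y → C (x + y)) (x : M) : C x :=
  Submodule.iSup_induction deg (motive := C) (mem_iSup_of_isInternal h x) hom zero add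

/-- A graded abelian group as the direct sum of its components. -/
def gradingEquiv {deg : ℤ → Submodule ℤ M} (h : DirectSum.IsInternal deg) :
    M ≃ₗ[ℤ] DirectSum ℤ fun i => deg i :=
  (LinearEquiv.ofBijective (DirectSum.coeLinearMap deg)
    (show Function.Bijective (DirectSum.coeLinearMap deg) from h)).symm

/-- The projection onto the component of degree `n`. -/
def proj {deg : ℤ → Submodule ℤ M} (h : DirectSum.IsInternal deg) (n : ℤ) : M →ₗ[ℤ] M :=
  (deg n).subtype ∘ₗ DirectSum.component ℤ ℤ (fun i => deg i) n ∘ₗ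
    (gradingEquiv h).toLinearMap

section
variable {deg : ℤ → Submodule ℤ M} (h : DirectSum.IsInternal deg)

lemma symm_of_mem {n : ℤ} {x : M} (hx : x ∈ deg n) :
    gradingEquiv h x = DirectSum.lof ℤ ℤ (fun i => deg i) n ⟨x, hx⟩ := by
  rw [gradingEquiv, LinearEquiv.symm_apply_eq, LinearEquiv.ofBijective_apply,
    DirectSum.coeLinearMap_lof]

lemma proj_mem (n : ℤ) (x : M) : proj h n x ∈ deg n := by
  simp [proj]

lemma proj_same {n : ℤ} {x : M} (hx : x ∈ deg n) : proj h n x = x := by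
  simp [proj, symm_of_mem h hx]

lemma proj_ne {n k : ℤ} (hk : k ≠ n) {x : M} (hx : x ∈ deg k) : proj h n x = 0 := by
  simp [proj, symm_of_mem h hx, DirectSum.component.of, hk]

end

/-- The image of a grading under a surjection with homogeneous kernel. -/
lemma isInternal_map {deg : ℤ → Submodule ℤ M} (h : DirectSum.IsInternal deg) (q : M →ₗ[ℤ] N)
    (hq : Function.Surjective q) (hker : ∀ n x, q x = 0 → q (proj h n x) = 0) :
    DirectSum.IsInternal fun n => (deg n).map q := by
  apply isInternal_of_proj
  · intro y
    obtain ⟨x, rfl⟩ := hq y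
    rw [← Submodule.map_iSup]
    exact Submodule.mem_map_of_mem (mem_iSup_of_isInternal h x)
  · intro n
    let p : N →ₗ[ℤ] N := (LinearMap.ker q).liftQ (q ∘ₗ proj h n) (fun x hx => hker n x hx) ∘ₗ
      (q.quotKerEquivOfSurjective hq).symm.toLinearMap
    have hp : ∀ x, p (q x) = q (proj h n x) := by
      intro x
      have : (q.quotKerEquivOfSurjective hq).symm (q x) = (LinearMap.ker q).mkQ x := by
        rw [LinearEquiv.symm_apply_eq]; rfl
      simp only [p, LinearMap.comp_apply, LinearEquiv.coe_coe, this]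
      exact Submodule.liftQ_apply _ _ _
    refine ⟨p, ?_, ?_⟩
    · rintro _ ⟨x, hx, rfl⟩
      rw [hp, proj_same h hx]
    · rintro k hk _ ⟨x, hx, rfl⟩
      rw [hp, proj_ne h hk hx, map_zero]

/-- The grading of a tensor product over `ℤ`. -/
def tensorDeg (d : ℤ → Submodule ℤ M) (e : ℤ → Submodule ℤ N) (n : ℤ) :
    Submodule ℤ (M ⊗[ℤ] N) :=
  Submodule.span ℤ {t | ∃ k l, k + l = n ∧ ∃ x ∈ d k, ∃ y ∈ e l, t = x ⊗ₜ[ℤ] y}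

lemma tmul_mem_tensorDeg {d : ℤ → Submodule ℤ M} {e : ℤ → Submodule ℤ N} {k l n : ℤ}
    (hkl : k + l = n) {x : M} (hx : x ∈ d k) {y : N} (hy : y ∈ e l) :
    x ⊗ₜ[ℤ] y ∈ tensorDeg d e n :=
  Submodule.subset_span ⟨k, l, hkl, x, hx, y, hy, rfl⟩

lemma isInternal_tensorDeg {d : ℤ → Submodule ℤ M} {e : ℤ → Submodule ℤ N}
    (hd : DirectSum.IsInternal d) (he : DirectSum.IsInternal e) :
    DirectSum.IsInternal (tensorDeg d e) := by
  apply isInternal_of_proj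
  · intro t
    induction t using TensorProduct.induction_on with
    | zero => exact zero_mem _
    | add x y hx hy => exact add_mem hx hy
    | tmul x y =>
      refine grading_induction hd (C := fun x => x ⊗ₜ[ℤ] y ∈ ⨆ n, tensorDeg d e n)
        (fun k x hx => ?_) (by simp) (fun a b ha hb => ?_) x
      · refine grading_induction he (C := fun y => x ⊗ₜ[ℤ] y ∈ ⨆ n, tensorDeg d e n)
          (fun l y hy => ?_) (by simp) (fun a b ha hb => ?_) y
        · exact Submodule.mem_iSup_of_mem (k + l) (tmul_mem_tensorDeg rfl hx hy)
        · rw [TensorProduct.tmul_add]; exact add_mem ha hb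
      · rw [TensorProduct.add_tmul]; exact add_mem ha hb
  · intro n
    let b : M →ₗ[ℤ] N →ₗ[ℤ] M ⊗[ℤ] N :=
      DirectSum.toModule ℤ ℤ (N →ₗ[ℤ] M ⊗[ℤ] N)
        (fun k => (LinearMap.lcomp ℤ _ (proj he (n - k))) ∘ₗ
          (TensorProduct.mk ℤ M N) ∘ₗ (d k).subtype) ∘ₗ
        (gradingEquiv hd).toLinearMap
    have hb : ∀ k, ∀ x ∈ d k, ∀ y, b x y = x ⊗ₜ proj he (n - k) y := by
      intro k x hx y
      simp only [b, LinearMap.comp_apply, LinearEquiv.coe_coe, symm_of_mem hd hx]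
      rw [DirectSum.toModule_lof]
      rfl
    refine ⟨TensorProduct.lift b, ?_, ?_⟩
    · intro t ht
      refine Submodule.span_induction (p := fun t _ => TensorProduct.lift b t = t)
        ?_ (by simp) (fun x y _ _ hx hy => by rw [map_add, hx, hy])
        (fun c x _ hx => by rw [map_smul, hx]) ht
      rintro _ ⟨k, l, hkl, x, hx, y, hy, rfl⟩
      obtain rfl : l = n - k := by omega
      rw [TensorProduct.lift.tmul, hb k x hx, proj_same he hy]
    · intro m hm t ht
      refine Submodule.span_induction (p := fun t _ => TensorProduct.lift b t = 0)
        ?_ (by simp) (fun x y _ _ hx hy => by rw [map_add, hx, hy, add_zero])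
        (fun c x _ hx => by rw [map_smul, hx, smul_zero]) ht
      rintro _ ⟨k, l, hkl, x, hx, y, hy, rfl⟩
      rw [TensorProduct.lift.tmul, hb k x hx, proj_ne he (by omega) hy, TensorProduct.tmul_zero]

end Gradings

/-! ### Finitely generated graded modules over a graded ring -/

section GradedModules

variable {A : Type} [Ring A] (𝒜 : ℤ → Submodule ℤ A)

/-- A finitely generated `ℤ`-graded left module over the graded ring `(A, 𝒜)`. -/
structure FinGrMod where
  carrier : Type
  [addCommGroup : AddCommGroup carrier]
  [module : Module A carrier]
  deg : ℤ → Submodule ℤ carrier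
  isInternal : DirectSum.IsInternal deg
  smul_mem : ∀ {k n : ℤ} {a : A} {x : carrier}, a ∈ 𝒜 k → x ∈ deg n → a • x ∈ deg (k + n)
  finite : Module.Finite A carrier

namespace FinGrMod

variable {𝒜}

instance : CoeSort (FinGrMod 𝒜) Type := ⟨carrier⟩
instance (M : FinGrMod 𝒜) : AddCommGroup M := M.addCommGroup
instance (M : FinGrMod 𝒜) : Module A M := M.module
instance (M : FinGrMod 𝒜) : Module.Finite A M := M.finite

/-- The group of grading-preserving `A`-linear maps. -/
def homs (M N : FinGrMod 𝒜) : AddSubgroup (M →ₗ[A] N) where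
  carrier := {f | ∀ n, ∀ x ∈ M.deg n, f x ∈ N.deg n}
  zero_mem' := fun n _ _ => zero_mem (N.deg n)
  add_mem' := fun hf hg n x hx => add_mem (hf n x hx) (hg n x hx)
  neg_mem' := fun hf n x hx => neg_mem (hf n x hx)

/-- Morphisms are the grading-preserving module homomorphisms. -/
instance : Category (FinGrMod 𝒜) where
  Hom M N := homs M N
  id M := ⟨LinearMap.id, fun _ _ hx => hx⟩
  comp f g := ⟨g.1 ∘ₗ f.1, fun n x hx => g.2 n _ (f.2 n x hx)⟩

instance (M N : FinGrMod 𝒜) : AddCommGroup (M ⟶ N) :=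
  inferInstanceAs (AddCommGroup (homs M N))

/-- The underlying linear map of a morphism. -/
def lin {M N : FinGrMod 𝒜} (f : M ⟶ N) : M →ₗ[A] N := f.1

lemma lin_mem {M N : FinGrMod 𝒜} (f : M ⟶ N) {n : ℤ} {x : M} (hx : x ∈ M.deg n) :
    lin f x ∈ N.deg n := f.2 n x hx

/-- A grading-preserving linear map, as a morphism. -/
def ofLin {M N : FinGrMod 𝒜} (f : M →ₗ[A] N) (hf : ∀ n, ∀ x ∈ M.deg n, f x ∈ N.deg n) :
    M ⟶ N := ⟨f, hf⟩

@[simp] lemma lin_ofLin {M N : FinGrMod 𝒜} (f : M →ₗ[A] N)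
    (hf : ∀ n, ∀ x ∈ M.deg n, f x ∈ N.deg n) : lin (ofLin f hf) = f := rfl

@[ext] lemma hom_ext {M N : FinGrMod 𝒜} {f g : M ⟶ N} (h : ∀ x, lin f x = lin g x) : f = g :=
  Subtype.ext (LinearMap.ext h)

@[simp] lemma lin_id (M : FinGrMod 𝒜) : lin (𝟙 M) = LinearMap.id := rfl
@[simp] lemma lin_comp {M N K : FinGrMod 𝒜} (f : M ⟶ N) (g : N ⟶ K) :
    lin (f ≫ g) = lin g ∘ₗ lin f := rfl
@[simp] lemma lin_add {M N : FinGrMod 𝒜} (f g : M ⟶ N) : lin (f + g) = lin f + lin g := rfl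
@[simp] lemma lin_neg {M N : FinGrMod 𝒜} (f : M ⟶ N) : lin (-f) = -lin f := rfl
@[simp] lemma lin_zero (M N : FinGrMod 𝒜) : lin (0 : M ⟶ N) = 0 := rfl

instance : Preadditive (FinGrMod 𝒜) where
  homGroup M N := inferInstance
  add_comp := by intros; ext; simp
  comp_add := by intros; ext; simp

/-- The zero module. -/
def zeroObj : FinGrMod 𝒜 where
  carrier := PUnit
  deg _ := ⊤
  isInternal := isInternal_of_proj
    (fun _ => Submodule.mem_iSup_of_mem 0 trivial)
    (fun _ => ⟨0, fun _ _ => rfl, fun _ _ _ _ => rfl⟩)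
  smul_mem _ _ := trivial
  finite := inferInstance

instance : HasZeroObject (FinGrMod 𝒜) :=
  ⟨zeroObj, by
    rw [IsZero.iff_id_eq_zero]
    ext x
    exact Subsingleton.elim (α := PUnit) _ _⟩

/-- The direct sum of two graded modules. -/
def sum (M N : FinGrMod 𝒜) : FinGrMod 𝒜 where
  carrier := M × N
  deg n := (M.deg n).prod (N.deg n)
  isInternal := by
    apply isInternal_of_proj
    · rintro ⟨x, y⟩
      have h1 : (x, (0 : N)) ∈ ⨆ n, (M.deg n).prod (N.deg n) :=
        grading_induction M.isInternal
          (C := fun x => (x, (0 : N)) ∈ ⨆ n, (M.deg n).prod (N.deg n))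
          (fun n x hx => Submodule.mem_iSup_of_mem n ⟨hx, zero_mem _⟩) (zero_mem _)
          (fun a b ha hb => by simpa using add_mem ha hb) x
      have h2 : ((0 : M), y) ∈ ⨆ n, (M.deg n).prod (N.deg n) :=
        grading_induction N.isInternal
          (C := fun y => ((0 : M), y) ∈ ⨆ n, (M.deg n).prod (N.deg n))
          (fun n x hx => Submodule.mem_iSup_of_mem n ⟨zero_mem _, hx⟩) (zero_mem _)
          (fun a b ha hb => by simpa using add_mem ha hb) y
      simpa using add_mem h1 h2
    · intro n
      refine ⟨(proj M.isInternal n).prodMap (proj N.isInternal n), ?_, ?_⟩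
      · rintro ⟨x, y⟩ ⟨hx, hy⟩
        exact Prod.ext (proj_same _ hx) (proj_same _ hy)
      · rintro k hk ⟨x, y⟩ ⟨hx, hy⟩
        exact Prod.ext (proj_ne _ hk hx) (proj_ne _ hk hy)
  smul_mem ha hx := ⟨M.smul_mem ha hx.1, N.smul_mem ha hx.2⟩
  finite := inferInstance

instance : HasBinaryBiproducts (FinGrMod 𝒜) where
  has_binary_biproduct M N := hasBinaryBiproduct_of_total
    { pt := sum M N
      fst := ofLin (N := M) (LinearMap.fst A M N) fun _ _ hx => hx.1
      snd := ofLin (N := N) (LinearMap.snd A M N) fun _ _ hx => hx.2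
      inl := ofLin (M := M) (N := sum M N) (LinearMap.inl A M N) fun _ _ hx => ⟨hx, zero_mem _⟩
      inr := ofLin (M := N) (N := sum M N) (LinearMap.inr A M N) fun _ _ hx => ⟨zero_mem _, hx⟩
      inl_fst := rfl
      inl_snd := rfl
      inr_fst := rfl
      inr_snd := rfl }
    (by
      ext x
      obtain ⟨x, y⟩ := x
      exact Prod.ext (add_zero x) (zero_add y))

lemma proj_smul {M : Type} [AddCommGroup M] [Module A M] {deg : ℤ → Submodule ℤ M}
    (h : DirectSum.IsInternal deg)
    (hs : ∀ {k n : ℤ} {a : A} {x : M}, a ∈ 𝒜 k → x ∈ deg n → a • x ∈ deg (k + n))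
    {k n : ℤ} {a : A} (ha : a ∈ 𝒜 k) (x : M) :
    proj h n (a • x) = a • proj h (n - k) x := by
  refine grading_induction h (C := fun x => proj h n (a • x) = a • proj h (n - k) x)
    (fun l x hx => ?_) (by simp) (fun x y hx hy => by simp only [smul_add, map_add, hx, hy]) x
  by_cases hl : k + l = n
  · subst hl
    rw [proj_same h (hs ha hx), proj_same h (by simpa using hx)]
  · rw [proj_ne h hl (hs ha hx), proj_ne h (by omega) hx, smul_zero]

/-- The quotient by a submodule that is stable under the projections. -/
def quot (M : FinGrMod 𝒜) (S : Submodule A M)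
    (hS : ∀ n, ∀ x ∈ S, proj M.isInternal n x ∈ S) : FinGrMod 𝒜 where
  carrier := M ⧸ S
  deg n := (M.deg n).map S.mkQ.toAddMonoidHom.toIntLinearMap
  isInternal := isInternal_map M.isInternal _ S.mkQ_surjective (fun n x hx =>
    (Submodule.Quotient.mk_eq_zero S).2 (hS n x ((Submodule.Quotient.mk_eq_zero S).1 hx)))
  smul_mem := by
    rintro k n a _ ha ⟨x, hx, rfl⟩
    exact ⟨a • x, M.smul_mem ha hx, rfl⟩
  finite := inferInstance

lemma epi_of_surjective {M N : FinGrMod 𝒜} (f : M ⟶ N) (hf : Function.Surjective (lin f)) :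
    Epi f := ⟨fun g h e => by
  ext y
  obtain ⟨x, rfl⟩ := hf y
  exact LinearMap.congr_fun (congrArg lin e) x⟩

lemma surjective_of_epi {M N : FinGrMod 𝒜} (f : M ⟶ N) [Epi f] :
    Function.Surjective (lin f) := by
  have hS : ∀ n, ∀ x ∈ LinearMap.range (lin f), proj N.isInternal n x ∈ LinearMap.range (lin f) := by
    rintro n _ ⟨x, rfl⟩
    refine ⟨proj M.isInternal n x, ?_⟩
    refine grading_induction M.isInternal
      (C := fun x => lin f (proj M.isInternal n x) = proj N.isInternal n (lin f x))
      (fun l x hx => ?_) (by simp) (fun x y hx hy => by simp only [map_add, hx, hy]) x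
    by_cases hl : l = n
    · subst hl
      rw [proj_same _ hx, proj_same _ (lin_mem f hx)]
    · rw [proj_ne _ hl hx, proj_ne _ hl (lin_mem f hx), map_zero]
  let q : N ⟶ quot N _ hS := ofLin (N := quot N _ hS) (LinearMap.range (lin f)).mkQ
    (fun n x hx => ⟨x, hx, rfl⟩)
  have h : f ≫ q = f ≫ 0 := by
    ext x
    exact (Submodule.Quotient.mk_eq_zero _).2 ⟨x, rfl⟩
  have h2 : q = 0 := (cancel_epi f).1 h
  intro y
  have h3 : lin q y = 0 := by rw [h2]; rfl
  exact (Submodule.Quotient.mk_eq_zero _).1 h3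

/-- A finite homogeneous dual basis of a graded module. -/
def HasDualBasis {M : Type} [AddCommGroup M] [Module A M] (deg : ℤ → Submodule ℤ M) : Prop :=
  ∃ (ι : Type) (_ : Fintype ι) (k : ι → ℤ) (b : ι → M) (φ : ι → M →ₗ[A] A),
    (∀ i, b i ∈ deg (k i)) ∧ (∀ i n, ∀ x ∈ deg n, φ i x ∈ 𝒜 (n - k i)) ∧
    ∀ x, ∑ i, φ i x • b i = x

lemma projective_of_hasDualBasis (M : FinGrMod 𝒜) (h : HasDualBasis (𝒜 := 𝒜) M.deg) :
    Projective M := by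
  obtain ⟨ι, _, k, b, φ, hb, hφ, hsum⟩ := h
  refine ⟨fun {N N'} f g hg => ?_⟩
  have key : ∀ i, ∃ y ∈ N.deg (k i), lin g y = lin f (b i) := by
    intro i
    obtain ⟨y, hy⟩ := surjective_of_epi g (lin f (b i))
    refine ⟨proj N.isInternal (k i) y, proj_mem _ _ _, ?_⟩
    have hc : lin g (proj N.isInternal (k i) y) = proj N'.isInternal (k i) (lin g y) := by
      refine grading_induction N.isInternal
        (C := fun x => lin g (proj N.isInternal (k i) x) = proj N'.isInternal (k i) (lin g x))
        (fun l x hx => ?_) (by simp) (fun x y hx hy => by simp only [map_add, hx, hy]) y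
      by_cases hl : l = k i
      · subst hl
        rw [proj_same _ hx, proj_same _ (lin_mem g hx)]
      · rw [proj_ne _ hl hx, proj_ne _ hl (lin_mem g hx), map_zero]
    rw [hc, hy, proj_same _ (lin_mem f (hb i))]
  choose y hy hgy using key
  refine ⟨ofLin (∑ i, (φ i).smulRight (y i)) ?_, ?_⟩
  · intro n x hx
    rw [LinearMap.sum_apply]
    refine sum_mem fun i _ => ?_
    have := N.smul_mem (hφ i n x hx) (hy i)
    simpa using this
  · ext x
    conv_rhs => rw [← hsum x]
    simp [hgy]

end FinGrMod

namespace FinGrMod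

variable {𝒜}

/-- The free graded module with generators in the degrees `k i`. -/
def free [GradedRing 𝒜] {ι : Type} [Fintype ι] (k : ι → ℤ) : FinGrMod 𝒜 where
  carrier := ι → A
  deg n := Submodule.pi Set.univ fun i => 𝒜 (n - k i)
  isInternal := by
    classical
    have h𝒜 : DirectSum.IsInternal 𝒜 := DirectSum.Decomposition.isInternal 𝒜
    apply isInternal_of_proj
    · intro f
      rw [← Finset.univ_sum_single f]
      refine sum_mem fun i _ => ?_
      refine grading_induction h𝒜
        (C := fun a => (Pi.single i a : ι → A) ∈
          ⨆ n, Submodule.pi Set.univ fun i => 𝒜 (n - k i))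
        (fun n x hx => Submodule.mem_iSup_of_mem (n + k i) ?_) (by simp)
        (fun a b ha hb => by rw [Pi.single_add]; exact add_mem ha hb) (f i)
      intro j _
      by_cases hj : j = i
      · subst hj; simpa using hx
      · simp [hj]
    · intro n
      refine ⟨LinearMap.pi fun i => proj h𝒜 (n - k i) ∘ₗ LinearMap.proj i, ?_, ?_⟩
      · intro f hf
        ext i
        exact proj_same _ (hf i trivial)
      · intro l hl f hf
        ext i
        exact proj_ne _ (by omega) (hf i trivial)
  smul_mem := by
    intro l n a f ha hf i _
    have := SetLike.GradedMul.mul_mem ha (hf i trivial)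
    rwa [← add_sub_assoc] at this
  finite := inferInstance

lemma exists_homogeneous_generators (M : FinGrMod 𝒜) :
    ∃ s : Finset M, (∀ x ∈ s, ∃ n, x ∈ M.deg n) ∧ Submodule.span A (s : Set M) = ⊤ := by
  have h : Submodule.span A {x : M | ∃ n, x ∈ M.deg n} = ⊤ := by
    rw [eq_top_iff]
    intro x _
    exact grading_induction M.isInternal 
      (C := fun x => x ∈ Submodule.span A {x : M | ∃ n, x ∈ M.deg n})
      (fun n x hx => Submodule.subset_span ⟨n, hx⟩) (zero_mem _) (fun _ _ => add_mem) x
  have hf : (Submodule.span A {x : M | ∃ n, x ∈ M.deg n}).FG := by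
    rw [h]; exact M.finite.1
  obtain ⟨s, hs, hs'⟩ := (Submodule.fg_span_iff_fg_span_finset_subset _).1 hf
  exact ⟨s, fun x hx => hs hx, hs'.symm.trans h⟩

lemma hasDualBasis_of_projective [GradedRing 𝒜] (M : FinGrMod 𝒜) [Projective M] :
    HasDualBasis (𝒜 := 𝒜) M.deg := by
  obtain ⟨s, hs, htop⟩ := exists_homogeneous_generators M
  choose! d hd using hs
  let k : s → ℤ := fun x => d x.1
  let p : free (𝒜 := 𝒜) k ⟶ M := ofLin (M := free (𝒜 := 𝒜) k)
    (Fintype.linearCombination A (fun x : s => (x.1 : M))) (by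
      intro n f hf
      have e : Fintype.linearCombination A (fun x : s => (x.1 : M)) f
          = ∑ x : s, (f : s → A) x • (x.1 : M) := Fintype.linearCombination_apply A _ _
      refine e ▸ sum_mem fun x _ => ?_
      have := M.smul_mem (hf x trivial) (hd x.1 x.2)
      simpa [k] using this)
  have hp : Function.Surjective (lin p) := by
    intro y
    have hy : y ∈ Submodule.span A (Set.range fun x : s => (x.1 : M)) := by
      have : (Set.range fun x : s => (x.1 : M)) = (s : Set M) := by simp
      rw [this, htop]; trivial
    rw [← Fintype.range_linearCombination] at hy
    exact hy
  have := epi_of_surjective p hp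
  let σ := Projective.factorThru (𝟙 M) p
  have hσ : σ ≫ p = 𝟙 M := Projective.factorThru_comp _ _
  refine ⟨s, inferInstance, k, fun x => x.1,
    fun x => LinearMap.proj x ∘ₗ (lin σ : M →ₗ[A] (s → A)), fun x => hd x.1 x.2,
    fun i n x hx => lin_mem σ hx i trivial, fun x => ?_⟩
  have h2 : lin p (lin σ x) = x := by
    change lin (σ ≫ p) x = x
    rw [hσ]; rfl
  exact h2

end FinGrMod

/-! ### Graded bimodules and their tensor products with modules -/

/-- A `ℤ`-graded `(A, A)`-bimodule that is finitely generated as a left module.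
The right action is written as an action of the opposite ring. -/
structure GrBimod where
  carrier : Type
  [addCommGroup : AddCommGroup carrier]
  [left : Module A carrier]
  [right : Module Aᵐᵒᵖ carrier]
  [comm : SMulCommClass A Aᵐᵒᵖ carrier]
  deg : ℤ → Submodule ℤ carrier
  isInternal : DirectSum.IsInternal deg
  smul_mem : ∀ {k n : ℤ} {a : A} {x : carrier}, a ∈ 𝒜 k → x ∈ deg n → a • x ∈ deg (k + n)
  op_smul_mem : ∀ {k n : ℤ} {a : A} {x : carrier}, a ∈ 𝒜 k → x ∈ deg n →
    MulOpposite.op a • x ∈ deg (n + k)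
  finite : Module.Finite A carrier

namespace GrBimod

variable {𝒜}

instance : CoeSort (GrBimod 𝒜) Type := ⟨carrier⟩
instance (B : GrBimod 𝒜) : AddCommGroup B := B.addCommGroup
instance (B : GrBimod 𝒜) : Module A B := B.left
instance (B : GrBimod 𝒜) : Module Aᵐᵒᵖ B := B.right
instance (B : GrBimod 𝒜) : SMulCommClass A Aᵐᵒᵖ B := B.comm
instance (B : GrBimod 𝒜) : Module.Finite A B := B.finite

/-- Grading-preserving bimodule homomorphisms. -/
structure Hom (B C : GrBimod 𝒜) where
  toLin : B →ₗ[A] C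
  map_op_smul : ∀ (a : A) (x : B), toLin (MulOpposite.op a • x) = MulOpposite.op a • toLin x
  map_mem : ∀ n, ∀ x ∈ B.deg n, toLin x ∈ C.deg n

/-- The negative of a bimodule homomorphism. -/
def Hom.neg {B C : GrBimod 𝒜} (f : Hom B C) : Hom B C where
  toLin := -f.toLin
  map_op_smul a x := by simp [f.map_op_smul]
  map_mem n x hx := neg_mem (f.map_mem n x hx)

/-- The bimodule `B{k}`: the grading is raised by `k`. -/
def shift (B : GrBimod 𝒜) (k : ℤ) : GrBimod 𝒜 where
  carrier := B
  deg n := B.deg (n - k)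
  isInternal := isInternal_of_proj
    (fun x => grading_induction B.isInternal (C := fun x => x ∈ ⨆ n, B.deg (n - k))
      (fun n x hx => Submodule.mem_iSup_of_mem (n + k) (by simpa using hx))
      (zero_mem _) (fun _ _ => add_mem) x)
    (fun n => ⟨proj B.isInternal (n - k), fun x hx => proj_same _ hx,
      fun l hl x hx => proj_ne _ (by omega) hx⟩)
  smul_mem ha hx := by
    have := B.smul_mem ha hx
    rwa [← add_sub_assoc] at this
  op_smul_mem {l n a x} ha hx := by
    have := B.op_smul_mem ha hx
    rwa [show n - k + l = n + l - k by ring] at this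
  finite := B.finite

/-- The ring `A` as a bimodule over itself. -/
def regular (𝒜 : ℤ → Submodule ℤ A) [GradedRing 𝒜] : GrBimod 𝒜 where
  carrier := A
  deg := 𝒜
  isInternal := DirectSum.Decomposition.isInternal 𝒜
  smul_mem ha hx := SetLike.GradedMul.mul_mem ha hx
  op_smul_mem ha hx := SetLike.GradedMul.mul_mem hx ha
  finite := inferInstance

/-- The relations `b a ⊗ x = b ⊗ a x`; their left `A`-span is their additive span. -/
def tensorRel (B : GrBimod 𝒜) (M : FinGrMod 𝒜) : Submodule A (B ⊗[ℤ] M) :=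
  Submodule.span A {t | ∃ (b : B) (a : A) (x : M),
    t = (MulOpposite.op a • b) ⊗ₜ[ℤ] x - b ⊗ₜ[ℤ] (a • x)}

lemma tensor_smul_mem (B : GrBimod 𝒜) (M : FinGrMod 𝒜) {k n : ℤ} {a : A} {t : B ⊗[ℤ] M}
    (ha : a ∈ 𝒜 k) (ht : t ∈ tensorDeg B.deg M.deg n) :
    a • t ∈ tensorDeg B.deg M.deg (k + n) := by
  refine Submodule.span_induction
    (p := fun t _ => a • t ∈ tensorDeg B.deg M.deg (k + n)) ?_ (by simp)
    (fun x y _ _ hx hy => by rw [smul_add]; exact add_mem hx hy)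
    (fun c x _ hx => by rw [smul_comm]; exact Submodule.smul_mem _ _ hx) ht
  rintro _ ⟨p, q, rfl, x, hx, y, hy, rfl⟩
  rw [TensorProduct.smul_tmul']
  exact tmul_mem_tensorDeg (by ring) (B.smul_mem ha hx) hy

lemma proj_mem_tensorRel [GradedRing 𝒜] (B : GrBimod 𝒜) (M : FinGrMod 𝒜) (n : ℤ)
    (t : B ⊗[ℤ] M) (ht : t ∈ tensorRel B M) :
    proj (isInternal_tensorDeg B.isInternal M.isInternal) n t ∈ tensorRel B M := by
  have h𝒜 : DirectSum.IsInternal 𝒜 := DirectSum.Decomposition.isInternal 𝒜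
  set h := isInternal_tensorDeg B.isInternal M.isInternal
  refine Submodule.span_induction (p := fun t _ => ∀ n, proj h n t ∈ tensorRel B M)
    ?_ (by simp) (fun x y _ _ hx hy n => by rw [map_add]; exact add_mem (hx n) (hy n))
    (fun a x _ hx => ?_) ht n
  · rintro _ ⟨b, a, x, rfl⟩ n
    refine grading_induction B.isInternal (C := fun b => proj h n
      ((MulOpposite.op a • b) ⊗ₜ[ℤ] x - b ⊗ₜ[ℤ] (a • x)) ∈ tensorRel B M)
      (fun k b hb => ?_) (by simp) (fun b c hb hc => ?_) b
    swap
    · have := add_mem hb hc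
      rw [← map_add] at this
      convert this using 2
      rw [smul_add, TensorProduct.add_tmul, TensorProduct.add_tmul]
      abel
    refine grading_induction h𝒜 (C := fun a => proj h n
      ((MulOpposite.op a • b) ⊗ₜ[ℤ] x - b ⊗ₜ[ℤ] (a • x)) ∈ tensorRel B M)
      (fun l a ha => ?_) (by simp) (fun a c ha hc => ?_) a
    swap
    · have := add_mem ha hc
      rw [← map_add] at this
      convert this using 2
      rw [MulOpposite.op_add, add_smul, add_smul, TensorProduct.add_tmul, TensorProduct.tmul_add]
      abel
    refine grading_induction M.isInternal (C := fun x => proj h n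
      ((MulOpposite.op a • b) ⊗ₜ[ℤ] x - b ⊗ₜ[ℤ] (a • x)) ∈ tensorRel B M)
      (fun p x hx => ?_) (by simp) (fun x y hx hy => ?_) x
    swap
    · have := add_mem hx hy
      rw [← map_add] at this
      convert this using 2
      rw [smul_add, TensorProduct.tmul_add, TensorProduct.tmul_add]
      abel
    have hmem : (MulOpposite.op a • b) ⊗ₜ[ℤ] x - b ⊗ₜ[ℤ] (a • x) ∈
        tensorDeg B.deg M.deg (k + l + p) :=
      sub_mem (tmul_mem_tensorDeg rfl (B.op_smul_mem ha hb) hx)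
        (tmul_mem_tensorDeg (by ring) hb (M.smul_mem ha hx))
    by_cases hn : k + l + p = n
    · subst hn
      rw [proj_same h hmem]
      exact Submodule.subset_span ⟨b, a, x, rfl⟩
    · rw [proj_ne h hn hmem]
      exact zero_mem _
  · intro n
    refine grading_induction h𝒜 (C := fun a => proj h n (a • x) ∈ tensorRel B M)
      (fun k a ha => ?_) (by simp) (fun a c ha hc => ?_) a
    · rw [FinGrMod.proj_smul (𝒜 := 𝒜) h (tensor_smul_mem B M) ha]
      exact Submodule.smul_mem _ _ (hx _)
    · rw [add_smul, map_add]; exact add_mem ha hc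

/-- The class of `b ⊗ x` in `B ⊗_A M`. -/
def tmul {B : GrBimod 𝒜} {M : FinGrMod 𝒜} (b : B) (x : M) : (B ⊗[ℤ] M) ⧸ tensorRel B M :=
  (tensorRel B M).mkQ (b ⊗ₜ[ℤ] x)

lemma tmul_add {B : GrBimod 𝒜} {M : FinGrMod 𝒜} (b : B) (x y : M) :
    tmul b (x + y) = tmul b x + tmul b y := by
  simp [tmul, TensorProduct.tmul_add]

lemma add_tmul {B : GrBimod 𝒜} {M : FinGrMod 𝒜} (b c : B) (x : M) :
    tmul (b + c) x = tmul b x + tmul c x := by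
  simp [tmul, TensorProduct.add_tmul]

lemma smul_tmul {B : GrBimod 𝒜} {M : FinGrMod 𝒜} (a : A) (b : B) (x : M) :
    a • tmul b x = tmul (a • b) x := rfl

lemma tmul_smul {B : GrBimod 𝒜} {M : FinGrMod 𝒜} (b : B) (a : A) (x : M) :
    tmul b (a • x) = tmul (MulOpposite.op a • b) x := by
  rw [eq_comm, ← sub_eq_zero]
  exact (Submodule.Quotient.mk_eq_zero _).2 (Submodule.subset_span ⟨b, a, x, rfl⟩)

lemma tmul_sum {B : GrBimod 𝒜} {M : FinGrMod 𝒜} {ι : Type} (s : Finset ι) (b : B) (x : ι → M) :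
    tmul b (∑ i ∈ s, x i) = ∑ i ∈ s, tmul b (x i) := by
  simp [tmul, TensorProduct.tmul_sum]

lemma sum_tmul {B : GrBimod 𝒜} {M : FinGrMod 𝒜} {ι : Type} (s : Finset ι) (b : ι → B) (x : M) :
    tmul (∑ i ∈ s, b i) x = ∑ i ∈ s, tmul (b i) x := by
  simp [tmul, TensorProduct.sum_tmul]

lemma tmul_finite (B : GrBimod 𝒜) (M : FinGrMod 𝒜) :
    Module.Finite A ((B ⊗[ℤ] M) ⧸ tensorRel B M) := by
  obtain ⟨s, hs⟩ := M.finite.1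
  let f : (s → B) →ₗ[A] (B ⊗[ℤ] M) ⧸ tensorRel B M :=
    ∑ x : s, (tensorRel B M).mkQ ∘ₗ
      (TensorProduct.AlgebraTensorModule.mk ℤ A B M).flip x.1 ∘ₗ LinearMap.proj x
  have hf : ∀ (x : s) (b : B), tmul b x.1 ∈ LinearMap.range f := fun x b => by
    classical
    refine ⟨Pi.single x b, ?_⟩
    simp only [f, LinearMap.sum_apply, LinearMap.comp_apply, LinearMap.proj_apply]
    rw [Finset.sum_eq_single x]
    · simp [tmul]
    · intro y _ hy
      simp [hy]
    · simp
  refine Module.Finite.of_surjective f (LinearMap.range_eq_top.1 (eq_top_iff.2 ?_))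
  rintro t -
  obtain ⟨t, rfl⟩ := Submodule.mkQ_surjective _ t
  induction t using TensorProduct.induction_on with
  | zero => simp
  | add x y hx hy => rw [map_add]; exact add_mem hx hy
  | tmul b x =>
    have hx : x ∈ Submodule.span A (s : Set M) := by rw [hs]; trivial
    change tmul b x ∈ _
    refine Submodule.span_induction (p := fun x _ => ∀ b : B, tmul b x ∈ LinearMap.range f)
      (fun x hx b => hf ⟨x, hx⟩ b) (fun b => by simp [tmul])
      (fun x y _ _ hx hy b => by rw [tmul_add]; exact add_mem (hx b) (hy b))
      (fun a x _ hx b => by rw [tmul_smul]; exact hx _) hx b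

/-- The graded left module `B ⊗_A M`. -/
def tensor [GradedRing 𝒜] (B : GrBimod 𝒜) (M : FinGrMod 𝒜) : FinGrMod 𝒜 where
  carrier := (B ⊗[ℤ] M) ⧸ tensorRel B M
  deg n := (tensorDeg B.deg M.deg n).map (tensorRel B M).mkQ.toAddMonoidHom.toIntLinearMap
  isInternal := isInternal_map (isInternal_tensorDeg B.isInternal M.isInternal) _
    (tensorRel B M).mkQ_surjective (fun n t ht => (Submodule.Quotient.mk_eq_zero _).2
      (proj_mem_tensorRel B M n t ((Submodule.Quotient.mk_eq_zero _).1 ht)))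
  smul_mem := by
    rintro k n a _ ha ⟨x, hx, rfl⟩
    exact ⟨a • x, tensor_smul_mem B M ha hx, rfl⟩
  finite := tmul_finite B M

/-- The map `f ⊗ g` on tensor products over `A`. -/
def tensorMapLin {B C : GrBimod 𝒜} {M N : FinGrMod 𝒜} (f : Hom B C) (g : M ⟶ N) :
    ((B ⊗[ℤ] M) ⧸ tensorRel B M) →ₗ[A] ((C ⊗[ℤ] N) ⧸ tensorRel C N) :=
  Submodule.mapQ _ _ (TensorProduct.AlgebraTensorModule.map f.toLin
    (FinGrMod.lin g).toAddMonoidHom.toIntLinearMap) <| by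
      rw [tensorRel, Submodule.span_le]
      rintro _ ⟨b, a, x, rfl⟩
      refine Submodule.subset_span ⟨f.toLin b, a, FinGrMod.lin g x, ?_⟩
      simp [f.map_op_smul]

lemma tensorMapLin_tmul {B C : GrBimod 𝒜} {M N : FinGrMod 𝒜} (f : Hom B C) (g : M ⟶ N)
    (b : B) (x : M) : tensorMapLin f g (tmul b x) = tmul (f.toLin b) (FinGrMod.lin g x) := rfl

lemma tensor_lin_ext [GradedRing 𝒜] {B : GrBimod 𝒜} {M N : FinGrMod 𝒜} {f g : tensor B M ⟶ N}
    (h : ∀ (b : B) (x : M), FinGrMod.lin f (tmul b x) = FinGrMod.lin g (tmul b x)) : f = g := by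
  ext t
  obtain ⟨t, rfl⟩ := (tensorRel B M).mkQ_surjective t
  induction t using TensorProduct.induction_on with
  | zero => exact (map_zero (FinGrMod.lin f)).trans (map_zero (FinGrMod.lin g)).symm
  | add x y hx hy =>
    exact (map_add (FinGrMod.lin f) _ _).trans
      ((congrArg₂ (· + ·) hx hy).trans (map_add (FinGrMod.lin g) _ _).symm)
  | tmul b x => exact h b x

/-- The morphism `f ⊗ g : B ⊗_A M ⟶ C ⊗_A N` of graded modules. -/
def tensorMap [GradedRing 𝒜] {B C : GrBimod 𝒜} {M N : FinGrMod 𝒜} (f : Hom B C) (g : M ⟶ N) :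
    tensor B M ⟶ tensor C N :=
  FinGrMod.ofLin (M := tensor B M) (N := tensor C N) (tensorMapLin f g) <| by
    rintro n _ ⟨t, ht, rfl⟩
    refine ⟨_, ?_, rfl⟩
    refine Submodule.span_induction (p := fun t _ =>
      (TensorProduct.AlgebraTensorModule.map f.toLin
        (FinGrMod.lin g).toAddMonoidHom.toIntLinearMap) t ∈ tensorDeg C.deg N.deg n)
      ?_ (by simp) (fun x y _ _ hx hy => by rw [map_add]; exact add_mem hx hy)
      (fun c x _ hx => by rw [map_zsmul]; exact Submodule.smul_mem _ _ hx) ht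
    rintro _ ⟨k, l, hkl, x, hx, y, hy, rfl⟩
    exact tmul_mem_tensorDeg hkl (f.map_mem _ _ hx) (FinGrMod.lin_mem g hy)

/-- The identity of a bimodule. -/
def Hom.id (B : GrBimod 𝒜) : Hom B B := ⟨LinearMap.id, fun _ _ => rfl, fun _ _ hx => hx⟩

/-- The functor `M ↦ B ⊗_A M`. -/
def tensorFunctor [GradedRing 𝒜] (B : GrBimod 𝒜) : FinGrMod 𝒜 ⥤ FinGrMod 𝒜 where
  obj M := tensor B M
  map g := tensorMap (Hom.id B) g
  map_id _ := tensor_lin_ext fun _ _ => rfl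
  map_comp _ _ := tensor_lin_ext fun _ _ => rfl

instance [GradedRing 𝒜] (B : GrBimod 𝒜) : (tensorFunctor B).Additive where
  map_add {_ _ f g} := tensor_lin_ext fun b x => tmul_add b (FinGrMod.lin f x) (FinGrMod.lin g x)

/-- The natural transformation `f ⊗_A M : B ⊗_A M ⟶ C ⊗_A M`. -/
def tensorNat [GradedRing 𝒜] {B C : GrBimod 𝒜} (f : Hom B C) :
    tensorFunctor B ⟶ tensorFunctor C where
  app M := tensorMap f (𝟙 M)
  naturality _ _ _ := tensor_lin_ext fun _ _ => rfl

/-- Tensoring with a bimodule that has a finite homogeneous dual basis as a left module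
preserves projectives. -/
lemma projective_tensor [GradedRing 𝒜] (B : GrBimod 𝒜)
    (hB : FinGrMod.HasDualBasis (𝒜 := 𝒜) B.deg) (M : FinGrMod 𝒜) [Projective M] :
    Projective ((tensorFunctor B).obj M) := by
  apply FinGrMod.projective_of_hasDualBasis
  obtain ⟨ι, _, k, b, φ, hb, hφ, hsum⟩ := hB
  obtain ⟨κ, _, l, x, ψ, hx, hψ, hsum'⟩ := FinGrMod.hasDualBasis_of_projective M
  let θ : ι × κ → ((B ⊗[ℤ] M) ⧸ tensorRel B M) →ₗ[A] A := fun p =>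
    (tensorRel B M).liftQ (TensorProduct.AlgebraTensorModule.lift
      { toFun := fun b =>
          (AddMonoidHom.mk' (fun y => φ p.1 (MulOpposite.op (ψ p.2 y) • b))
            fun y z => by simp [add_smul]).toIntLinearMap
        map_add' := fun b c => by ext y; simp
        map_smul' := fun a b => by
          ext y
          simp [← smul_comm a] }) <| by
      rw [tensorRel, Submodule.span_le]
      rintro _ ⟨b, a, y, rfl⟩
      simp [mul_smul]
  have hθ : ∀ p b y, θ p (tmul b y) = φ p.1 (MulOpposite.op (ψ p.2 y) • b) := fun _ _ _ => rfl
  refine ⟨ι × κ, inferInstance, fun p => k p.1 + l p.2, fun p => tmul (b p.1) (x p.2), θ,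
    fun p => ⟨_, tmul_mem_tensorDeg rfl (hb _) (hx _), rfl⟩, ?_, ?_⟩
  · rintro p n _ ⟨t, ht, rfl⟩
    refine Submodule.span_induction (p := fun t _ =>
      θ p ((tensorRel B M).mkQ t) ∈ 𝒜 (n - (k p.1 + l p.2)))
      ?_ (by simp) (fun x y _ _ hx hy => by rw [map_add, map_add]; exact add_mem hx hy)
      (fun c x _ hx => by rw [map_zsmul, map_zsmul]; exact Submodule.smul_mem _ _ hx) ht
    rintro _ ⟨u, v, rfl, c, hc, y, hy, rfl⟩
    have := hφ p.1 _ _ (B.op_smul_mem (hψ p.2 _ _ hy) hc)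
    rwa [show u + (v - l p.2) - k p.1 = u + v - (k p.1 + l p.2) by ring] at this
  · intro t
    obtain ⟨t, rfl⟩ := (tensorRel B M).mkQ_surjective t
    change ∑ p, θ p ((tensorRel B M).mkQ t) • (tmul (b p.1) (x p.2) :
      (B ⊗[ℤ] M) ⧸ tensorRel B M) = (tensorRel B M).mkQ t
    induction t using TensorProduct.induction_on with
    | zero => simp
    | add s t hs ht => simp only [map_add, add_smul, Finset.sum_add_distrib, hs, ht]
    | tmul c y =>
      change ∑ p, θ p (tmul c y) • tmul (b p.1) (x p.2) = tmul c y
      simp only [hθ, smul_tmul, Fintype.sum_prod_type_right]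
      simp only [← sum_tmul, hsum, ← tmul_smul]
      rw [← tmul_sum, hsum']

end GrBimod

end GradedModules

/-! ### Homotopy categories of bounded complexes of projectives -/

section HomotopyCategories

open CochainComplex CochainComplex.HomComplex

variable (𝓐 : Type*) [Category 𝓐] [Preadditive 𝓐]

/-- The complex is bounded and its terms are projective objects. -/
def isBoundedProjective : ObjectProperty (CochainComplex 𝓐 ℤ) := fun K =>
  (∀ n, Projective (K.X n)) ∧ ∃ a b : ℤ, ∀ n, (n < a ∨ b < n) → IsZero (K.X n)

/-- The homotopy category `P(𝓐)` of bounded complexes of projective objects of `𝓐`. -/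
abbrev BoundedProj : Type _ :=
  ObjectProperty.FullSubcategory
    (fun K : HomotopyCategory 𝓐 (ComplexShape.up ℤ) => isBoundedProjective 𝓐 K.as)

variable {𝓐}

/-- The endofunctor of `P(𝓐)` induced by an endofunctor of the category of complexes which is
compatible with homotopies and preserves bounded complexes of projectives. -/
def descend (Φ : CochainComplex 𝓐 ℤ ⥤ CochainComplex 𝓐 ℤ)
    (hΦ : ∀ {K L : CochainComplex 𝓐 ℤ} (f g : K ⟶ L), Homotopy f g →
      Nonempty (Homotopy (Φ.map f) (Φ.map g)))
    (hP : ∀ K, isBoundedProjective 𝓐 K → isBoundedProjective 𝓐 (Φ.obj K)) :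
    BoundedProj 𝓐 ⥤ BoundedProj 𝓐 :=
  ObjectProperty.lift _
    (ObjectProperty.ι _ ⋙ CategoryTheory.Quotient.lift _
      (Φ ⋙ HomotopyCategory.quotient 𝓐 (ComplexShape.up ℤ))
      (fun _ _ f g ⟨h⟩ => HomotopyCategory.eq_of_homotopy _ _ (hΦ f g h).some))
    (fun K => hP K.obj.as K.property)

variable [HasBinaryBiproducts 𝓐]

/-- Compatible homotopies induce a homotopy between maps of cones. -/
def coneHomotopy {K₁ L₁ K₂ L₂ : CochainComplex 𝓐 ℤ} {φ₁ : K₁ ⟶ L₁} {φ₂ : K₂ ⟶ L₂}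
    {a a' : K₁ ⟶ K₂} {b b' : L₁ ⟶ L₂} (comm : φ₁ ≫ b = a ≫ φ₂) (comm' : φ₁ ≫ b' = a' ≫ φ₂)
    (ha : Homotopy a a') (hb : Homotopy b b')
    (hab : ∀ p q, φ₁.f p ≫ hb.hom p q = ha.hom p q ≫ φ₂.f q) :
    Homotopy (mappingCone.map φ₁ φ₂ a b comm) (mappingCone.map φ₁ φ₂ a' b' comm') :=
  mappingCone.descHomotopy _ _ _
    (-(Cochain.ofHomotopy ha).comp (mappingCone.inl _) (by norm_num))
    ((Cochain.ofHomotopy hb).comp (Cochain.ofHom (mappingCone.inr _)) (add_zero _))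
    (by
      have hnat : (Cochain.ofHom φ₁).comp (Cochain.ofHomotopy hb) (zero_add (-1)) =
          (Cochain.ofHomotopy ha).comp (Cochain.ofHom φ₂) (add_zero (-1)) := by
        ext p q hpq
        rw [Cochain.zero_cochain_comp_v, Cochain.comp_zero_cochain_v]
        simpa [Cochain.ofHomotopy] using hab p q
      rw [δ_neg, δ_comp _ _ (show (-1 : ℤ) + -1 = -2 by norm_num) 0 0 (-1) (by norm_num)
        (by norm_num) (by norm_num), mappingCone.δ_inl, δ_ofHomotopy,
        ← Cochain.comp_assoc_of_first_is_zero_cochain, hnat, Cochain.sub_comp,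
        Cochain.ofHom_comp, Cochain.comp_assoc_of_second_is_zero_cochain]
      simp [mappingCone.map])
    (by
      simp [mappingCone.map])

section Cone

variable {F G : 𝓐 ⥤ 𝓐} [F.Additive] [G.Additive] (τ : F ⟶ G)

/-- The functor sending a complex `M` to the cone of `τ : F(M) ⟶ G(M)`. -/
def coneFunctor : CochainComplex 𝓐 ℤ ⥤ CochainComplex 𝓐 ℤ where
  obj K := mappingCone ((NatTrans.mapHomologicalComplex τ (ComplexShape.up ℤ)).app K)
  map f := mappingCone.map _ _ ((F.mapHomologicalComplex _).map f)
    ((G.mapHomologicalComplex _).map f) (NatTrans.naturality _ f).symm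
  map_id K := by
    simp only [CategoryTheory.Functor.map_id]
    exact mappingCone.map_id _
  map_comp f g := by
    simp only [CategoryTheory.Functor.map_comp]
    exact mappingCone.map_comp _ _ _ _ _ _ _ _ _

lemma coneFunctor_homotopy {K L : CochainComplex 𝓐 ℤ} (f g : K ⟶ L) (h : Homotopy f g) :
    Nonempty (Homotopy ((coneFunctor τ).map f) ((coneFunctor τ).map g)) :=
  ⟨coneHomotopy (NatTrans.naturality _ f).symm (NatTrans.naturality _ g).symm
    (F.mapHomotopy h) (G.mapHomotopy h)
    (fun p q => (τ.naturality (h.hom p q)).symm)⟩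

lemma coneFunctor_isBoundedProjective (hF : ∀ X, Projective X → Projective (F.obj X))
    (hG : ∀ X, Projective X → Projective (G.obj X)) (K : CochainComplex 𝓐 ℤ)
    (hK : isBoundedProjective 𝓐 K) : isBoundedProjective 𝓐 ((coneFunctor τ).obj K) := by
  obtain ⟨hp, a, b, hab⟩ := hK
  refine ⟨fun n => ?_, a - 1, b, fun n hn => ?_⟩
  · have h1 := hF _ (hp (n + 1))
    have h2 := hG _ (hp n)
    exact Projective.of_iso (HomologicalComplex.homotopyCofiber.XIsoBiprod
      ((NatTrans.mapHomologicalComplex τ (ComplexShape.up ℤ)).app K) n (n + 1) rfl).symm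
      (inferInstanceAs (Projective (F.obj (K.X (n + 1)) ⊞ G.obj (K.X n))))
  · refine (mappingCone.isZero_X_iff _ n).2 ⟨?_, ?_⟩
    · exact F.map_isZero (hab _ (by omega))
    · exact G.map_isZero (hab _ (by omega))

/-- The endofunctor `M ↦ C(τ : F(M) ⟶ G(M))` of `P(𝓐)`. -/
def coneEndofunctor (hF : ∀ X, Projective X → Projective (F.obj X))
    (hG : ∀ X, Projective X → Projective (G.obj X)) : BoundedProj 𝓐 ⥤ BoundedProj 𝓐 :=
  descend (coneFunctor τ) (coneFunctor_homotopy τ) (coneFunctor_isBoundedProjective τ hF hG)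

/-- The endofunctor `M ↦ C(τ : F(M) ⟶ G(M))[-1]` of `P(𝓐)`. -/
def shiftedConeEndofunctor (hF : ∀ X, Projective X → Projective (F.obj X))
    (hG : ∀ X, Projective X → Projective (G.obj X)) : BoundedProj 𝓐 ⥤ BoundedProj 𝓐 :=
  descend (coneFunctor τ ⋙ shiftFunctor (CochainComplex 𝓐 ℤ) (-1 : ℤ))
    (fun f g h => ⟨(coneFunctor_homotopy τ f g h).some.shift (-1)⟩)
    (fun K hK => by
      obtain ⟨hp, a, b, hab⟩ := coneFunctor_isBoundedProjective τ hF hG K hK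
      exact ⟨fun n => hp (n + -1), a + 1, b + 1, fun n hn => hab (n + -1) (by omega)⟩)

end Cone

end HomotopyCategories

/-! ### Weak actions -/

/-- A weak action of a group `G` on a category `𝓠`: functors `F g` with `F 1` the identity
and `F (g * h)` isomorphic to `F g ∘ F h`. -/
structure WeakAction (G : Type*) [Group G] (𝓠 : Type*) [Category 𝓠] where
  functor : G → 𝓠 ⥤ 𝓠
  functor_one : functor 1 = 𝟭 𝓠
  functor_mul : ∀ g h, Nonempty (functor (g * h) ≅ functor h ⋙ functor g)

/-! ### The rings `A_m` -/

section ZigzagRing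

/-- Generators of the path ring of the quiver with vertices `0, …, m` and arrows
`i ⟶ i + 1`, `i + 1 ⟶ i`: `vtx i` is the path `(i)`, `up i` is `(i|i+1)`, `dn i` is `(i+1|i)`. -/
inductive Gen (m : ℕ) : Type
  | vtx (i : Fin (m + 1))
  | up (i : Fin m)
  | dn (i : Fin m)

/-- The grading: `deg (i) = deg (i|i+1) = 0` and `deg (i+1|i) = 1`. -/
def Gen.degree {m : ℕ} : Gen m → ℤ
  | vtx _ => 0
  | up _ => 0
  | dn _ => 1

open FreeRing Gen in
/-- The first seven relations present the path ring (the `(i)` are orthogonal idempotents with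
sum `1`, and an arrow is multiplied by its source on the left and by its target on the right).
The last four are, with `j = i + 1`: `(i|i+1|i+2) = 0`, `(i+2|i+1|i) = 0`,
`(i+1|i+2|i+1) = (i+1|i|i+1)` and `(0|1|0) = 0`. -/
inductive Rel (m : ℕ) : FreeRing (Gen m) → FreeRing (Gen m) → Prop
  | vtx_self (i) : Rel m (of (vtx i) * of (vtx i)) (of (vtx i))
  | vtx_ne (i j) : i ≠ j → Rel m (of (vtx i) * of (vtx j)) 0
  | vtx_sum : Rel m (∑ i, of (vtx i)) 1
  | vtx_up (i) : Rel m (of (vtx i.castSucc) * of (up i)) (of (up i))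
  | up_vtx (i) : Rel m (of (up i) * of (vtx i.succ)) (of (up i))
  | vtx_dn (i) : Rel m (of (vtx i.succ) * of (dn i)) (of (dn i))
  | dn_vtx (i) : Rel m (of (dn i) * of (vtx i.castSucc)) (of (dn i))
  | up_up (i j) : j.val = i.val + 1 → Rel m (of (up i) * of (up j)) 0
  | dn_dn (i j) : j.val = i.val + 1 → Rel m (of (dn j) * of (dn i)) 0
  | loop (i j) : j.val = i.val + 1 → Rel m (of (up j) * of (dn j)) (of (dn i) * of (up i))
  | up_dn_zero (i) : i.val = 0 → Rel m (of (up i) * of (dn i)) 0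

/-- The ring `A_m`. -/
def Zig (m : ℕ) : Type := RingQuot (Rel m)

instance (m : ℕ) : Ring (Zig m) := inferInstanceAs (Ring (RingQuot (Rel m)))

variable {m : ℕ}

/-- The quotient map. -/
def toZig : FreeRing (Gen m) →+* Zig m := RingQuot.mkRingHom (Rel m)

lemma toZig_rel {x y : FreeRing (Gen m)} (h : Rel m x y) : toZig x = toZig y :=
  RingQuot.mkRingHom_rel h

lemma toZig_surjective : Function.Surjective (toZig (m := m)) :=
  RingQuot.mkRingHom_surjective (Rel m)

/-- The class of a generator in `A_m`. -/
def gen (g : Gen m) : Zig m := toZig (FreeRing.of g)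

/-- The idempotent `(i)`. -/
abbrev e (i : Fin (m + 1)) : Zig m := gen (.vtx i)
/-- The arrow `(i|i+1)`. -/
abbrev u (i : Fin m) : Zig m := gen (.up i)
/-- The arrow `(i+1|i)`. -/
abbrev d (i : Fin m) : Zig m := gen (.dn i)

lemma e_e (i : Fin (m + 1)) : e i * e i = e i := by
  simpa [gen] using toZig_rel (Rel.vtx_self i)
lemma e_e_ne {i j : Fin (m + 1)} (h : i ≠ j) : e i * e j = 0 := by
  simpa [gen] using toZig_rel (Rel.vtx_ne i j h)
lemma e_sum : ∑ i, e (m := m) i = 1 := by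
  simpa [gen] using toZig_rel (Rel.vtx_sum (m := m))
lemma e_u (i : Fin m) : e i.castSucc * u i = u i := by
  simpa [gen] using toZig_rel (Rel.vtx_up i)
lemma u_e (i : Fin m) : u i * e i.succ = u i := by
  simpa [gen] using toZig_rel (Rel.up_vtx i)
lemma e_d (i : Fin m) : e i.succ * d i = d i := by
  simpa [gen] using toZig_rel (Rel.vtx_dn i)
lemma d_e (i : Fin m) : d i * e i.castSucc = d i := by
  simpa [gen] using toZig_rel (Rel.dn_vtx i)
lemma loop_eq {i j : Fin m} (h : j.val = i.val + 1) : u j * d j = d i * u i := by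
  simpa [gen] using toZig_rel (Rel.loop i j h)
lemma u_d_zero {i : Fin m} (h : i.val = 0) : u i * d i = 0 := by
  simpa [gen] using toZig_rel (Rel.up_dn_zero i h)

lemma e_u_ne {k : Fin (m + 1)} {i : Fin m} (h : k ≠ i.castSucc) : e k * u i = 0 := by
  rw [← e_u, ← mul_assoc, e_e_ne h, zero_mul]
lemma u_e_ne {k : Fin (m + 1)} {i : Fin m} (h : i.succ ≠ k) : u i * e k = 0 := by
  rw [← u_e, mul_assoc, e_e_ne h, mul_zero]
lemma e_d_ne {k : Fin (m + 1)} {i : Fin m} (h : k ≠ i.succ) : e k * d i = 0 := by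
  rw [← e_d, ← mul_assoc, e_e_ne h, zero_mul]
lemma d_e_ne {k : Fin (m + 1)} {i : Fin m} (h : i.castSucc ≠ k) : d i * e k = 0 := by
  rw [← d_e, mul_assoc, e_e_ne h, mul_zero]
lemma u_u (k i : Fin m) : u k * u i = 0 := by
  by_cases h : i.val = k.val + 1
  · simpa [gen] using toZig_rel (Rel.up_up k i h)
  · rw [← e_u i, ← mul_assoc, u_e_ne, zero_mul]
    intro h'; apply h; simpa [Fin.ext_iff] using h'.symm
lemma d_d (k i : Fin m) : d k * d i = 0 := by
  by_cases h : k.val = i.val + 1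
  · simpa [gen] using toZig_rel (Rel.dn_dn i k h)
  · rw [← e_d i, ← mul_assoc, d_e_ne, zero_mul]
    intro h'; apply h; simpa [Fin.ext_iff] using h'
lemma u_d_ne {k i : Fin m} (h : k ≠ i) : u k * d i = 0 := by
  rw [← e_d, ← mul_assoc, u_e_ne (by simpa using h), zero_mul]
lemma d_u_ne {k i : Fin m} (h : k ≠ i) : d k * u i = 0 := by
  rw [← e_u, ← mul_assoc, d_e_ne (by simpa using h), zero_mul]
lemma u_d_u (k i : Fin m) : u k * (d i * u i) = 0 := by
  rw [← mul_assoc]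
  by_cases h : k = i
  · subst h
    by_cases h0 : k.val = 0
    · rw [u_d_zero h0, zero_mul]
    · rw [loop_eq (i := ⟨k.val - 1, by omega⟩) (j := k) (by simp; omega), mul_assoc, u_u, mul_zero]
  · rw [u_d_ne h, zero_mul]
lemma d_d_u (k i : Fin m) : d k * (d i * u i) = 0 := by
  rw [← mul_assoc, d_d, zero_mul]
lemma d_u_u (k i : Fin m) : d i * u i * u k = 0 := by
  rw [mul_assoc, u_u, mul_zero]
lemma d_u_d (k i : Fin m) : d i * u i * d k = 0 := by
  by_cases h : i = k
  · subst h
    by_cases h0 : i.val = 0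
    · rw [mul_assoc, u_d_zero h0, mul_zero]
    · rw [mul_assoc, loop_eq (i := ⟨i.val - 1, by omega⟩) (j := i) (by simp; omega),
        ← mul_assoc, d_d, zero_mul]
  · rw [mul_assoc, u_d_ne h, mul_zero]

/-- Induction over left multiplication by generators. -/
lemma zig_induction {C : Zig m → Prop} (one : C 1) (neg : ∀ y, C y → C (-y))
    (add : ∀ x y, C x → C y → C (x + y)) (mul : ∀ g y, C y → C (gen g * y)) (x : Zig m) : C x := by
  obtain ⟨z, rfl⟩ := toZig_surjective x
  suffices h : ∀ y : Zig m, C y → C (toZig z * y) by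
    simpa using h 1 one
  induction z using FreeRing.induction_on with
  | hn1 => intro y hy; simpa using neg y hy
  | hb g => exact fun y hy => mul g y hy
  | ha a b ha hb =>
    intro y hy
    rw [map_add, add_mul]
    exact add _ _ (ha y hy) (hb y hy)
  | hm a b ha hb =>
    intro y hy
    rw [map_mul, mul_assoc]
    exact ha _ (hb y hy)

/-- A ring homomorphism out of `A_m`, from values on generators. -/
def zigLift {R : Type} [Ring R] (f : Gen m → R)
    (hf : ∀ x y, Rel m x y → FreeRing.lift f x = FreeRing.lift f y) : Zig m →+* R :=
  RingQuot.lift ⟨FreeRing.lift f, fun {x y} h => hf x y h⟩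

lemma zigLift_gen {R : Type} [Ring R] (f : Gen m → R)
    (hf : ∀ x y, Rel m x y → FreeRing.lift f x = FreeRing.lift f y) (g : Gen m) :
    zigLift f hf (gen g) = f g := by
  refine (RingQuot.lift_mkRingHom_apply _ _ _).trans ?_
  simp

/-- The homogeneous component of degree `k` of `A_m`, spanned by the paths of degree `k`. -/
def gr (m : ℕ) (k : ℤ) : Submodule ℤ (Zig m) :=
  Submodule.span ℤ {x | ∃ w : List (Gen m), (w.map Gen.degree).sum = k ∧ x = (w.map gen).prod}

lemma gen_mul_mem (g : Gen m) {n : ℤ} {x : Zig m} (hx : x ∈ gr m n) :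
    gen g * x ∈ gr m (g.degree + n) := by
  refine Submodule.span_induction (p := fun x _ => gen g * x ∈ gr m (g.degree + n)) ?_
    (by simp) (fun x y _ _ hx hy => by rw [mul_add]; exact add_mem hx hy)
    (fun c x _ hx => by rw [mul_smul_comm]; exact Submodule.smul_mem _ _ hx) hx
  rintro _ ⟨w, rfl, rfl⟩
  exact Submodule.subset_span ⟨g :: w, by simp, by simp⟩

lemma one_mem_gr : (1 : Zig m) ∈ gr m 0 := Submodule.subset_span ⟨[], by simp, by simp⟩

lemma gen_mem (g : Gen m) : gen g ∈ gr m g.degree := by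
  simpa using gen_mul_mem g one_mem_gr

lemma mul_mem_gr {k n : ℤ} {x y : Zig m} (hx : x ∈ gr m k) (hy : y ∈ gr m n) :
    x * y ∈ gr m (k + n) := by
  refine Submodule.span_induction (p := fun x _ => x * y ∈ gr m (k + n)) ?_
    (by simp) (fun x z _ _ hx hz => by rw [add_mul]; exact add_mem hx hz)
    (fun c x _ hx => by rw [smul_mul_assoc]; exact Submodule.smul_mem _ _ hx) hx
  rintro _ ⟨w, rfl, rfl⟩
  clear hx
  induction w with
  | nil => simpa using hy
  | cons g w ih =>
    simp only [List.map_cons, List.sum_cons, List.prod_cons, mul_assoc, add_assoc]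
    exact gen_mul_mem g ih

/-- The map sending a homogeneous element `x` of degree `k` to `x T ^ k`. -/
def coact (m : ℕ) : Zig m →+* AddMonoidAlgebra (Zig m) ℤ :=
  zigLift (fun g => AddMonoidAlgebra.single g.degree (gen g)) <| by
    intro x y h
    have hs : ∀ (a b : ℤ) (x y : Zig m), (AddMonoidAlgebra.single a x) *
        (AddMonoidAlgebra.single b y) = AddMonoidAlgebra.single (a + b) (x * y) :=
      fun a b x y => AddMonoidAlgebra.single_mul_single ..
    cases h with
    | vtx_self i => simp only [map_mul, FreeRing.lift_of, hs, Gen.degree, e_e, add_zero]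
    | vtx_ne i j h =>
      simp only [map_mul, FreeRing.lift_of, hs, e_e_ne h, map_zero, AddMonoidAlgebra.single_zero]
    | vtx_sum =>
      simp only [map_sum, FreeRing.lift_of, map_one, Gen.degree]
      rw [AddMonoidAlgebra.one_def, ← e_sum]
      exact (map_sum (AddMonoidAlgebra.singleAddHom 0) _ _).symm
    | vtx_up i => simp only [map_mul, FreeRing.lift_of, hs, Gen.degree, e_u, add_zero]
    | up_vtx i => simp only [map_mul, FreeRing.lift_of, hs, Gen.degree, u_e, add_zero]
    | vtx_dn i => simp only [map_mul, FreeRing.lift_of, hs, Gen.degree, e_d, zero_add]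
    | dn_vtx i => simp only [map_mul, FreeRing.lift_of, hs, Gen.degree, d_e, add_zero]
    | up_up i j h =>
      simp only [map_mul, FreeRing.lift_of, hs, u_u, map_zero, AddMonoidAlgebra.single_zero]
    | dn_dn i j h =>
      simp only [map_mul, FreeRing.lift_of, hs, d_d, map_zero, AddMonoidAlgebra.single_zero]
    | loop i j h =>
      simp only [map_mul, FreeRing.lift_of, hs, Gen.degree, loop_eq h, add_zero, zero_add]
    | up_dn_zero i h =>
      simp only [map_mul, FreeRing.lift_of, hs, u_d_zero h, map_zero, AddMonoidAlgebra.single_zero]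

lemma coact_gen (g : Gen m) : coact m (gen g) = AddMonoidAlgebra.single g.degree (gen g) :=
  zigLift_gen _ _ g

lemma coact_of_mem {k : ℤ} {x : Zig m} (hx : x ∈ gr m k) :
    coact m x = AddMonoidAlgebra.single k x := by
  refine Submodule.span_induction (p := fun x _ => coact m x = AddMonoidAlgebra.single k x) ?_
    (by simp) (fun x y _ _ hx hy => by rw [map_add, hx, hy, AddMonoidAlgebra.single_add])
    (fun c x _ hx => by
      rw [map_zsmul, hx]
      exact (map_zsmul (AddMonoidAlgebra.singleAddHom k) c x).symm) hx
  rintro _ ⟨w, rfl, rfl⟩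
  clear hx
  induction w with
  | nil => rw [List.map_nil, List.map_nil, List.prod_nil, List.sum_nil, map_one]; rfl
  | cons g w ih =>
    simp only [List.map_cons, List.sum_cons, List.prod_cons, map_mul, ih, coact_gen]
    exact AddMonoidAlgebra.single_mul_single ..

lemma isInternal_gr : DirectSum.IsInternal (gr m) := by
  apply isInternal_of_proj
  · refine zig_induction (Submodule.mem_iSup_of_mem 0 one_mem_gr) (fun _ h => neg_mem h)
      (fun _ _ => add_mem) (fun g y hy => ?_)
    refine Submodule.iSup_induction _ (motive := fun y => gen g * y ∈ ⨆ n, gr m n) hy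
      (fun n x hx => Submodule.mem_iSup_of_mem _ (gen_mul_mem g hx)) (by simp)
      (fun x y hx hy => by rw [mul_add]; exact add_mem hx hy)
  · intro n
    refine ⟨((Finsupp.applyAddHom n).comp (AddMonoidAlgebra.coeffAddEquiv.toAddMonoidHom.comp
      (coact m).toAddMonoidHom)).toIntLinearMap,
      fun x hx => ?_, fun k hk x hx => ?_⟩
    · change (coact m x).coeff n = x
      rw [coact_of_mem hx]
      exact Finsupp.single_eq_same
    · change (coact m x).coeff n = 0
      rw [coact_of_mem hx]
      exact Finsupp.single_eq_of_ne' hk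

instance : GradedRing (gr m) where
  one_mem := one_mem_gr
  mul_mem _ _ _ _ hx hy := mul_mem_gr hx hy
  toDecomposition := (isInternal_gr (m := m)).chooseDecomposition

/-! #### An additive dual basis of `A_m` -/

/-- Labels of the elements `(i)`, `(i|i+1)`, `(i+1|i)`, `(i+1|i|i+1)`. -/
abbrev Bas (m : ℕ) : Type := Fin (m + 1) ⊕ Fin m ⊕ Fin m ⊕ Fin m

/-- Left multiplication of generators on labels. -/
def act : Gen m → Bas m → Option (Bas m)
  | .vtx k, .inl i => if k = i then some (.inl i) else none
  | .vtx k, .inr (.inl i) => if k = i.castSucc then some (.inr (.inl i)) else none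
  | .vtx k, .inr (.inr (.inl i)) => if k = i.succ then some (.inr (.inr (.inl i))) else none
  | .vtx k, .inr (.inr (.inr i)) => if k = i.succ then some (.inr (.inr (.inr i))) else none
  | .up k, .inl i => if k.succ = i then some (.inr (.inl k)) else none
  | .up k, .inr (.inr (.inl i)) =>
    if k = i then
      if 0 < k.val then some (.inr (.inr (.inr ⟨k.val - 1, by omega⟩))) else none
    else none
  | .dn k, .inl i => if k.castSucc = i then some (.inr (.inr (.inl k))) else none
  | .dn k, .inr (.inl i) => if k = i then some (.inr (.inr (.inr k))) else none
  | _, _ => none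

/-- The vector attached to a label. -/
def vec : Option (Bas m) → (Bas m →₀ ℤ)
  | none => 0
  | some b => Finsupp.single b 1

lemma vec_ite {p : Prop} [Decidable p] (b : Bas m) :
    vec (if p then some b else none) = if p then Finsupp.single b 1 else 0 := by
  split_ifs <;> rfl

/-- The operator of left multiplication by a generator. -/
def genOp (g : Gen m) : Module.End ℤ (Bas m →₀ ℤ) :=
  Finsupp.linearCombination ℤ (fun b => vec (act g b))

lemma genOp_single (g : Gen m) (b : Bas m) : genOp g (Finsupp.single b 1) = vec (act g b) := by
  simp [genOp]

/-- The regular representation in terms of labels. -/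
def rep (m : ℕ) : Zig m →+* Module.End ℤ (Bas m →₀ ℤ) :=
  zigLift genOp <| by
    intro x y h
    refine Finsupp.lhom_ext' fun b => LinearMap.ext_ring ?_
    cases h with
    | vtx_self k =>
      rcases b with i | i | i | i <;>
        simp [genOp_single, act, vec] <;> split_ifs <;> simp_all [genOp_single, act, vec]
    | vtx_ne k l h =>
      rcases b with i | i | i | i <;>
        simp [genOp_single, act, vec] <;> split_ifs <;> simp_all [genOp_single, act, vec]
    | vtx_sum =>
      simp only [map_sum, FreeRing.lift_of, map_one, LinearMap.sum_apply, LinearMap.comp_apply,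
        Finsupp.lsingle_apply, genOp_single, Module.End.one_apply]
      rcases b with i | i | i | i <;>
        simp only [act, vec_ite, Finset.sum_ite_eq', Finset.mem_univ, if_true]
    | vtx_up k =>
      rcases b with i | i | i | i <;>
        simp [genOp_single, act, vec] <;> split_ifs <;> simp_all [genOp_single, act, vec]
      rw [if_pos]
      simp [Fin.ext_iff]; omega
    | up_vtx k =>
      rcases b with i | i | i | i <;>
        simp [genOp_single, act, vec] <;> split_ifs <;> simp_all [genOp_single, act, vec]
    | vtx_dn k =>
      rcases b with i | i | i | i <;>
        simp [genOp_single, act, vec] <;> split_ifs <;> simp_all [genOp_single, act, vec]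
    | dn_vtx k =>
      rcases b with i | i | i | i <;>
        simp [genOp_single, act, vec] <;> split_ifs <;> simp_all [genOp_single, act, vec]
    | up_up k l h =>
      rcases b with i | i | i | i <;>
        simp [genOp_single, act, vec] <;> split_ifs <;> simp_all [genOp_single, act, vec]
    | dn_dn k l h =>
      rcases b with i | i | i | i <;>
        simp [genOp_single, act, vec] <;> split_ifs <;> simp_all [genOp_single, act, vec]
    | loop k l h =>
      have hkl : l.castSucc = k.succ := Fin.ext (by simpa using h)
      have hl : 0 < l.val := by omega
      have hk : (⟨l.val - 1, by omega⟩ : Fin m) = k := Fin.ext (by simp [h])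
      rcases b with i | i | i | i
      · simp only [map_mul, FreeRing.lift_of, LinearMap.comp_apply, Finsupp.lsingle_apply,
          Module.End.mul_apply, genOp_single, act, hkl]
        split_ifs <;> simp [vec, genOp_single, act, hl, hk]
      all_goals simp [genOp_single, act, vec]
      all_goals split_ifs <;> simp_all [genOp_single, act, vec]
    | up_dn_zero k h =>
      rcases b with i | i | i | i <;>
        simp [genOp_single, act, vec] <;> split_ifs <;> simp_all [genOp_single, act, vec]

/-- The element of `A_m` with a given label. -/
def elt : Bas m → Zig m
  | .inl i => e i
  | .inr (.inl i) => u i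
  | .inr (.inr (.inl i)) => d i
  | .inr (.inr (.inr i)) => d i * u i

/-- The degree of a label. -/
def eltDeg : Bas m → ℤ
  | .inl _ => 0
  | .inr (.inl _) => 0
  | .inr (.inr (.inl _)) => 1
  | .inr (.inr (.inr _)) => 1

lemma elt_mem (b : Bas m) : elt b ∈ gr m (eltDeg b) := by
  rcases b with i | i | i | i
  · exact gen_mem (.vtx i)
  · exact gen_mem (.up i)
  · exact gen_mem (.dn i)
  · have := gen_mul_mem (.dn i) (gen_mem (.up i))
    rwa [show Gen.degree (.dn i) + Gen.degree (.up i) = 1 from add_zero 1] at this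

/-- Coordinates to elements. -/
def toElt (m : ℕ) : (Bas m →₀ ℤ) →ₗ[ℤ] Zig m := Finsupp.linearCombination ℤ elt

/-- The unit in coordinates. -/
def unitVec (m : ℕ) : Bas m →₀ ℤ := ∑ i, Finsupp.single (.inl i) 1

lemma toElt_unitVec : toElt m (unitVec m) = 1 := by
  simp [toElt, unitVec, elt, e_sum]

lemma toElt_vec_some (b : Bas m) : toElt m (vec (some b)) = elt b := by simp [toElt, vec]
lemma toElt_vec_none : toElt m (vec none) = 0 := map_zero _

lemma toElt_vec_act (g : Gen m) (b : Bas m) : toElt m (vec (act g b)) = gen g * elt b := by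
  rcases g with k | k | k <;> rcases b with i | i | i | i <;>
    simp only [act, elt] <;> (try split_ifs) <;> simp only [toElt_vec_some, toElt_vec_none, elt]
  case pos h => rw [h, e_e]
  case neg h => rw [e_e_ne h]
  case pos h => rw [h, e_u]
  case neg h => rw [e_u_ne h]
  case pos h => rw [h, e_d]
  case neg h => rw [e_d_ne h]
  case pos h => rw [h, ← mul_assoc, e_d]
  case neg h => rw [← mul_assoc, e_d_ne h, zero_mul]
  case pos h => rw [← h, u_e]
  case neg h => rw [u_e_ne h]
  case up.inr.inl => rw [u_u]
  case pos h h0 =>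
    rw [← h, ← loop_eq (i := ⟨k.val - 1, by omega⟩) (j := k) (by simp; omega)]
  case neg h h0 => rw [← h, u_d_zero (by omega)]
  case neg h => rw [u_d_ne h]
  case up.inr.inr.inr => rw [u_d_u]
  case pos h => rw [← h, d_e]
  case neg h => rw [d_e_ne h]
  case pos h => rw [← h]
  case neg h => rw [d_u_ne h]
  case dn.inr.inr.inl => rw [d_d]
  case dn.inr.inr.inr => rw [d_d_u]

lemma toElt_genOp (g : Gen m) (z : Bas m →₀ ℤ) : toElt m (genOp g z) = gen g * toElt m z := by
  induction z using Finsupp.induction_linear with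
  | zero => simp
  | add x y hx hy => simp only [map_add, hx, hy, mul_add]
  | single b c =>
    rw [← mul_one c, ← smul_eq_mul, ← Finsupp.smul_single, map_zsmul, map_zsmul, map_zsmul,
      genOp_single, toElt_vec_act, mul_smul_comm]
    simp [toElt]

lemma toElt_rep (a : Zig m) : toElt m (rep m a (unitVec m)) = a := by
  refine zig_induction (C := fun a => toElt m (rep m a (unitVec m)) = a) ?_ (fun y hy => ?_) (fun x y hx hy => ?_) (fun g y hy => ?_) a
  · simp [toElt_unitVec]
  · rw [map_neg, LinearMap.neg_apply, map_neg, hy]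
  · rw [map_add, LinearMap.add_apply, map_add, hx, hy]
  · rw [map_mul, Module.End.mul_apply, show rep m (gen g) = genOp g from zigLift_gen _ _ _,
      toElt_genOp, hy]

/-- The coordinate functionals. -/
def coord (b : Bas m) : Zig m →ₗ[ℤ] ℤ :=
  Finsupp.lapply b ∘ₗ ((LinearMap.applyₗ (R := ℤ) (unitVec m)).toAddMonoidHom.comp
    (rep m).toAddMonoidHom).toIntLinearMap

lemma sum_coord (a : Zig m) : ∑ b, coord b a • elt b = a := by
  conv_rhs => rw [← toElt_rep a]
  rw [toElt, Finsupp.linearCombination_apply, Finsupp.sum_fintype _ _ (by simp)]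
  rfl

lemma eltDeg_act {g : Gen m} {b c : Bas m} (h : act g b = some c) :
    eltDeg c = g.degree + eltDeg b := by
  rcases g with k | k | k <;> rcases b with i | i | i | i <;>
    simp only [act] at h <;> (try split_ifs at h) <;> cases h <;> rfl

lemma genOp_apply_eq_zero {n : ℤ} (g : Gen m) (z : Bas m →₀ ℤ) (hz : ∀ b, eltDeg b ≠ n → z b = 0)
    (c : Bas m) (hc : eltDeg c ≠ g.degree + n) : genOp g z c = 0 := by
  rw [genOp, Finsupp.linearCombination_apply, Finsupp.sum, Finsupp.finsetSum_apply]
  refine Finset.sum_eq_zero fun b _ => ?_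
  by_cases hb : eltDeg b = n
  · cases h : act g b with
    | none => simp [vec]
    | some c' =>
      have hcc : c' ≠ c := by
        rintro rfl
        exact hc (hb ▸ eltDeg_act h)
      simp [vec, Finsupp.single_eq_of_ne' hcc]
  · simp [hz b hb]

lemma coord_eq_zero {n : ℤ} {a : Zig m} (ha : a ∈ gr m n) (b : Bas m) (hb : eltDeg b ≠ n) :
    coord b a = 0 := by
  refine Submodule.span_induction (p := fun a _ => coord b a = 0) ?_ (by simp)
    (fun x y _ _ hx hy => by rw [map_add, hx, hy, add_zero])
    (fun c x _ hx => by rw [map_smul, hx, smul_zero]) ha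
  rintro _ ⟨w, rfl, rfl⟩
  change rep m (w.map gen).prod (unitVec m) b = 0
  clear ha
  induction w generalizing b with
  | nil =>
    simp only [List.map_nil, List.prod_nil, map_one, Module.End.one_apply, unitVec,
      Finsupp.finsetSum_apply]
    refine Finset.sum_eq_zero fun i _ => Finsupp.single_eq_of_ne' ?_
    rintro rfl
    exact hb rfl
  | cons g w ih =>
    rw [List.map_cons, List.prod_cons, map_mul, Module.End.mul_apply,
      show rep m (gen g) = genOp g from zigLift_gen _ _ _]
    exact genOp_apply_eq_zero g _ ih b (by simpa using hb)

/-! #### The projective modules and the bimodules `P_i ⊗ _iP` -/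

/-- The left module `P_i = A_m (i)`. -/
def P (i : Fin (m + 1)) : Submodule (Zig m) (Zig m) := Submodule.span (Zig m) {e i}

/-- The right module `_iP = (i) A_m`. -/
def Q (i : Fin (m + 1)) : Submodule (Zig m)ᵐᵒᵖ (Zig m) := Submodule.span (Zig m)ᵐᵒᵖ {e i}

/-- The grading of `P_i` induced from `A_m`. -/
def Pdeg (i : Fin (m + 1)) (n : ℤ) : Submodule ℤ (P i) :=
  (gr m n).comap (P i).subtype.toAddMonoidHom.toIntLinearMap

/-- The grading of `_iP` induced from `A_m`. -/
def Qdeg (i : Fin (m + 1)) (n : ℤ) : Submodule ℤ (Q i) :=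
  (gr m n).comap (Q i).subtype.toAddMonoidHom.toIntLinearMap

/-- The projection `a ↦ a (i)`. -/
def toP (i : Fin (m + 1)) : Zig m →ₗ[Zig m] P i :=
  LinearMap.codRestrict (P i) (LinearMap.toSpanSingleton (Zig m) (Zig m) (e i))
    fun a => Submodule.smul_mem _ a (Submodule.mem_span_singleton_self _)

/-- The projection `a ↦ (i) a`. -/
def toQ (i : Fin (m + 1)) : Zig m →ₗ[(Zig m)ᵐᵒᵖ] Q i where
  toFun a := ⟨e i * a, Submodule.smul_mem _ (MulOpposite.op a) (Submodule.mem_span_singleton_self _)⟩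
  map_add' _ _ := Subtype.ext (mul_add _ _ _)
  map_smul' _ _ := Subtype.ext (mul_assoc _ _ _).symm

@[simp] lemma coe_toP (i : Fin (m + 1)) (a : Zig m) : (toP i a : Zig m) = a * e i := rfl
@[simp] lemma coe_toQ (i : Fin (m + 1)) (a : Zig m) : (toQ i a : Zig m) = e i * a := rfl

lemma toP_coe {i : Fin (m + 1)} (p : P i) : toP i p = p := by
  obtain ⟨a, ha⟩ := Submodule.mem_span_singleton.1 p.2
  ext
  rw [coe_toP, ← ha, smul_eq_mul, mul_assoc, e_e]

lemma toQ_coe {i : Fin (m + 1)} (q : Q i) : toQ i q = q := by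
  obtain ⟨a, ha⟩ := Submodule.mem_span_singleton.1 q.2
  ext
  rw [coe_toQ, ← ha, MulOpposite.smul_eq_mul_unop, ← mul_assoc, e_e]

lemma e_mem (i : Fin (m + 1)) : e i ∈ gr m 0 := gen_mem (.vtx i)

lemma toP_mem {i : Fin (m + 1)} {n : ℤ} {a : Zig m} (ha : a ∈ gr m n) : toP i a ∈ Pdeg i n := by
  have := mul_mem_gr ha (e_mem i)
  rwa [add_zero] at this

lemma toQ_mem {i : Fin (m + 1)} {n : ℤ} {a : Zig m} (ha : a ∈ gr m n) : toQ i a ∈ Qdeg i n := by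
  have := mul_mem_gr (e_mem i) ha
  rwa [zero_add] at this

lemma isInternal_Pdeg (i : Fin (m + 1)) : DirectSum.IsInternal (Pdeg (m := m) i) := by
  have h : Pdeg (m := m) i = fun n => (gr m n).map (toP i).toAddMonoidHom.toIntLinearMap := by
    funext n
    apply le_antisymm
    · intro p hp
      exact ⟨p, hp, toP_coe p⟩
    · rintro _ ⟨a, ha, rfl⟩
      exact toP_mem ha
  rw [h]
  refine isInternal_map isInternal_gr _ (fun p => ⟨p, toP_coe p⟩) (fun n x hx => ?_)
  have hx' : x * e i = 0 := congrArg Subtype.val hx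
  refine Subtype.ext (?_ : proj isInternal_gr n x * e i = 0)
  have key : ∀ y, proj isInternal_gr n y * e i = proj isInternal_gr n (y * e i) := fun y => by
    refine grading_induction isInternal_gr
      (C := fun y => proj isInternal_gr n y * e i = proj isInternal_gr n (y * e i))
      (fun k y hy => ?_) (by simp) (fun a b ha hb => by simp only [map_add, add_mul, ha, hb]) y
    have hy' : y * e i ∈ gr m k := by simpa using mul_mem_gr hy (e_mem i)
    by_cases hk : k = n
    · subst hk; rw [proj_same _ hy, proj_same _ hy']
    · rw [proj_ne _ hk hy, proj_ne _ hk hy', zero_mul]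
  rw [key, hx', map_zero]

lemma isInternal_Qdeg (i : Fin (m + 1)) : DirectSum.IsInternal (Qdeg (m := m) i) := by
  have h : Qdeg (m := m) i = fun n => (gr m n).map (toQ i).toAddMonoidHom.toIntLinearMap := by
    funext n
    apply le_antisymm
    · intro p hp
      exact ⟨p, hp, toQ_coe p⟩
    · rintro _ ⟨a, ha, rfl⟩
      exact toQ_mem ha
  rw [h]
  refine isInternal_map isInternal_gr _ (fun p => ⟨p, toQ_coe p⟩) (fun n x hx => ?_)
  have hx' : e i * x = 0 := congrArg Subtype.val hx
  refine Subtype.ext (?_ : e i * proj isInternal_gr n x = 0)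
  have key : ∀ y, e i * proj isInternal_gr n y = proj isInternal_gr n (e i * y) := fun y => by
    refine grading_induction isInternal_gr
      (C := fun y => e i * proj isInternal_gr n y = proj isInternal_gr n (e i * y))
      (fun k y hy => ?_) (by simp) (fun a b ha hb => by simp only [map_add, mul_add, ha, hb]) y
    have hy' : e i * y ∈ gr m k := by simpa using mul_mem_gr (e_mem i) hy
    by_cases hk : k = n
    · subst hk; rw [proj_same _ hy, proj_same _ hy']
    · rw [proj_ne _ hk hy, proj_ne _ hk hy', mul_zero]
  rw [key, hx', map_zero]

/-- The right `A_m`-action on `P_i ⊗ _iP` through the second factor. -/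
abbrev rightModule (i : Fin (m + 1)) : Module (Zig m)ᵐᵒᵖ (P i ⊗[ℤ] Q i) where
  smul a t := LinearMap.lTensor (P i) (DistribSMul.toAddMonoidHom (Q i) a).toIntLinearMap t
  one_smul t := by
    change LinearMap.lTensor (P i) (DistribSMul.toAddMonoidHom (Q i) 1).toIntLinearMap t = t
    have h : (DistribSMul.toAddMonoidHom (Q i) (1 : (Zig m)ᵐᵒᵖ)).toIntLinearMap = LinearMap.id := by
      ext; simp
    rw [h, LinearMap.lTensor_id_apply]
  mul_smul a b t := by
    change LinearMap.lTensor (P i) (DistribSMul.toAddMonoidHom (Q i) (a * b)).toIntLinearMap t =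
      LinearMap.lTensor (P i) (DistribSMul.toAddMonoidHom (Q i) a).toIntLinearMap
        (LinearMap.lTensor (P i) (DistribSMul.toAddMonoidHom (Q i) b).toIntLinearMap t)
    rw [← LinearMap.lTensor_comp_apply]
    congr 2
    ext; simp [mul_smul]
  smul_zero a := map_zero _
  smul_add a := map_add _
  add_smul a b t := by
    change LinearMap.lTensor (P i) (DistribSMul.toAddMonoidHom (Q i) (a + b)).toIntLinearMap t =
      LinearMap.lTensor (P i) (DistribSMul.toAddMonoidHom (Q i) a).toIntLinearMap t +
        LinearMap.lTensor (P i) (DistribSMul.toAddMonoidHom (Q i) b).toIntLinearMap t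
    rw [← LinearMap.add_apply, ← LinearMap.lTensor_add]
    congr 2
    ext; simp [add_smul]
  zero_smul t := by
    change LinearMap.lTensor (P i) (DistribSMul.toAddMonoidHom (Q i) 0).toIntLinearMap t = 0
    have h : (DistribSMul.toAddMonoidHom (Q i) (0 : (Zig m)ᵐᵒᵖ)).toIntLinearMap = 0 := by
      ext; simp
    rw [h, LinearMap.lTensor_zero, LinearMap.zero_apply]

lemma PQ_hasDualBasis (i : Fin (m + 1)) :
    FinGrMod.HasDualBasis (𝒜 := gr m) (tensorDeg (Pdeg (m := m) i) (Qdeg i)) := by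
  let φ : Bas m → (P i ⊗[ℤ] Q i) →ₗ[Zig m] Zig m := fun b =>
    TensorProduct.AlgebraTensorModule.lift
      { toFun := fun p => (AddMonoidHom.mk' (fun q : Q i => coord b q • (p : Zig m))
          fun x y => by simp [add_smul]).toIntLinearMap
        map_add' := fun p p' => by ext q; simp
        map_smul' := fun a p => by
          ext q
          change coord b q • (a * (p : Zig m)) = a * (coord b q • (p : Zig m))
          rw [mul_smul_comm] }
  have hφ : ∀ b p q, φ b (p ⊗ₜ q) = coord b q • (p : Zig m) := fun _ _ _ => rfl
  refine ⟨Bas m, inferInstance, eltDeg, fun b => toP i (e i) ⊗ₜ toQ i (elt b), φ, ?_, ?_, ?_⟩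
  · intro b
    exact tmul_mem_tensorDeg (zero_add _) (toP_mem (e_mem i)) (toQ_mem (elt_mem b))
  · intro b n t ht
    refine Submodule.span_induction (p := fun t _ => φ b t ∈ gr m (n - eltDeg b)) ?_ (by simp)
      (fun x y _ _ hx hy => by rw [map_add]; exact add_mem hx hy)
      (fun c x _ hx => by rw [map_zsmul]; exact Submodule.smul_mem _ _ hx) ht
    rintro _ ⟨k, l, rfl, p, hp, q, hq, rfl⟩
    rw [hφ]
    by_cases hb : eltDeg b = l
    · rw [hb, add_sub_cancel_right]
      exact Submodule.smul_mem _ _ hp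
    · rw [coord_eq_zero (show (q : Zig m) ∈ gr m l from hq) b hb, zero_smul]
      exact zero_mem _
  · intro t
    induction t using TensorProduct.induction_on with
    | zero => simp
    | add s t hs ht => simp only [map_add, add_smul, Finset.sum_add_distrib, hs, ht]
    | tmul p q =>
      have h1 : ∀ b, φ b (p ⊗ₜ q) • (toP i (e i) ⊗ₜ[ℤ] toQ i (elt b) : P i ⊗[ℤ] Q i) =
          p ⊗ₜ[ℤ] toQ i (coord b q • elt b) := by
        intro b
        rw [hφ, TensorProduct.smul_tmul', map_zsmul, TensorProduct.tmul_smul,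
          TensorProduct.smul_tmul']
        congr 1
        ext
        have := congrArg Subtype.val (toP_coe p)
        rw [coe_toP] at this
        simp [mul_assoc, e_e, this]
      simp only [h1]
      rw [← TensorProduct.tmul_sum, ← map_sum, sum_coord, toQ_coe]

lemma finite_of_hasDualBasis {A : Type} [Ring A] {𝒜 : ℤ → Submodule ℤ A} {M : Type}
    [AddCommGroup M] [Module A M] {deg : ℤ → Submodule ℤ M}
    (h : FinGrMod.HasDualBasis (𝒜 := 𝒜) deg) : Module.Finite A M := by
  obtain ⟨ι, _, k, b, φ, -, -, hs⟩ := h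
  exact Module.Finite.of_surjective (Fintype.linearCombination A b)
    fun x => ⟨fun i => φ i x, (Fintype.linearCombination_apply _ _ _).trans (hs x)⟩

/-- The graded `A_m`-bimodule `P_i ⊗ _iP`, the tensor product being over `ℤ`. -/
def PQ (i : Fin (m + 1)) : GrBimod (gr m) where
  carrier := P i ⊗[ℤ] Q i
  left := TensorProduct.leftModule
  right := rightModule i
  comm := by
    let _ := rightModule (m := m) i
    refine ⟨fun a b t => ?_⟩
    induction t using TensorProduct.induction_on with
    | zero => simp
    | add s t hs ht => simp only [smul_add, hs, ht]
    | tmul p q => rfl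
  deg := tensorDeg (Pdeg i) (Qdeg i)
  isInternal := isInternal_tensorDeg (isInternal_Pdeg i) (isInternal_Qdeg i)
  smul_mem := by
    intro k n a t ha ht
    refine Submodule.span_induction
      (p := fun t _ => a • t ∈ tensorDeg (Pdeg i) (Qdeg i) (k + n)) ?_ (by simp)
      (fun x y _ _ hx hy => by rw [smul_add]; exact add_mem hx hy)
      (fun c x _ hx => by rw [smul_comm]; exact Submodule.smul_mem _ _ hx) ht
    rintro _ ⟨k', l, rfl, p, hp, q, hq, rfl⟩
    exact tmul_mem_tensorDeg (x := a • p) (add_assoc k k' l) (mul_mem_gr ha hp) hq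
  op_smul_mem := by
    intro k n a t ha ht
    let _ := rightModule (m := m) i
    refine Submodule.span_induction
      (p := fun t _ => MulOpposite.op a • t ∈ tensorDeg (Pdeg i) (Qdeg i) (n + k)) ?_ (by simp)
      (fun x y _ _ hx hy => by rw [smul_add]; exact add_mem hx hy)
      (fun c x _ hx => by rw [smul_comm]; exact Submodule.smul_mem _ _ hx) ht
    rintro _ ⟨k', l, rfl, p, hp, q, hq, rfl⟩
    exact tmul_mem_tensorDeg (y := MulOpposite.op a • q) (add_assoc k' l k).symm hp
      (mul_mem_gr hq ha)
  finite := finite_of_hasDualBasis (PQ_hasDualBasis i)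

/-- The element `x (i) ⊗ (i) y` of `P_i ⊗ _iP`. -/
def pq (i : Fin (m + 1)) (x y : Zig m) : PQ i := (toP i x ⊗ₜ[ℤ] toQ i y : P i ⊗[ℤ] Q i)

lemma smul_pq (i : Fin (m + 1)) (a x y : Zig m) : a • pq i x y = pq i (a * x) y :=
  congrArg (fun p => (p ⊗ₜ[ℤ] toQ i y : P i ⊗[ℤ] Q i)) ((toP i).map_smul a x).symm

lemma op_smul_pq (i : Fin (m + 1)) (a x y : Zig m) :
    MulOpposite.op a • pq i x y = pq i x (y * a) :=
  congrArg (fun q => (toP i x ⊗ₜ[ℤ] q : P i ⊗[ℤ] Q i))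
    ((toQ i).map_smul (MulOpposite.op a) y).symm

lemma pq_zero_left (i : Fin (m + 1)) (y : Zig m) : pq i 0 y = 0 := by
  have : (toP i 0 ⊗ₜ[ℤ] toQ i y : P i ⊗[ℤ] Q i) = 0 := by simp
  exact this

lemma pq_zero_right (i : Fin (m + 1)) (x : Zig m) : pq i x 0 = 0 := by
  have : (toP i x ⊗ₜ[ℤ] toQ i 0 : P i ⊗[ℤ] Q i) = 0 := by simp
  exact this

lemma pq_mem (i : Fin (m + 1)) {k l n : ℤ} (h : k + l = n) {x y : Zig m} (hx : x ∈ gr m k)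
    (hy : y ∈ gr m l) : pq i x y ∈ (PQ i).deg n :=
  tmul_mem_tensorDeg h (toP_mem hx) (toQ_mem hy)

/-- The multiplication map `x ⊗ y ↦ x y` on `P_i ⊗ _iP`. -/
def mulPQ (i : Fin (m + 1)) : (P i ⊗[ℤ] Q i) →ₗ[Zig m] Zig m :=
  TensorProduct.AlgebraTensorModule.lift
    { toFun := fun p => (AddMonoidHom.mk' (fun q : Q i => (p : Zig m) * (q : Zig m))
        fun x y => by simp [mul_add]).toIntLinearMap
      map_add' := fun p p' => by ext q; simp [add_mul]
      map_smul' := fun a p => by ext q; simp [mul_assoc] }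

lemma mulPQ_tmul (i : Fin (m + 1)) (p : P i) (q : Q i) :
    mulPQ i (p ⊗ₜ q) = (p : Zig m) * (q : Zig m) := rfl

/-- The bimodule homomorphism `β_i : P_i ⊗ _iP ⟶ A_m`; it sends `x ⊗ y` to `x y`, so it is the
bimodule homomorphism with `β_i ((i) ⊗ (i)) = (i)`. -/
def β (i : Fin (m + 1)) : GrBimod.Hom (PQ i) (GrBimod.regular (gr m)) where
  toLin := mulPQ i
  map_op_smul a t := by
    change P i ⊗[ℤ] Q i at t
    let _ := rightModule (m := m) i
    change mulPQ i (MulOpposite.op a • t) = mulPQ i t * a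
    induction t using TensorProduct.induction_on with
    | zero => rw [smul_zero, map_zero, zero_mul]
    | add s t hs ht => rw [smul_add, map_add, hs, ht, map_add, add_mul]
    | tmul p q => exact (mul_assoc (p : Zig m) (q : Zig m) a).symm
  map_mem n t ht := by
    change P i ⊗[ℤ] Q i at t
    change mulPQ i t ∈ gr m n
    refine Submodule.span_induction (p := fun t _ => mulPQ i t ∈ gr m n) ?_ (by simp)
      (fun x y _ _ hx hy => by rw [map_add]; exact add_mem hx hy)
      (fun c x _ hx => by rw [map_zsmul]; exact Submodule.smul_mem _ _ hx) ht
    rintro _ ⟨k, l, rfl, p, hp, q, hq, rfl⟩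
    exact mul_mem_gr hp hq

/-- The element `γ_v(1)` of `P_v ⊗ _vP`, where `v = i + 1` is the vertex `i.succ`:
`(v-1|v) ⊗ (v|v-1) + (v+1|v) ⊗ (v|v+1) + (v) ⊗ (v|v-1|v) + (v|v-1|v) ⊗ (v)`,
without the second term if `v = m`. -/
def γElt (i : Fin m) : PQ i.succ :=
  pq i.succ (u i) (d i) +
  (if h : i.val + 1 < m then pq i.succ (d ⟨i.val + 1, h⟩) (u ⟨i.val + 1, h⟩) else 0) +
  pq i.succ (e i.succ) (d i * u i) + pq i.succ (d i * u i) (e i.succ)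

lemma γElt_mem (i : Fin m) : γElt i ∈ (PQ i.succ).deg 1 := by
  have hu : ∀ j : Fin m, u j ∈ gr m 0 := fun j => gen_mem (.up j)
  have hd : ∀ j : Fin m, d j ∈ gr m 1 := fun j => gen_mem (.dn j)
  have hdu : d i * u i ∈ gr m 1 := by simpa using mul_mem_gr (hd i) (hu i)
  refine add_mem (add_mem (add_mem ?_ ?_) ?_) ?_
  · exact pq_mem _ (by norm_num) (hu i) (hd i)
  · split_ifs with h
    · exact pq_mem _ (by norm_num) (hd _) (hu _)
    · exact zero_mem _
  · exact pq_mem _ (by norm_num) (e_mem _) hdu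
  · exact pq_mem _ (by norm_num) hdu (e_mem _)

lemma smul_γElt (i : Fin m) (a : Zig m) : a • γElt i =
    pq i.succ (a * u i) (d i) +
    (if h : i.val + 1 < m then pq i.succ (a * d ⟨i.val + 1, h⟩) (u ⟨i.val + 1, h⟩) else 0) +
    pq i.succ (a * e i.succ) (d i * u i) + pq i.succ (a * (d i * u i)) (e i.succ) := by
  rw [γElt, smul_add, smul_add, smul_add]
  split_ifs <;> simp only [smul_pq, smul_zero]

lemma op_smul_γElt (i : Fin m) (a : Zig m) : MulOpposite.op a • γElt i =
    pq i.succ (u i) (d i * a) +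
    (if h : i.val + 1 < m then pq i.succ (d ⟨i.val + 1, h⟩) (u ⟨i.val + 1, h⟩ * a) else 0) +
    pq i.succ (e i.succ) (d i * u i * a) + pq i.succ (d i * u i) (e i.succ * a) := by
  rw [γElt, smul_add, smul_add, smul_add]
  split_ifs <;> simp only [op_smul_pq, smul_zero]

lemma γElt_gen (i : Fin m) (g : Gen m) :
    MulOpposite.op (gen g) • γElt i = gen g • γElt i := by
  rw [smul_γElt, op_smul_γElt]
  rcases g with k | k | k
  · have h1 : pq i.succ (u i) (d i * e k) = pq i.succ (e k * u i) (d i) := by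
      by_cases h : k = i.castSucc
      · subst h; rw [d_e, e_u]
      · rw [d_e_ne (Ne.symm h), e_u_ne h, pq_zero_left, pq_zero_right]
    have h2 : ∀ j : Fin m, pq i.succ (d j) (u j * e k) = pq i.succ (e k * d j) (u j) := by
      intro j
      by_cases h : k = j.succ
      · subst h; rw [u_e, e_d]
      · rw [u_e_ne (Ne.symm h), e_d_ne h, pq_zero_left, pq_zero_right]
    have h3 : pq i.succ (e i.succ) (d i * u i * e k) = pq i.succ (e k * e i.succ) (d i * u i) := by
      by_cases h : k = i.succ
      · subst h; rw [mul_assoc, u_e, e_e]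
      · rw [mul_assoc, u_e_ne (Ne.symm h), e_e_ne h, mul_zero, pq_zero_left, pq_zero_right]
    have h4 : pq i.succ (d i * u i) (e i.succ * e k) =
        pq i.succ (e k * (d i * u i)) (e i.succ) := by
      by_cases h : k = i.succ
      · subst h; rw [← mul_assoc, e_d, e_e]
      · rw [← mul_assoc, e_d_ne h, e_e_ne (Ne.symm h), zero_mul, pq_zero_left, pq_zero_right]
    rw [h1, h3, h4]
    simp only [h2]
  · rw [u_u, d_u_u, u_d_u, pq_zero_left, pq_zero_right, pq_zero_left]
    simp only [u_u, pq_zero_right]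
    have h1 : pq i.succ (u i) (d i * u k) = pq i.succ (u k * e i.succ) (d i * u i) := by
      by_cases h : k = i
      · subst h; rw [u_e]
      · rw [d_u_ne (Ne.symm h), u_e_ne (by simpa using h), pq_zero_left, pq_zero_right]
    have h2 : pq i.succ (d i * u i) (e i.succ * u k) = if h : i.val + 1 < m then
        pq i.succ (u k * d ⟨i.val + 1, h⟩) (u ⟨i.val + 1, h⟩) else 0 := by
      by_cases hk : k.val = i.val + 1
      · have h : i.val + 1 < m := by omega
        obtain rfl : k = ⟨i.val + 1, h⟩ := Fin.ext hk
        rw [dif_pos h, loop_eq (i := i) rfl]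
        have := e_u (⟨i.val + 1, h⟩ : Fin m)
        rw [show (⟨i.val + 1, h⟩ : Fin m).castSucc = i.succ from Fin.ext rfl] at this
        rw [this]
      · have h0 : e i.succ * u k = 0 := e_u_ne (fun h => hk (by simpa using (Fin.ext_iff.1 h).symm))
        rw [h0, pq_zero_right]
        split_ifs with h
        · rw [u_d_ne (fun h' => hk (Fin.ext_iff.1 h')), pq_zero_left]
        · rfl
    rw [h1, h2]
    simp only [dite_eq_ite, ite_self]
    abel
  · rw [d_d, d_u_d, d_d_u, pq_zero_left, pq_zero_right, pq_zero_right]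
    simp only [d_d, pq_zero_left]
    have h1 : pq i.succ (d i * u i) (e i.succ * d k) = pq i.succ (d k * u i) (d i) := by
      by_cases h : k = i
      · subst h; rw [e_d]
      · rw [d_u_ne h, e_d_ne (by simpa using Ne.symm h), pq_zero_left, pq_zero_right]
    have h2 : pq i.succ (d k * e i.succ) (d i * u i) = if h : i.val + 1 < m then
        pq i.succ (d ⟨i.val + 1, h⟩) (u ⟨i.val + 1, h⟩ * d k) else 0 := by
      by_cases hk : k.val = i.val + 1
      · have h : i.val + 1 < m := by omega
        obtain rfl : k = ⟨i.val + 1, h⟩ := Fin.ext hk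
        rw [dif_pos h, loop_eq (i := i) rfl]
        have := d_e (⟨i.val + 1, h⟩ : Fin m)
        rw [show (⟨i.val + 1, h⟩ : Fin m).castSucc = i.succ from Fin.ext rfl] at this
        rw [this]
      · have h0 : d k * e i.succ = 0 := d_e_ne (fun h => hk (by simpa using Fin.ext_iff.1 h))
        rw [h0, pq_zero_left]
        split_ifs with h
        · rw [u_d_ne (fun h' => hk (Fin.ext_iff.1 h').symm), pq_zero_right]
        · rfl
    rw [h1, h2]
    simp only [dite_eq_ite, ite_self]
    abel

lemma γElt_comm (i : Fin m) (a : Zig m) : MulOpposite.op a • γElt i = a • γElt i := by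
  refine zig_induction (C := fun a => MulOpposite.op a • γElt i = a • γElt i)
    (by simp) (fun y hy => by simp [hy]) (fun x y hx hy => by simp [add_smul, hx, hy])
    (fun g y hy => ?_) a
  rw [MulOpposite.op_mul, mul_smul, γElt_gen, mul_smul, ← hy]
  exact (smul_comm (gen g) (MulOpposite.op y) (γElt i)).symm

/-- The bimodule homomorphism `γ_v : A_m ⟶ P_v ⊗ _vP {-1}` with the given value at `1`,
where `v = i + 1`. -/
def γ (i : Fin m) : GrBimod.Hom (GrBimod.regular (gr m)) ((PQ i.succ).shift (-1)) where
  toLin := (LinearMap.toSpanSingleton (Zig m) (PQ i.succ) (γElt i) : Zig m →ₗ[Zig m] PQ i.succ)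
  map_op_smul a x := by
    change Zig m at x
    change (x * a) • γElt i = MulOpposite.op a • x • γElt i
    rw [mul_smul, ← γElt_comm]
    exact smul_comm x (MulOpposite.op a) (γElt i)
  map_mem n x hx := by
    have := (PQ i.succ).smul_mem (show x ∈ gr m n from hx) (γElt_mem i)
    rwa [show n + 1 = n - -1 by ring] at this

/-! #### The functors -/

/-- The category `A_m-mod` of finitely generated graded left `A_m`-modules. -/
abbrev AMod (m : ℕ) : Type 1 := FinGrMod (gr m)

/-- The category `P(A_m-mod)`. -/
abbrev CCat (m : ℕ) : Type 1 := BoundedProj (AMod m)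

lemma regular_hasDualBasis : FinGrMod.HasDualBasis (𝒜 := gr m) (GrBimod.regular (gr m)).deg :=
  ⟨Unit, inferInstance, fun _ => 0, fun _ => (1 : Zig m), fun _ => LinearMap.id (M := Zig m),
    fun _ => one_mem_gr, fun _ n x hx => by rw [sub_zero]; exact hx, fun x => by
      rw [Fintype.sum_unique]
      exact mul_one (show Zig m from x)⟩

lemma shift_hasDualBasis {B : GrBimod (gr m)} (k : ℤ)
    (h : FinGrMod.HasDualBasis (𝒜 := gr m) B.deg) :
    FinGrMod.HasDualBasis (𝒜 := gr m) (B.shift k).deg := by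
  obtain ⟨ι, hι, l, b, φ, hb, hφ, hs⟩ := h
  refine ⟨ι, hι, fun i => l i + k, b, φ, fun i => ?_, fun i n x hx => ?_, hs⟩
  · have := hb i
    rwa [← add_sub_cancel_right (l i) k] at this
  · have := hφ i _ x hx
    rwa [show n - k - l i = n - (l i + k) by ring] at this

/-- The functor `R_v`, where `v = i + 1`: tensoring over `A_m` with the complex of bimodules
`0 ⟶ P_v ⊗ _vP ⟶ A_m ⟶ 0` with differential `β_v` and `A_m` in degree `0`. The total complex of
the tensor product with a complex `M` is the cone of
`β_v ⊗ M : (P_v ⊗ _vP) ⊗ M ⟶ A_m ⊗ M`. -/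
def R (i : Fin m) : CCat m ⥤ CCat m :=
  coneEndofunctor (GrBimod.tensorNat (β i.succ))
    (fun _ _ => GrBimod.projective_tensor _ (PQ_hasDualBasis _) _)
    (fun _ _ => GrBimod.projective_tensor _ regular_hasDualBasis _)

/-- The functor `R'_v`, where `v = i + 1`: tensoring over `A_m` with the complex of bimodules
`0 ⟶ A_m ⟶ P_v ⊗ _vP {-1} ⟶ 0` with differential `γ_v` and `A_m` in degree `0`. The total complex
of the tensor product with a complex `M` is the cone of
`-γ_v ⊗ M : A_m ⊗ M ⟶ (P_v ⊗ _vP {-1}) ⊗ M`, shifted by `[-1]`. -/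
def R' (i : Fin m) : CCat m ⥤ CCat m :=
  shiftedConeEndofunctor (GrBimod.tensorNat (γ i).neg)
    (fun _ _ => GrBimod.projective_tensor _ regular_hasDualBasis _)
    (fun _ _ => GrBimod.projective_tensor _ (shift_hasDualBasis _ (PQ_hasDualBasis _)) _)

end ZigzagRing

/-! ### The braid group -/

/-- Artin's relations `σ_i σ_{i+1} σ_i = σ_{i+1} σ_i σ_{i+1}` and `σ_i σ_j = σ_j σ_i` for
`|i - j| > 1`, for `m` generators. -/
inductive BraidRel (m : ℕ) : FreeGroup (Fin m) → Prop
  | braid (i j : Fin m) : j.val = i.val + 1 → BraidRel m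
      (.of i * .of j * .of i * (.of j * .of i * .of j)⁻¹)
  | comm (i j : Fin m) : i.val + 1 < j.val → BraidRel m
      (.of i * .of j * (.of j * .of i)⁻¹)

/-- The braid group `B_{m+1}` on `m + 1` strands. -/
abbrev Braid (m : ℕ) : Type := PresentedGroup {w | BraidRel m w}

/-- The standard generators. -/
def σ {m : ℕ} (i : Fin m) : Braid m := PresentedGroup.of i

end KS

end

/-! Write U_v for the functor of tensoring with P_v ⊗ _vP, and b_v : U_v → Id for the map induced by
β_v. Once A ⊗_A M is identified with M, R_v is the cone of b_v, and R'_v[1] is the cone of a map g_v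
: Id → V_v, where V_v = U_v{-1}.

All the algebra comes from the corners of A_m. The group (v)A(v) is free on (v) and the loop x_v =
(v|v-1|v), the group (v)A(w) has rank at most one for neighbours v, w, and it vanishes for vertices
further apart. Hence U_v U_w = 0 for distant v, w. For neighbours v, w ≥ 1 the loop x_v factors
through w, so the map U_v U_w U_v → U_v U_v given by b_w and the comultiplication U_v → U_v U_v
together form an isomorphism U_v U_w U_v ⊕ U_v ≅ U_v U_v (`splits_braid`). In the same way g_v and
comultiplications give U_v ⊕ V_v ≅ U_v V_v and U_v ⊕ V_v ≅ V_v U_v (`splits_whiskerRight`,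
`splits_whiskerLeft`). These are the Temperley–Lieb relations.

The rest is formal. If (a, s) : A ⊕ C → B is an isomorphism, then C is homotopy equivalent to the
cone of a (`isHEquiv_comp_inr`), and cones may be replaced along homotopy equivalences
(`isHEquiv_coneMap`).

Inverses: U_v applied to the cone of g_v becomes V_v, so the cone of b_v over the cone of g_v
becomes the cone of the inclusion of V_v into the cone of g_v, which is the shift [1]. The other
order is similar.

Distant commutation: both products are equivalent to the cone of U_v → Id → cone(b_w).

Braid relation: put Φ = R_v R_w. As Φ commutes with cones, R_v R_w R_v is the cone of Φ U_v → Φ,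
while R_w R_v R_w is the cone of U_w Φ → Φ. Both Φ U_v and U_w Φ are equivalent to U_w U_v[1], and
the two resulting maps U_w U_v[1] → Φ agree up to a sign (`braidLift_comp`, `braidLift'_comp`). So
both sides are equivalent to the cone of `braidMap`.

All comparison maps are natural on the level of complexes. Homotopy inverses need not be: a natural
map, or a roof of natural maps, of objectwise homotopy equivalences already gives an isomorphism of
functors on the homotopy category. Finally, the classes of the R_v are units in the monoid of
isomorphism classes of endofunctors and satisfy Artin's relations, so the braid group maps to these
units; choosing representatives gives the weak action. -/

noncomputable section

open CategoryTheory.Limits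
open scoped TensorProduct

namespace KS

/-! ### Homotopy equivalences between functors on complexes -/

section ChainLevel

open CochainComplex CochainComplex.HomComplex Pretriangulated

universe v₁ u₁

variable {𝓐 : Type u₁} [Category.{v₁} 𝓐] [Preadditive 𝓐]

/-- A chain map which is invertible up to homotopy. -/
def IsHEquiv {K L : CochainComplex 𝓐 ℤ} (f : K ⟶ L) : Prop :=
  IsIso ((HomotopyCategory.quotient 𝓐 (ComplexShape.up ℤ)).map f)

section
variable {K L N : CochainComplex 𝓐 ℤ}

lemma _root_.HomotopyEquiv.isHEquiv (e : HomotopyEquiv K L) : IsHEquiv e.hom :=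
  inferInstanceAs (IsIso (HomotopyCategory.isoOfHomotopyEquiv e).hom)

lemma isHEquiv_of_isIso (f : K ⟶ L) [IsIso f] : IsHEquiv f := by
  unfold IsHEquiv; infer_instance

lemma IsHEquiv.comp {f : K ⟶ L} {g : L ⟶ N} (hf : IsHEquiv f) (hg : IsHEquiv g) :
    IsHEquiv (f ≫ g) := by
  unfold IsHEquiv at *
  rw [Functor.map_comp]; infer_instance

lemma IsHEquiv.of_comp_right {f : K ⟶ L} {g : L ⟶ N} (hg : IsHEquiv g) (h : IsHEquiv (f ≫ g)) :
    IsHEquiv f := by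
  unfold IsHEquiv at *
  rw [Functor.map_comp] at h
  exact IsIso.of_isIso_comp_right _ ((HomotopyCategory.quotient 𝓐 (ComplexShape.up ℤ)).map g)

/-- Needed because one of the two lifts in the braid relation covers `braidMap` only up to a sign.
-/
lemma IsHEquiv.neg {f : K ⟶ L} (hf : IsHEquiv f) : IsHEquiv (-f) := by
  unfold IsHEquiv at *
  rw [Functor.map_neg]
  exact ⟨-inv ((HomotopyCategory.quotient 𝓐 (ComplexShape.up ℤ)).map f), by simp, by simp⟩

lemma IsHEquiv.of_homotopy {f : K ⟶ L} {g : L ⟶ K} (h₁ : Homotopy (f ≫ g) (𝟙 K))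
    (h₂ : Homotopy (g ≫ f) (𝟙 L)) : IsHEquiv f :=
  HomotopyEquiv.isHEquiv ⟨f, g, h₁, h₂⟩

end

/-- Functors on complexes which induce endofunctors of `P(𝓐)`. -/
class Descends (Φ : CochainComplex 𝓐 ℤ ⥤ CochainComplex 𝓐 ℤ) : Prop where
  homotopy : ∀ {K L : CochainComplex 𝓐 ℤ} (f g : K ⟶ L), Homotopy f g →
      Nonempty (Homotopy (Φ.map f) (Φ.map g))
  boundedProj : ∀ K, isBoundedProjective 𝓐 K → isBoundedProjective 𝓐 (Φ.obj K)

/-- The induced endofunctor of `P(𝓐)`. -/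
abbrev induced (Φ : CochainComplex 𝓐 ℤ ⥤ CochainComplex 𝓐 ℤ) [h : Descends Φ] :
    BoundedProj 𝓐 ⥤ BoundedProj 𝓐 :=
  descend Φ h.homotopy h.boundedProj

instance Descends.comp (Φ Ψ : CochainComplex 𝓐 ℤ ⥤ CochainComplex 𝓐 ℤ) [Descends Φ] [Descends Ψ] :
    Descends (Φ ⋙ Ψ) where
  homotopy f g h := (Descends.homotopy (Φ := Φ) f g h).elim (Descends.homotopy (Φ := Ψ) _ _)
  boundedProj K hK := Descends.boundedProj (Φ := Ψ) _ (Descends.boundedProj (Φ := Φ) K hK)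

instance : Descends (𝟭 (CochainComplex 𝓐 ℤ)) where
  homotopy _ _ h := ⟨h⟩
  boundedProj _ hK := hK

instance (n : ℤ) : Descends (CategoryTheory.shiftFunctor (CochainComplex 𝓐 ℤ) n) where
  homotopy _ _ h := ⟨h.shift n⟩
  boundedProj K hK := by
    obtain ⟨hp, a, b, hab⟩ := hK
    exact ⟨fun k => hp (k + n), a - n, b - n, fun k hk => hab (k + n) (by omega)⟩

/-- A natural map between functors on complexes which is a homotopy equivalence on each object
induces an isomorphism of endofunctors of `P(𝓐)`. -/
def inducedIso {Φ Ψ : CochainComplex 𝓐 ℤ ⥤ CochainComplex 𝓐 ℤ} [Descends Φ] [Descends Ψ]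
    (θ : Φ ⟶ Ψ) (hθ : ∀ K, IsHEquiv (θ.app K)) : induced Φ ≅ induced Ψ :=
  NatIso.ofComponents (fun X => ObjectProperty.isoMk _
      (@asIso _ _ _ _ ((HomotopyCategory.quotient 𝓐 _).map (θ.app X.obj.as)) (hθ _)))
    (by
      rintro X Y ⟨f⟩
      -- Every morphism of the homotopy category is the class of a chain map, so naturality of `θ`
      -- on complexes is enough.
      obtain ⟨f, rfl⟩ := (HomotopyCategory.quotient 𝓐 (ComplexShape.up ℤ)).map_surjective f
      apply InducedCategory.Hom.ext
      change (HomotopyCategory.quotient 𝓐 _).map (Φ.map f) ≫ (HomotopyCategory.quotient 𝓐 _).map _ =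
        (HomotopyCategory.quotient 𝓐 _).map _ ≫ (HomotopyCategory.quotient 𝓐 _).map (Ψ.map f)
      rw [← Functor.map_comp, ← Functor.map_comp, θ.naturality])

/-- Induced functors are compatible with composition. -/
def inducedComp (Φ Ψ : CochainComplex 𝓐 ℤ ⥤ CochainComplex 𝓐 ℤ) [Descends Φ] [Descends Ψ] :
    induced Φ ⋙ induced Ψ ≅ induced (Φ ⋙ Ψ) :=
  NatIso.ofComponents (fun X => Iso.refl _) (by
      rintro X Y ⟨f⟩
      obtain ⟨f, rfl⟩ := (HomotopyCategory.quotient 𝓐 (ComplexShape.up ℤ)).map_surjective f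
      exact (Category.comp_id _).trans (Category.id_comp _).symm)

/-- The identity functor induces the identity. -/
def inducedId : induced (𝟭 (CochainComplex 𝓐 ℤ)) ≅ 𝟭 _ :=
  NatIso.ofComponents (fun X => Iso.refl _) (by
      rintro X Y ⟨f⟩
      obtain ⟨f, rfl⟩ := (HomotopyCategory.quotient 𝓐 (ComplexShape.up ℤ)).map_surjective f
      exact (Category.comp_id _).trans (Category.id_comp _).symm)

variable [HasBinaryBiproducts 𝓐]

/-- The five lemma for cones. -/
lemma isHEquiv_coneMap [HasZeroObject 𝓐] {K₁ L₁ K₂ L₂ : CochainComplex 𝓐 ℤ} {φ₁ : K₁ ⟶ L₁}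
    {φ₂ : K₂ ⟶ L₂} {a : K₁ ⟶ K₂} {b : L₁ ⟶ L₂} (comm : φ₁ ≫ b = a ≫ φ₂)
    (ha : IsHEquiv a) (hb : IsHEquiv b) : IsHEquiv (mappingCone.map φ₁ φ₂ a b comm) :=
  isIso₃_of_isIso₁₂
    ((HomotopyCategory.quotient 𝓐 (ComplexShape.up ℤ)).mapTriangle.map
      (mappingCone.triangleMap φ₁ φ₂ a b comm))
    (HomotopyCategory.mappingCone_triangleh_distinguished φ₁)
    (HomotopyCategory.mappingCone_triangleh_distinguished φ₂) ha hb

lemma inr_coneMap {K₁ L₁ K₂ L₂ : CochainComplex 𝓐 ℤ} {φ₁ : K₁ ⟶ L₁}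
    {φ₂ : K₂ ⟶ L₂} {a : K₁ ⟶ K₂} {b : L₁ ⟶ L₂} (comm : φ₁ ≫ b = a ≫ φ₂) :
    mappingCone.inr φ₁ ≫ mappingCone.map φ₁ φ₂ a b comm = b ≫ mappingCone.inr φ₂ := by
  simp [mappingCone.map]

lemma inr_coneMap_assoc {K₁ L₁ K₂ L₂ : CochainComplex 𝓐 ℤ} {φ₁ : K₁ ⟶ L₁}
    {φ₂ : K₂ ⟶ L₂} {a : K₁ ⟶ K₂} {b : L₁ ⟶ L₂} (comm : φ₁ ≫ b = a ≫ φ₂)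
    {N : CochainComplex 𝓐 ℤ} (h : mappingCone φ₂ ⟶ N) :
    mappingCone.inr φ₁ ≫ mappingCone.map φ₁ φ₂ a b comm ≫ h = b ≫ mappingCone.inr φ₂ ≫ h := by
  rw [← Category.assoc, inr_coneMap, Category.assoc]

/-- If `(a, s) : A ⊞ C ⟶ B` is an isomorphism, then `C` is homotopy equivalent to the cone
of `a`. -/
lemma isHEquiv_comp_inr {A B C : CochainComplex 𝓐 ℤ} (a : A ⟶ B) (s : C ⟶ B) (ρ : B ⟶ A)
    (π : B ⟶ C) (haπ : a ≫ π = 0) (hsπ : s ≫ π = 𝟙 C) (hsum : ρ ≫ a + π ≫ s = 𝟙 B)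
    (haρ : a ≫ ρ = 𝟙 A) :
    IsHEquiv (s ≫ mappingCone.inr a) := by
  -- The homotopy inverse is `π` on `B` and zero on the shifted `A`; it is a chain map by `haπ`, and
  -- a strict left inverse by `hsπ`.
  refine IsHEquiv.of_homotopy
    (g := mappingCone.desc a 0 π (by rw [haπ, δ_zero, Cochain.ofHom_zero]))
    (Homotopy.ofEq (by simp [hsπ])) ?_
  -- The homotopy is zero on `A` and carries `B` back to `A` by `-ρ`. It works on `A` because `a ≫ ρ
  -- = 𝟙 A`, and on `B` because `π ≫ s = 𝟙 B - ρ ≫ a`.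
  refine mappingCone.descHomotopy _ _ _ 0
    (-(Cochain.ofHom ρ).comp (mappingCone.inl a) (zero_add (-1))) ?_ ?_
  · ext p
    simp [← Cochain.comp_assoc_of_first_is_zero_cochain, ← Cochain.ofHom_comp, haρ]
  · have h : π ≫ s = 𝟙 B - ρ ≫ a := by rw [← hsum]; abel
    simp [reassoc_of% h]
    abel

end ChainLevel

/-! ### Iterated cones of commutative squares, and functors compatible with cones. -/

section Interchange

open CochainComplex CochainComplex.HomComplex

universe v₁ u₁

variable {𝓐 : Type u₁} [Category.{v₁} 𝓐] [Preadditive 𝓐] [HasBinaryBiproducts 𝓐]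

open mappingCone

lemma inl_coneMap_f {K₁ L₁ K₂ L₂ : CochainComplex 𝓐 ℤ} {φ₁ : K₁ ⟶ L₁}
    {φ₂ : K₂ ⟶ L₂} {a : K₁ ⟶ K₂} {b : L₁ ⟶ L₂} (comm : φ₁ ≫ b = a ≫ φ₂) (p q : ℤ)
    (h : p + (-1) = q) :
    (inl φ₁).v p q h ≫ (mappingCone.map φ₁ φ₂ a b comm).f q = a.f p ≫ (inl φ₂).v p q h := by
  simp [mappingCone.map]

lemma inr_coneMap_f {K₁ L₁ K₂ L₂ : CochainComplex 𝓐 ℤ} {φ₁ : K₁ ⟶ L₁}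
    {φ₂ : K₂ ⟶ L₂} {a : K₁ ⟶ K₂} {b : L₁ ⟶ L₂} (comm : φ₁ ≫ b = a ≫ φ₂) (p : ℤ) :
    (inr φ₁).f p ≫ (mappingCone.map φ₁ φ₂ a b comm).f p = b.f p ≫ (inr φ₂).f p := by
  simp [mappingCone.map]

lemma inl_coneMap_f_assoc {K₁ L₁ K₂ L₂ : CochainComplex 𝓐 ℤ} {φ₁ : K₁ ⟶ L₁}
    {φ₂ : K₂ ⟶ L₂} {a : K₁ ⟶ K₂} {b : L₁ ⟶ L₂} (comm : φ₁ ≫ b = a ≫ φ₂) (p q : ℤ)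
    (h : p + (-1) = q) {Z : 𝓐} (z : (mappingCone φ₂).X q ⟶ Z) :
    (inl φ₁).v p q h ≫ (mappingCone.map φ₁ φ₂ a b comm).f q ≫ z = a.f p ≫ (inl φ₂).v p q h ≫ z := by
  rw [← Category.assoc, inl_coneMap_f, Category.assoc]

lemma inr_coneMap_f_assoc {K₁ L₁ K₂ L₂ : CochainComplex 𝓐 ℤ} {φ₁ : K₁ ⟶ L₁}
    {φ₂ : K₂ ⟶ L₂} {a : K₁ ⟶ K₂} {b : L₁ ⟶ L₂} (comm : φ₁ ≫ b = a ≫ φ₂) (p : ℤ)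
    {Z : 𝓐} (z : (mappingCone φ₂).X p ⟶ Z) :
    (inr φ₁).f p ≫ (mappingCone.map φ₁ φ₂ a b comm).f p ≫ z = b.f p ≫ (inr φ₂).f p ≫ z := by
  rw [← Category.assoc, inr_coneMap_f, Category.assoc]

lemma inl_coneMap {K₁ L₁ K₂ L₂ : CochainComplex 𝓐 ℤ} {φ₁ : K₁ ⟶ L₁}
    {φ₂ : K₂ ⟶ L₂} {a : K₁ ⟶ K₂} {b : L₁ ⟶ L₂} (comm : φ₁ ≫ b = a ≫ φ₂) :
    (inl φ₁).comp (Cochain.ofHom (mappingCone.map φ₁ φ₂ a b comm)) (add_zero (-1)) =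
      (Cochain.ofHom a).comp (inl φ₂) (zero_add (-1)) := by
  simp [mappingCone.map]

section Transpose

variable {K L K' L' : CochainComplex 𝓐 ℤ} {f : K ⟶ L} {f' : K' ⟶ L'} {k : K ⟶ K'} {l : L ⟶ L'}
  (comm : f ≫ l = k ≫ f')

/-- The map exchanging the two directions in the iterated cone of a commutative square. -/
def transposeHom : mappingCone (mappingCone.map f f' k l comm) ⟶
    mappingCone (mappingCone.map k l f f' comm.symm) :=
  desc _
    -- The corner `K` is shifted twice, once for each direction; exchanging the two shifts forces
    -- the sign.
    (descCochain f (m := -2) (-((inl k).comp (inl (mappingCone.map k l f f' comm.symm)) (by norm_num)))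
      ((inl l).comp (Cochain.ofHom (inr (mappingCone.map k l f f' comm.symm))) (by norm_num))
      (by norm_num))
    (desc f' ((Cochain.ofHom (inr k)).comp (inl (mappingCone.map k l f f' comm.symm)) (zero_add _))
      (inr l ≫ inr (mappingCone.map k l f f' comm.symm)) (by
        rw [δ_ofHom_comp, δ_inl, ← Cochain.ofHom_comp, ← Category.assoc, inr_coneMap,
          Category.assoc]))
    (by
      rw [δ_descCochain _ _ _ _ _ (neg_add_cancel 1), δ_neg,
        δ_comp _ _ (show (-1 : ℤ) + -1 = -2 by norm_num) 0 0 (-1) (by norm_num)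
        (by norm_num) (by norm_num)]
      simp only [δ_inl, δ_comp_ofHom]
      rw [ext_cochain_from_iff f (-1) 0 (neg_add_cancel 1)]
      constructor
      · rw [Cochain.comp_add, inl_fst_assoc, inl_snd_assoc]
        ext p q hpq
        simp [inl_coneMap_f_assoc]
      · rw [Cochain.comp_add, inr_fst_assoc, inr_snd_assoc, zero_add, ← Cochain.ofHom_comp,
          ← Cochain.ofHom_comp, inr_coneMap_assoc, inr_desc, Category.assoc])

-- On the four corners of the square the transposition is a permutation, with a single sign at the
-- doubly shifted corner. The following formulas record this matrix, and identities of maps out of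
-- an iterated cone are checked with them corner by corner.
@[simp]
lemma inr_inr_transposeHom_f (p : ℤ) : (inr f').f p ≫ (inr _).f p ≫ (transposeHom comm).f p =
    (inr l).f p ≫ (inr _).f p := by
  simp [transposeHom]

@[simp]
lemma inl_inr_transposeHom_f (p q : ℤ) (h : p + -1 = q) :
    (inl f').v p q h ≫ (inr _).f q ≫ (transposeHom comm).f q =
    (inr k).f p ≫ (inl _).v p q h := by
  simp [transposeHom]

@[simp]
lemma inr_inl_transposeHom_f (p q : ℤ) (h : p + -1 = q) :
    (inr f).f p ≫ (inl _).v p q h ≫ (transposeHom comm).f q =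
    (inl l).v p q h ≫ (inr _).f q := by
  simp [transposeHom]

@[simp]
lemma inl_inl_transposeHom_f (p q r : ℤ) (h : p + -1 = q) (h' : q + -1 = r) :
    (inl f).v p q h ≫ (inl _).v q r h' ≫ (transposeHom comm).f r =
    - (inl k).v p q h ≫ (inl _).v q r h' := by
  simp [transposeHom, Cochain.comp_v _ _ _ p q r h h']

@[simp]
lemma inr_inr_transposeHom_f_assoc (p : ℤ) {Z : 𝓐}
    (z : (mappingCone (mappingCone.map k l f f' comm.symm)).X p ⟶ Z) :
    (inr f').f p ≫ (inr _).f p ≫ (transposeHom comm).f p ≫ z = (inr l).f p ≫ (inr _).f p ≫ z := by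
  simpa only [Category.assoc] using congrArg (fun t => t ≫ z) (inr_inr_transposeHom_f comm p)

@[simp]
lemma inl_inr_transposeHom_f_assoc (p q : ℤ) (h : p + -1 = q) {Z : 𝓐}
    (z : (mappingCone (mappingCone.map k l f f' comm.symm)).X q ⟶ Z) :
    (inl f').v p q h ≫ (inr _).f q ≫ (transposeHom comm).f q ≫ z =
      (inr k).f p ≫ (inl _).v p q h ≫ z := by
  simpa only [Category.assoc] using congrArg (fun t => t ≫ z) (inl_inr_transposeHom_f comm p q h)

@[simp]
lemma inr_inl_transposeHom_f_assoc (p q : ℤ) (h : p + -1 = q) {Z : 𝓐}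
    (z : (mappingCone (mappingCone.map k l f f' comm.symm)).X q ⟶ Z) :
    (inr f).f p ≫ (inl _).v p q h ≫ (transposeHom comm).f q ≫ z =
      (inl l).v p q h ≫ (inr _).f q ≫ z := by
  simpa only [Category.assoc] using congrArg (fun t => t ≫ z) (inr_inl_transposeHom_f comm p q h)

@[simp]
lemma inl_inl_transposeHom_f_assoc (p q r : ℤ) (h : p + -1 = q) (h' : q + -1 = r) {Z : 𝓐}
    (z : (mappingCone (mappingCone.map k l f f' comm.symm)).X r ⟶ Z) :
    (inl f).v p q h ≫ (inl _).v q r h' ≫ (transposeHom comm).f r ≫ z =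
      (- (inl k).v p q h ≫ (inl _).v q r h') ≫ z := by
  simpa only [Category.assoc] using
    congrArg (fun t => t ≫ z) (inl_inl_transposeHom_f comm p q r h h')

lemma ext_from_cone_cone {n : ℤ} {Z : 𝓐} {x y : (mappingCone (mappingCone.map f f' k l comm)).X n ⟶ Z}
    (h₁ : ∀ p q (h : p + -1 = q) (h' : q + -1 = n), (inl f).v p q h ≫ (inl _).v q n h' ≫ x =
      (inl f).v p q h ≫ (inl _).v q n h' ≫ y)
    (h₂ : ∀ p (h : p + -1 = n), (inr f).f p ≫ (inl _).v p n h ≫ x =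
      (inr f).f p ≫ (inl _).v p n h ≫ y)
    (h₃ : ∀ p (h : p + -1 = n), (inl f').v p n h ≫ (inr _).f n ≫ x =
      (inl f').v p n h ≫ (inr _).f n ≫ y)
    (h₄ : (inr f').f n ≫ (inr _).f n ≫ x = (inr f').f n ≫ (inr _).f n ≫ y) : x = y := by
  apply ext_from _ (n + 1) n rfl
  · apply ext_from _ (n + 1 + 1) (n + 1) rfl
    · exact h₁ _ _ _ _
    · exact h₂ _ _
  · apply ext_from _ (n + 1) n rfl
    · exact h₃ _ _
    · exact h₄

lemma transposeHom_comp : transposeHom comm ≫ transposeHom comm.symm = 𝟙 _ := by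
  ext n
  apply ext_from_cone_cone <;> intros <;> simp

/-- The two iterated cones of a commutative square. -/
@[simps]
def transposeIso : mappingCone (mappingCone.map f f' k l comm) ≅
    mappingCone (mappingCone.map k l f f' comm.symm) where
  hom := transposeHom comm
  inv := transposeHom comm.symm
  hom_inv_id := transposeHom_comp comm
  inv_hom_id := transposeHom_comp comm.symm

/-- Naturality of the transposition for a commutative cube. The equations `h₅` and `h₆` enter
because the outer cone maps are formed from them. -/
lemma coneMap_transposeHom {K₁ L₁ K₁' L₁' : CochainComplex 𝓐 ℤ} {f₁ : K₁ ⟶ L₁} {f₁' : K₁' ⟶ L₁'}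
    {k₁ : K₁ ⟶ K₁'} {l₁ : L₁ ⟶ L₁'} (comm₁ : f₁ ≫ l₁ = k₁ ≫ f₁') {a : K ⟶ K₁} {b : L ⟶ L₁}
    {a' : K' ⟶ K₁'} {b' : L' ⟶ L₁'} (h₁ : f ≫ b = a ≫ f₁) (h₂ : f' ≫ b' = a' ≫ f₁')
    (h₃ : k ≫ a' = a ≫ k₁) (h₄ : l ≫ b' = b ≫ l₁)
    (h₅ : mappingCone.map f f' k l comm ≫ mappingCone.map f' f₁' a' b' h₂ =
      mappingCone.map f f₁ a b h₁ ≫ mappingCone.map f₁ f₁' k₁ l₁ comm₁)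
    (h₆ : mappingCone.map k l f f' comm.symm ≫ mappingCone.map l l₁ b b' h₄ =
      mappingCone.map k k₁ a a' h₃ ≫ mappingCone.map k₁ l₁ f₁ f₁' comm₁.symm) :
    mappingCone.map _ _ _ _ h₅ ≫ transposeHom comm₁ = transposeHom comm ≫ mappingCone.map _ _ _ _ h₆ := by
  ext n
  apply ext_from_cone_cone <;> intros <;>
    simp [inl_coneMap_f_assoc, inr_coneMap_f_assoc, inl_coneMap_f, inr_coneMap_f]

lemma neg_neg_comp_add_neg_comp {A B C D E : 𝓐} (h : A ⟶ B) (x : B ⟶ C) (y : C ⟶ D) (z : B ⟶ E)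
    (w : E ⟶ D) : (- -(h ≫ x)) ≫ y + (-(h ≫ z)) ≫ w = h ≫ (x ≫ y - z ≫ w) := by
  simp [sub_eq_add_neg]

/-- The two summands that `K⟦1⟧` reaches in the cone of `inr φ` carry opposite signs. This is the
origin of the sign in `rotate_transposeHom`. -/
lemma rotateHomotopyEquiv_hom_f (φ : K ⟶ L) (p : ℤ) : (rotateHomotopyEquiv φ).hom.f p =
    (K.shiftFunctorObjXIso 1 p (p + 1) rfl).hom ≫
      (φ.f (p + 1) ≫ (inl (inr φ)).v (p + 1) p (by omega) -
        (inl φ).v (p + 1) p (by omega) ≫ (inr (inr φ)).f p) := by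
  simp only [rotateHomotopyEquiv, Int.reduceNeg, lift_f _ _ _ _ _ (p + 1) rfl, shiftFunctor_obj_X', Cocycle.coe_neg,
    Cocycle.leftShift_coe, Cocycle.ofHom_coe, Cochain.neg_v,
    (Cochain.ofHom φ).leftShift_v 1 1 (zero_add 1) p (p + 1) rfl (p + 1) (by lia), mul_one,
    (inl φ).leftShift_v 1 0 (neg_add_cancel 1) p p (add_zero p) (p + 1) (by lia),
      sub_self, mul_zero, Int.zero_ediv, add_zero, Int.negOnePow_one,
    Int.negOnePow_zero,
    Cochain.ofHom_v, Units.neg_smul, one_smul]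
  exact neg_neg_comp_add_neg_comp _ _ _ _ _

/-- The two ways of mapping `Z⟦1⟧` to the iterated cone of a commutative square,
where `Z` maps to the two middle corners, differ by a sign. -/
lemma rotate_transposeHom {Z : CochainComplex 𝓐 ℤ} (z : Z ⟶ L) (y : Z ⟶ K') (h : z ≫ l = y ≫ f')
    (h₁ : inr z ≫ mappingCone.map z f' y l h = inr f ≫ mappingCone.map f f' k l comm)
    (h₂ : inr y ≫ mappingCone.map y l z f' h.symm =
      inr k ≫ mappingCone.map k l f f' comm.symm) :
    (rotateHomotopyEquiv z).hom ≫ mappingCone.map _ _ (inr f) (mappingCone.map z f' y l h) h₁ ≫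
      transposeHom comm =
    -((rotateHomotopyEquiv y).hom ≫
      mappingCone.map _ _ (inr k) (mappingCone.map y l z f' h.symm) h₂) := by
  ext p
  rw [HomologicalComplex.neg_f_apply, HomologicalComplex.comp_f, HomologicalComplex.comp_f, HomologicalComplex.comp_f,
    rotateHomotopyEquiv_hom_f, rotateHomotopyEquiv_hom_f, Category.assoc, Category.assoc, ← Preadditive.comp_neg]
  congr 1
  -- Transposition interchanges the two terms of the difference describing the rotation, which
  -- reverses its sign.
  simp only [Preadditive.sub_comp, Category.assoc, inl_coneMap_f_assoc, inr_coneMap_f_assoc, inl_coneMap_f, inr_coneMap_f,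
    inr_inl_transposeHom_f, inl_inr_transposeHom_f, neg_sub]

/-- `rotateHomotopyEquiv` is natural. -/
lemma rotate_naturality (comm : f ≫ l = k ≫ f')
    (h : inr f ≫ mappingCone.map f f' k l comm = l ≫ inr f') :
    (rotateHomotopyEquiv f).hom ≫ mappingCone.map _ _ l (mappingCone.map f f' k l comm) h =
      k⟦(1 : ℤ)⟧' ≫ (rotateHomotopyEquiv f').hom := by
  ext p
  rw [HomologicalComplex.comp_f, HomologicalComplex.comp_f, 
    rotateHomotopyEquiv_hom_f, rotateHomotopyEquiv_hom_f, Category.assoc]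
  -- The identifications of the terms of a shifted complex are identities by definition.
  change _ = k.f (p + 1) ≫ 𝟙 _ ≫ _
  rw [Category.id_comp]
  refine (Category.id_comp _).trans ?_
  have := congr_fun (congr_arg HomologicalComplex.Hom.f comm) (p + 1)
  rw [HomologicalComplex.comp_f, HomologicalComplex.comp_f] at this
  simp only [Preadditive.sub_comp, Preadditive.comp_sub, Category.assoc, inl_coneMap_f_assoc, inr_coneMap_f_assoc, inl_coneMap_f, inr_coneMap_f,
    reassoc_of% this]
  rfl

end Transpose

/-- A functor on complexes which is compatible with cones. -/
class CommCone (Φ : CochainComplex 𝓐 ℤ ⥤ CochainComplex 𝓐 ℤ) where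
  iso {K L : CochainComplex 𝓐 ℤ} (f : K ⟶ L) : Φ.obj (mappingCone f) ≅ mappingCone (Φ.map f)
  map_coneMap {K L K' L' : CochainComplex 𝓐 ℤ} {f : K ⟶ L} {f' : K' ⟶ L'} {k : K ⟶ K'} {l : L ⟶ L'}
    (comm : f ≫ l = k ≫ f') : Φ.map (mappingCone.map f f' k l comm) ≫ (iso f').hom =
      (iso f).hom ≫ mappingCone.map (Φ.map f) (Φ.map f') (Φ.map k) (Φ.map l)
        (by rw [← Φ.map_comp, comm, Φ.map_comp])

instance : CommCone (𝟭 (CochainComplex 𝓐 ℤ)) where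
  iso f := Iso.refl _
  map_coneMap _ := by
    rw [Iso.refl_hom, Iso.refl_hom]
    exact (Category.comp_id _).trans (Category.id_comp _).symm

instance (Φ Ψ : CochainComplex 𝓐 ℤ ⥤ CochainComplex 𝓐 ℤ) [CommCone Φ] [CommCone Ψ] :
    CommCone (Φ ⋙ Ψ) where
  iso f := Ψ.mapIso (CommCone.iso f) ≪≫ CommCone.iso (Φ.map f)
  map_coneMap comm := by
    dsimp
    rw [← Ψ.map_comp_assoc, CommCone.map_coneMap, Ψ.map_comp, Category.assoc, CommCone.map_coneMap,
      Category.assoc]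

/-- The functor `F` on complexes induced by an additive functor. -/
abbrev mapC (F : 𝓐 ⥤ 𝓐) [F.Additive] : CochainComplex 𝓐 ℤ ⥤ CochainComplex 𝓐 ℤ :=
  F.mapHomologicalComplex (ComplexShape.up ℤ)

section
variable (F : 𝓐 ⥤ 𝓐) [F.Additive] {K L : CochainComplex 𝓐 ℤ} (f : K ⟶ L)

/-- The inverse has a cone as its source, so in this form it is determined by its composites with
`inl` and `inr`. Compatibility statements for `mapC F` are reduced to these. -/
lemma mapHomologicalComplexIso_inv : (mapHomologicalComplexIso f F).inv =
    desc ((mapC F).map f) ((inl f).map F) ((mapC F).map (inr f))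
      (by rw [δ_map, δ_inl, ← Functor.map_comp, Cochain.map_ofHom]) := by
  ext n
  rw [desc_f _ _ _ _ n (n + 1) rfl]
  rfl

lemma inr_mapHomologicalComplexIso_inv : inr ((mapC F).map f) ≫ (mapHomologicalComplexIso f F).inv =
    (mapC F).map (inr f) := by
  rw [mapHomologicalComplexIso_inv, inr_desc]

lemma inr_mapHomologicalComplexIso_inv_assoc {N : CochainComplex 𝓐 ℤ}
    (h : (mapC F).obj (mappingCone f) ⟶ N) :
    inr ((mapC F).map f) ≫ (mapHomologicalComplexIso f F).inv ≫ h = (mapC F).map (inr f) ≫ h := by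
  rw [← Category.assoc, inr_mapHomologicalComplexIso_inv]

lemma inl_mapHomologicalComplexIso_inv : (inl ((mapC F).map f)).comp
    (Cochain.ofHom (mapHomologicalComplexIso f F).inv) (add_zero (-1)) = (inl f).map F := by
  rw [mapHomologicalComplexIso_inv, inl_desc]

end

lemma hom_ext_from_cone {K L N : CochainComplex 𝓐 ℤ} {f : K ⟶ L} {x y : mappingCone f ⟶ N}
    (h₁ : (inl f).comp (Cochain.ofHom x) (add_zero (-1)) =
      (inl f).comp (Cochain.ofHom y) (add_zero (-1))) (h₂ : inr f ≫ x = inr f ≫ y) : x = y := by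
  apply Cochain.ofHom_injective
  rw [ext_cochain_from_iff f (-1) 0 (neg_add_cancel 1)]
  exact ⟨h₁, by rw [← Cochain.ofHom_comp, ← Cochain.ofHom_comp, h₂]⟩

instance (F : 𝓐 ⥤ 𝓐) [F.Additive] : CommCone (mapC F) where
  iso f := mapHomologicalComplexIso f F
  map_coneMap {K L K' L' f f' k l} comm := by
    rw [← Iso.inv_comp_eq, ← Category.assoc, ← Iso.eq_comp_inv]
    apply hom_ext_from_cone
    · rw [Cochain.ofHom_comp, Cochain.ofHom_comp, ← Cochain.comp_assoc_of_third_is_zero_cochain,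
        ← Cochain.comp_assoc_of_third_is_zero_cochain, inl_coneMap, inl_mapHomologicalComplexIso_inv,
        Cochain.comp_assoc_of_third_is_zero_cochain, inl_mapHomologicalComplexIso_inv,
        ← Cochain.map_ofHom, ← Cochain.map_ofHom, ← Cochain.map_comp, ← Cochain.map_comp,
        inl_coneMap]
    · rw [inr_mapHomologicalComplexIso_inv_assoc, inr_coneMap_assoc, inr_mapHomologicalComplexIso_inv,
        ← Functor.map_comp, ← Functor.map_comp, inr_coneMap]

/-- A natural map between functors compatible with cones. -/
class CommConeHom {Φ Ψ : CochainComplex 𝓐 ℤ ⥤ CochainComplex 𝓐 ℤ} [CommCone Φ] [CommCone Ψ]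
    (σ : Φ ⟶ Ψ) : Prop where
  comm {K L : CochainComplex 𝓐 ℤ} (f : K ⟶ L) :
    σ.app (mappingCone f) ≫ (CommCone.iso (Φ := Ψ) f).hom = (CommCone.iso (Φ := Φ) f).hom ≫
      mappingCone.map (Φ.map f) (Ψ.map f) (σ.app K) (σ.app L) (σ.naturality f)

end Interchange

/-! ### Cones of natural maps as functors on complexes. -/

section ChCone
open CochainComplex CochainComplex.HomComplex

universe v₁ u₁

variable {𝓐 : Type u₁} [Category.{v₁} 𝓐] [Preadditive 𝓐] [HasBinaryBiproducts 𝓐]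

open mappingCone

variable {Φ Ψ Φ' Ψ' : CochainComplex 𝓐 ℤ ⥤ CochainComplex 𝓐 ℤ}

/-- The cone of a natural map between functors on complexes. -/
abbrev chCone (σ : Φ ⟶ Ψ) : CochainComplex 𝓐 ℤ ⥤ CochainComplex 𝓐 ℤ where
  obj K := mappingCone (σ.app K)
  map f := mappingCone.map _ _ (Φ.map f) (Ψ.map f) (σ.naturality f).symm
  map_id K := by
    simp only [CategoryTheory.Functor.map_id]
    exact mappingCone.map_id _
  map_comp f g := by
    simp only [CategoryTheory.Functor.map_comp]
    exact mappingCone.map_comp _ _ _ _ _ _ _ _ _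

lemma coneMap_comp {K₁ L₁ K₂ L₂ K₃ L₃ : CochainComplex 𝓐 ℤ} {φ₁ : K₁ ⟶ L₁} {φ₂ : K₂ ⟶ L₂}
    {φ₃ : K₃ ⟶ L₃} {a : K₁ ⟶ K₂} {b : L₁ ⟶ L₂} (comm : φ₁ ≫ b = a ≫ φ₂)
    {a' : K₂ ⟶ K₃} {b' : L₂ ⟶ L₃} (comm' : φ₂ ≫ b' = a' ≫ φ₃) :
    mappingCone.map φ₁ φ₂ a b comm ≫ mappingCone.map φ₂ φ₃ a' b' comm' =
      mappingCone.map φ₁ φ₃ (a ≫ a') (b ≫ b')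
        (by rw [reassoc_of% comm, comm', Category.assoc]) :=
  (mappingCone.map_comp _ _ _ _ _ _ _ _ _).symm

lemma coneMap_comp_assoc {K₁ L₁ K₂ L₂ K₃ L₃ : CochainComplex 𝓐 ℤ} {φ₁ : K₁ ⟶ L₁} {φ₂ : K₂ ⟶ L₂}
    {φ₃ : K₃ ⟶ L₃} {a : K₁ ⟶ K₂} {b : L₁ ⟶ L₂} (comm : φ₁ ≫ b = a ≫ φ₂)
    {a' : K₂ ⟶ K₃} {b' : L₂ ⟶ L₃} (comm' : φ₂ ≫ b' = a' ≫ φ₃) {N : CochainComplex 𝓐 ℤ}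
    (h : mappingCone φ₃ ⟶ N) :
    mappingCone.map φ₁ φ₂ a b comm ≫ mappingCone.map φ₂ φ₃ a' b' comm' ≫ h =
      mappingCone.map φ₁ φ₃ (a ≫ a') (b ≫ b')
        (by rw [reassoc_of% comm, comm', Category.assoc]) ≫ h := by
  rw [← Category.assoc, coneMap_comp]

lemma coneMap_congr {K₁ L₁ K₂ L₂ : CochainComplex 𝓐 ℤ} {φ₁ : K₁ ⟶ L₁} {φ₂ : K₂ ⟶ L₂}
    {a a' : K₁ ⟶ K₂} {b b' : L₁ ⟶ L₂} (comm : φ₁ ≫ b = a ≫ φ₂) (ha : a = a') (hb : b = b') :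
    mappingCone.map φ₁ φ₂ a b comm = mappingCone.map φ₁ φ₂ a' b' (by rw [← ha, ← hb, comm]) := by
  subst ha hb; rfl

/-- Maps between cones of natural maps. -/
def chConeMap (σ : Φ ⟶ Ψ) (σ' : Φ' ⟶ Ψ') (p : Φ ⟶ Φ') (q : Ψ ⟶ Ψ')
    (w : ∀ K, σ.app K ≫ q.app K = p.app K ≫ σ'.app K) :
    chCone σ ⟶ chCone σ' where
  app K := mappingCone.map _ _ (p.app K) (q.app K) (w K)
  naturality K L f := by
    dsimp
    rw [coneMap_comp, coneMap_comp]
    exact coneMap_congr _ (p.naturality f) (q.naturality f)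

lemma isHEquiv_chConeMap [HasZeroObject 𝓐] (σ : Φ ⟶ Ψ) (σ' : Φ' ⟶ Ψ') (p : Φ ⟶ Φ') (q : Ψ ⟶ Ψ')
    (w : ∀ K, σ.app K ≫ q.app K = p.app K ≫ σ'.app K) (K : CochainComplex 𝓐 ℤ)
    (hp : IsHEquiv (p.app K)) (hq : IsHEquiv (q.app K)) :
    IsHEquiv ((chConeMap σ σ' p q w).app K) :=
  isHEquiv_coneMap (w K) hp hq

/-- The inclusion into the cone. -/
def chInr (σ : Φ ⟶ Ψ) : Ψ ⟶ chCone σ where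
  app K := inr (σ.app K)
  naturality K L f := (inr_coneMap (σ.naturality f).symm).symm

/-- Isomorphic maps have isomorphic cones. -/
@[simps]
def coneMapIso {K₁ L₁ K₂ L₂ : CochainComplex 𝓐 ℤ} {φ₁ : K₁ ⟶ L₁}
    {φ₂ : K₂ ⟶ L₂} (a : K₁ ≅ K₂) (b : L₁ ≅ L₂) (comm : φ₁ ≫ b.hom = a.hom ≫ φ₂) :
    mappingCone φ₁ ≅ mappingCone φ₂ where
  hom := mappingCone.map _ _ a.hom b.hom comm
  inv := mappingCone.map _ _ a.inv b.inv (by rw [Iso.comp_inv_eq, Category.assoc, comm,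
    Iso.inv_hom_id_assoc])
  hom_inv_id := by
    rw [coneMap_comp, coneMap_congr _ a.hom_inv_id b.hom_inv_id, mappingCone.map_id]
  inv_hom_id := by
    rw [coneMap_comp, coneMap_congr _ a.inv_hom_id b.inv_hom_id, mappingCone.map_id]

/-- The cone of `σ` over the cone of `f` becomes, by the compatibility of `Φ` and `Ψ`, an iterated
cone of the naturality square of `σ` at `f`. Transposing the square exchanges the order in which the
two cones are taken. -/
instance [CommCone Φ] [CommCone Ψ] (σ : Φ ⟶ Ψ) [CommConeHom σ] : CommCone (chCone σ) where
  iso f := (coneMapIso (CommCone.iso (Φ := Φ) f) (CommCone.iso (Φ := Ψ) f)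
    (CommConeHom.comm f)) ≪≫ transposeIso (σ.naturality f)
  map_coneMap {K L K' L' f f' k l} comm := by
    dsimp only [Iso.trans_hom, coneMapIso_hom, transposeIso_hom]
    rw [coneMapIso_hom, coneMapIso_hom, transposeIso_hom, transposeIso_hom, coneMap_comp_assoc]
    refine Eq.trans ?_ (Category.assoc _ _ _).symm
    have h₁ : mappingCone.map (Φ.map f) (Ψ.map f) (σ.app K) (σ.app L) (σ.naturality f) ≫
        mappingCone.map (Ψ.map f) (Ψ.map f') (Ψ.map k) (Ψ.map l)
          (by rw [← Ψ.map_comp, comm, Ψ.map_comp]) =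
        mappingCone.map (Φ.map f) (Φ.map f') (Φ.map k) (Φ.map l)
          (by rw [← Φ.map_comp, comm, Φ.map_comp]) ≫
        mappingCone.map (Φ.map f') (Ψ.map f') (σ.app K') (σ.app L') (σ.naturality f') := by
      rw [coneMap_comp, coneMap_comp]
      exact coneMap_congr _ (σ.naturality k).symm (σ.naturality l).symm
    rw [← coneMap_transposeHom (σ.naturality f) (σ.naturality f')
      (by rw [← Φ.map_comp, comm, Φ.map_comp]) (by rw [← Ψ.map_comp, comm, Ψ.map_comp])
      (σ.naturality k).symm (σ.naturality l).symm h₁, coneMap_comp_assoc]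
    congr 1
    exact coneMap_congr _ (CommCone.map_coneMap comm) (CommCone.map_coneMap comm)

/-- Functors compatible with cones are compatible with cones of natural maps. -/
def commConeNatIso (Θ : CochainComplex 𝓐 ℤ ⥤ CochainComplex 𝓐 ℤ) [CommCone Θ] (σ : Φ ⟶ Ψ) :
    chCone σ ⋙ Θ ≅ chCone (Functor.whiskerRight σ Θ) :=
  NatIso.ofComponents (fun K => CommCone.iso (Φ := Θ) (σ.app K))
    (fun f => CommCone.map_coneMap (σ.naturality f).symm)

end ChCone

/-! ### Cones of natural transformations to and from the identity functor. -/

section Braiding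

open CochainComplex CochainComplex.HomComplex mappingCone

universe v₁ u₁

variable {𝓐 : Type u₁} [Category.{v₁} 𝓐] [Preadditive 𝓐]

/-- The map of complexes induced by a natural transformation, in each degree. -/
abbrev mapNat {F G : 𝓐 ⥤ 𝓐} [F.Additive] [G.Additive] (α : F ⟶ G) : mapC F ⟶ mapC G :=
  NatTrans.mapHomologicalComplex α (ComplexShape.up ℤ)

/-- The map from the functor on complexes to the identity induced by a natural transformation. -/
abbrev mapNatTo {F : 𝓐 ⥤ 𝓐} [F.Additive] (α : F ⟶ 𝟭 𝓐) : mapC F ⟶ 𝟭 _ := mapNat α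

/-- The map from the identity to the functor on complexes induced by a natural transformation. -/
abbrev mapNatFrom {F : 𝓐 ⥤ 𝓐} [F.Additive] (α : 𝟭 𝓐 ⟶ F) : 𝟭 _ ⟶ mapC F := mapNat α

instance (F : 𝓐 ⥤ 𝓐) [F.Additive] [F.PreservesProjectiveObjects] : Descends (mapC F) where
  homotopy _ _ h := ⟨F.mapHomotopy h⟩
  boundedProj K hK := by
    obtain ⟨hp, a, b, hab⟩ := hK
    exact ⟨fun n => have := hp n; F.projective_obj _, a, b, fun n hn => F.map_isZero (hab n hn)⟩

variable [HasBinaryBiproducts 𝓐]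

/-- The isomorphism of a functor compatible with cones. -/
abbrev coneIso (Φ : CochainComplex 𝓐 ℤ ⥤ CochainComplex 𝓐 ℤ) [CommCone Φ]
    {K L : CochainComplex 𝓐 ℤ} (f : K ⟶ L) : Φ.obj (mappingCone f) ≅ mappingCone (Φ.map f) :=
  CommCone.iso f

/-- The homotopies on the two functors must commute strictly with `σ` to induce a homotopy on cones.
When `σ` comes from a transformation of additive functors, this is naturality applied to the
components of the given homotopy. -/
lemma Descends.chCone {Φ Ψ : CochainComplex 𝓐 ℤ ⥤ CochainComplex 𝓐 ℤ} [Descends Φ] [Descends Ψ]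
    (σ : Φ ⟶ Ψ) (h : ∀ {K L : CochainComplex 𝓐 ℤ} (f g : K ⟶ L), Homotopy f g →
      ∃ (ha : Homotopy (Φ.map f) (Φ.map g)) (hb : Homotopy (Ψ.map f) (Ψ.map g)),
        ∀ p q, (σ.app K).f p ≫ hb.hom p q = ha.hom p q ≫ (σ.app L).f q) :
    Descends (chCone σ) where
  homotopy f g hfg := by
    obtain ⟨ha, hb, hab⟩ := h f g hfg
    exact ⟨coneHomotopy (σ.naturality f).symm (σ.naturality g).symm ha hb hab⟩
  boundedProj K hK := by
    obtain ⟨hp, a, b, hab⟩ := Descends.boundedProj (Φ := Φ) K hK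
    obtain ⟨hp', a', b', hab'⟩ := Descends.boundedProj (Φ := Ψ) K hK
    refine ⟨fun n => ?_, min (a - 1) a', max b b', fun n hn =>
      (mappingCone.isZero_X_iff _ n).2 ⟨hab _ (by omega), hab' _ (by omega)⟩⟩
    have h1 := hp (n + 1)
    have h2 := hp' n
    exact Projective.of_iso
      (HomologicalComplex.homotopyCofiber.XIsoBiprod (σ.app K) n (n + 1) rfl).symm
      (inferInstanceAs (Projective ((Φ.obj K).X (n + 1) ⊞ (Ψ.obj K).X n)))

section
variable {F : 𝓐 ⥤ 𝓐} [F.Additive]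

instance [F.PreservesProjectiveObjects] (α : F ⟶ 𝟭 𝓐) : Descends (chCone (mapNatTo α)) :=
  .chCone _ fun _ _ h => ⟨F.mapHomotopy h, h, fun p q => (α.naturality (h.hom p q)).symm⟩

instance [F.PreservesProjectiveObjects] (α : 𝟭 𝓐 ⟶ F) : Descends (chCone (mapNatFrom α)) :=
  .chCone _ fun _ _ h => ⟨h, F.mapHomotopy h, fun p q => (α.naturality (h.hom p q)).symm⟩

/-- `F (inr f)` corresponds to `inr (F f)`. -/
lemma map_inr_iso {K L : CochainComplex 𝓐 ℤ} (f : K ⟶ L) :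
    (mapC F).map (inr f) ≫ (coneIso (mapC F) f).hom = inr ((mapC F).map f) := by
  rw [← Iso.eq_comp_inv]
  exact (inr_mapHomologicalComplexIso_inv F f).symm

instance (α : F ⟶ 𝟭 𝓐) : CommConeHom (mapNatTo α) where
  comm {K L} f := by
    -- The cone isomorphism of the identity functor is the identity. What remains is checked on
    -- `inl` and `inr`, where it is naturality of `α`.
    refine (Category.comp_id _).trans ?_
    rw [← Iso.inv_comp_eq]
    apply hom_ext_from_cone
    · rw [inl_coneMap, Cochain.ofHom_comp, ← Cochain.comp_assoc_of_third_is_zero_cochain]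
      refine (congrArg (fun z => Cochain.comp z _ (add_zero (-1)))
        (inl_mapHomologicalComplexIso_inv F f)).trans ?_
      ext p q hpq
      rw [Cochain.comp_zero_cochain_v, Cochain.zero_cochain_comp_v, Cochain.ofHom_v,
        Cochain.ofHom_v]
      exact α.naturality ((inl f).v p q hpq)
    · rw [inr_coneMap]
      refine (inr_mapHomologicalComplexIso_inv_assoc F f _).trans ?_
      exact (mapNatTo α).naturality _

instance (α : 𝟭 𝓐 ⟶ F) : CommConeHom (mapNatFrom α) where
  comm {K L} f := by
    refine Eq.trans ?_ (Category.id_comp _).symm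
    rw [← Iso.eq_comp_inv]
    change _ = mappingCone.map f ((mapC F).map f) ((mapNatFrom α).app K) ((mapNatFrom α).app L)
      ((mapNatFrom α).naturality f) ≫ (coneIso (mapC F) f).inv
    apply hom_ext_from_cone
    · rw [Cochain.ofHom_comp, ← Cochain.comp_assoc_of_third_is_zero_cochain, inl_coneMap,
        Cochain.comp_assoc_of_third_is_zero_cochain]
      refine Eq.trans ?_ (congrArg (fun z => Cochain.comp _ z (zero_add (-1)))
        (inl_mapHomologicalComplexIso_inv F f)).symm
      ext p q hpq
      rw [Cochain.comp_zero_cochain_v, Cochain.zero_cochain_comp_v, Cochain.ofHom_v,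
        Cochain.ofHom_v]
      exact α.naturality ((inl f).v p q hpq)
    · rw [inr_coneMap_assoc]
      refine Eq.trans ?_ (congrArg _ (inr_mapHomologicalComplexIso_inv F f)).symm
      exact (mapNatFrom α).naturality _

end

variable {Φ Ψ : CochainComplex 𝓐 ℤ ⥤ CochainComplex 𝓐 ℤ}

/-- The natural homotopy equivalence from the shift to the cone of the inclusion into a cone. -/
def chRotate (σ : Φ ⟶ Ψ) :
    Φ ⋙ CategoryTheory.shiftFunctor (CochainComplex 𝓐 ℤ) (1 : ℤ) ⟶ chCone (chInr σ) where
  app K := (rotateHomotopyEquiv (σ.app K)).hom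
  naturality K L f := (rotate_naturality (σ.naturality f).symm (inr_coneMap _)).symm

lemma isHEquiv_chRotate (σ : Φ ⟶ Ψ) (K : CochainComplex 𝓐 ℤ) : IsHEquiv ((chRotate σ).app K) :=
  (rotateHomotopyEquiv (σ.app K)).isHEquiv

end Braiding

/-! ### Distant commutation and inverses, from vanishing and splitting. -/

section BraidRelations

open CochainComplex CochainComplex.HomComplex mappingCone

universe v₁ u₁

variable {𝓐 : Type u₁} [Category.{v₁} 𝓐] [Preadditive 𝓐]

/-- A roof of natural homotopy equivalences induces an isomorphism of endofunctors of `P(𝓐)`. -/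
def inducedRoof {Ω Φ Ψ : CochainComplex 𝓐 ℤ ⥤ CochainComplex 𝓐 ℤ} [Descends Φ] [Descends Ψ]
    (θ : Ω ⟶ Φ) (θ' : Ω ⟶ Ψ) (hθ : ∀ K, IsHEquiv (θ.app K)) (hθ' : ∀ K, IsHEquiv (θ'.app K)) :
    induced Φ ≅ induced Ψ :=
  NatIso.ofComponents (fun X => ObjectProperty.isoMk _
      ((@asIso _ _ _ _ ((HomotopyCategory.quotient 𝓐 _).map (θ.app X.obj.as)) (hθ _)).symm ≪≫
        (@asIso _ _ _ _ ((HomotopyCategory.quotient 𝓐 _).map (θ'.app X.obj.as)) (hθ' _))))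
    (by
      rintro X Y ⟨f⟩
      obtain ⟨f, rfl⟩ := (HomotopyCategory.quotient 𝓐 (ComplexShape.up ℤ)).map_surjective f
      apply InducedCategory.Hom.ext
      have := hθ X.obj.as
      have := hθ Y.obj.as
      unfold IsHEquiv at *
      change (HomotopyCategory.quotient 𝓐 _).map (Φ.map f) ≫
          inv ((HomotopyCategory.quotient 𝓐 _).map (θ.app Y.obj.as)) ≫
            (HomotopyCategory.quotient 𝓐 _).map (θ'.app Y.obj.as) =
        (inv ((HomotopyCategory.quotient 𝓐 _).map (θ.app X.obj.as)) ≫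
          (HomotopyCategory.quotient 𝓐 _).map (θ'.app X.obj.as)) ≫
            (HomotopyCategory.quotient 𝓐 _).map (Ψ.map f)
      rw [Category.assoc, IsIso.eq_inv_comp, ← Functor.map_comp, ← θ'.naturality,
        ← Functor.map_comp_assoc, ← θ.naturality, Functor.map_comp, Functor.map_comp,
        Category.assoc, IsIso.hom_inv_id_assoc])

variable [HasBinaryBiproducts 𝓐]

/-- The degenerate case `C = B`, `ρ = 0` of `isHEquiv_comp_inr`: nothing is glued to `B`. -/
lemma isHEquiv_inr {A B : CochainComplex 𝓐 ℤ} (a : A ⟶ B) (hA : 𝟙 A = 0) : IsHEquiv (inr a) := by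
  have h := isHEquiv_comp_inr a (𝟙 B) 0 (𝟙 B) (by rw [← Category.id_comp a, hA]; simp) (by simp)
    (by simp) (by simp [hA])
  rwa [Category.id_comp] at h

lemma isHEquiv_map_inr {F : 𝓐 ⥤ 𝓐} [F.Additive] {A B : CochainComplex 𝓐 ℤ} (a : A ⟶ B)
    (hA : 𝟙 ((mapC F).obj A) = 0) : IsHEquiv ((mapC F).map (inr a)) := by
  refine .of_comp_right (isHEquiv_of_isIso (coneIso (mapC F) a).hom) ?_
  rw [map_inr_iso]
  exact isHEquiv_inr _ hA

lemma id_map_map_eq_zero {F G : 𝓐 ⥤ 𝓐} [F.Additive] [G.Additive]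
    (h : ∀ X, IsZero (G.obj (F.obj X))) (K : CochainComplex 𝓐 ℤ) :
    𝟙 ((mapC G).obj ((mapC F).obj K)) = 0 := by
  ext n
  exact (h (K.X n)).eq_of_src _ _

/-- A direct sum decomposition of a middle functor: `(a, s)` is an isomorphism. -/
structure Splits {F G H : 𝓐 ⥤ 𝓐} (a : F ⟶ G) (s : H ⟶ G) : Prop where
  exists_retractions : ∃ (ρ : G ⟶ F) (π : G ⟶ H), a ≫ π = 0 ∧ s ≫ π = 𝟙 H ∧
    ρ ≫ a + π ≫ s = 𝟙 G ∧ a ≫ ρ = 𝟙 F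

lemma Splits.isHEquiv {F G H : 𝓐 ⥤ 𝓐} [F.Additive] [G.Additive] [H.Additive] {a : F ⟶ G}
    {s : H ⟶ G} (h : Splits a s) (K : CochainComplex 𝓐 ℤ) :
    IsHEquiv ((mapNat s).app K ≫ inr ((mapNat a).app K)) := by
  obtain ⟨ρ, π, h₁, h₂, h₃, h₄⟩ := h.exists_retractions
  refine isHEquiv_comp_inr _ _ ((mapNat ρ).app K) ((mapNat π).app K) ?_ ?_ ?_ ?_ <;> ext n
  · exact NatTrans.congr_app h₁ (K.X n)
  · exact NatTrans.congr_app h₂ (K.X n)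
  · exact NatTrans.congr_app h₃ (K.X n)
  · exact NatTrans.congr_app h₄ (K.X n)

/-- The splitting describes the cone of `L` applied to `a`. Since `L` commutes with cones, it also
describes `L` applied to the cone of `a`, which is what occurs inside an iterated cone. -/
lemma Splits.isHEquiv_map {F G H L : 𝓐 ⥤ 𝓐} [F.Additive] [G.Additive] [H.Additive] [L.Additive]
    {a : F ⟶ G} {s : H ⟶ G ⋙ L} (h : Splits (G := G ⋙ L) (Functor.whiskerRight a L) s)
    (K : CochainComplex 𝓐 ℤ) :
    IsHEquiv ((mapNat s).app K ≫ (mapC L).map (inr ((mapNat a).app K))) := by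
  refine .of_comp_right (isHEquiv_of_isIso (coneIso (mapC L) _).hom) ?_
  let s' : (mapC H).obj K ⟶ (mapC L).obj ((mapC G).obj K) := (mapNat s).app K
  refine (congrArg IsHEquiv (Category.assoc s' _ _)).mpr ?_
  refine (congrArg (fun z => IsHEquiv (s' ≫ z)) (map_inr_iso _)).mpr ?_
  exact h.isHEquiv K

variable [HasZeroObject 𝓐]

section
variable {U W : 𝓐 ⥤ 𝓐} [U.Additive] [W.Additive] [U.PreservesProjectiveObjects]
  [W.PreservesProjectiveObjects] (b : U ⟶ 𝟭 𝓐) (c : W ⟶ 𝟭 𝓐)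

/-- Cones of natural maps to the identity commute if the composites of the sources vanish. -/
lemma nonempty_induced_comm (h : ∀ X, IsZero (U.obj (W.obj X))) (h' : ∀ X, IsZero (W.obj (U.obj X))) :
    Nonempty (induced (chCone (mapNatTo c) ⋙ chCone (mapNatTo b)) ≅
      induced (chCone (mapNatTo b) ⋙ chCone (mapNatTo c))) := by
  -- The apex of the roof is the cone of `U K ⟶ K ⟶ cone c`. As `U W` vanishes, `U K` may be
  -- replaced by `U` of the cone of `c`.
  let θ₁ : chCone (mapNatTo b ≫ chInr (mapNatTo c)) ⟶
      chCone (mapNatTo c) ⋙ chCone (mapNatTo b) :=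
    chConeMap (mapNatTo b ≫ chInr (mapNatTo c))
      (Functor.whiskerLeft (chCone (mapNatTo c)) (mapNatTo b))
      (Functor.whiskerRight (chInr (mapNatTo c)) (mapC U)) (Functor.rightUnitor _).inv
      (fun K => (Category.comp_id _).trans
        ((mapNatTo b).naturality (inr ((mapNatTo c).app K))).symm)
  -- For the other order, the cone functor of `c` is moved inside the cone of `b`. As `W U`
  -- vanishes, `U K` is equivalent to its image under the cone functor of `c`.
  let θ₂ : chCone (mapNatTo b ≫ chInr (mapNatTo c)) ⟶
      chCone (Functor.whiskerRight (mapNatTo b) (chCone (mapNatTo c))) :=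
    chConeMap (mapNatTo b ≫ chInr (mapNatTo c))
      (Functor.whiskerRight (mapNatTo b) (chCone (mapNatTo c)))
      (Functor.whiskerLeft (mapC U) (chInr (mapNatTo c))) (Functor.leftUnitor _).inv
      (fun K => (Category.comp_id _).trans ((chInr (mapNatTo c)).naturality ((mapNatTo b).app K)))
  exact ⟨inducedRoof θ₁ (θ₂ ≫ (commConeNatIso (chCone (mapNatTo c)) (mapNatTo b)).inv)
    (fun K => isHEquiv_chConeMap _ _ _ _ _ K
      (isHEquiv_map_inr ((mapNatTo c).app K) (id_map_map_eq_zero h K)) (isHEquiv_of_isIso (𝟙 _)))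
    (fun K => .comp (isHEquiv_chConeMap _ _ _ _ _ K
      (isHEquiv_inr ((mapNatTo c).app ((mapC U).obj K)) (id_map_map_eq_zero h' K))
      (isHEquiv_of_isIso (𝟙 _))) (isHEquiv_of_isIso _))⟩

end

section
variable {U V : 𝓐 ⥤ 𝓐} [U.Additive] [V.Additive] [U.PreservesProjectiveObjects]
  [V.PreservesProjectiveObjects] (b : U ⟶ 𝟭 𝓐) (g : 𝟭 𝓐 ⟶ V)

/-- By the splitting, `U` of the cone of `g` is equivalent to `V K`. By `hs` the map `b` becomes the
inclusion of `V K` into the cone of `g`, and the cone of that inclusion is `K⟦1⟧`. -/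
lemma nonempty_shift_iso_induced_comp (s : V ⟶ V ⋙ U)
    (hs : ∀ X, s.app X ≫ b.app (V.obj X) = 𝟙 _)
    (h : Splits (G := V ⋙ U) (Functor.whiskerRight g U) s) :
    Nonempty (induced (CategoryTheory.shiftFunctor (CochainComplex 𝓐 ℤ) (1 : ℤ)) ≅
      induced (chCone (mapNatFrom g) ⋙ chCone (mapNatTo b))) := by
  let s' : mapC V ⟶ mapC V ⋙ mapC U := mapNat s
  have hs' : ∀ K, s'.app K ≫ (mapNatTo b).app ((mapC V).obj K) = 𝟙 _ := fun K => by
    ext n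
    exact hs (K.X n)
  let θ : chCone (chInr (mapNatFrom g)) ⟶ chCone (mapNatFrom g) ⋙ chCone (mapNatTo b) :=
    chConeMap (chInr (mapNatFrom g))
      (Functor.whiskerLeft (chCone (mapNatFrom g)) (mapNatTo b))
      (s' ≫ Functor.whiskerRight (chInr (mapNatFrom g)) (mapC U)) (Functor.rightUnitor _).inv
      (fun K => by
        have := (mapNatTo b).naturality (inr ((mapNatFrom g).app K))
        refine (Category.comp_id _).trans (Eq.trans ?_ (Category.assoc _ _ _).symm)
        refine Eq.trans ?_ (congrArg (fun z => s'.app K ≫ z) this.symm)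
        exact ((reassoc_of% (hs' K)) _).symm)
  exact ⟨inducedIso (chRotate (mapNatFrom g) ≫ θ) (fun K => .comp (isHEquiv_chRotate _ K)
    (isHEquiv_chConeMap _ _ _ _ _ K (h.isHEquiv_map K) (isHEquiv_of_isIso (𝟙 _))))⟩

/-- The opposite order. The cone functor of `g` commutes with the cone of `b`, and the splitting
makes its value at `U K` equivalent to `V K`. By `hs` the image of `b` becomes the inclusion of `V
K` into the cone of `g`, so the total cone is again `K⟦1⟧`. -/
lemma nonempty_shift_iso_induced_comp' (s : V ⟶ U ⋙ V)
    (hs : ∀ X, s.app X ≫ V.map (b.app X) = 𝟙 _)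
    (h : Splits (G := U ⋙ V) (Functor.whiskerLeft U g) s) :
    Nonempty (induced (CategoryTheory.shiftFunctor (CochainComplex 𝓐 ℤ) (1 : ℤ)) ≅
      induced (chCone (mapNatTo b) ⋙ chCone (mapNatFrom g))) := by
  let s' : mapC V ⟶ mapC U ⋙ mapC V := mapNat s
  have hs' : ∀ K, s'.app K ≫ (mapC V).map ((mapNatTo b).app K) = 𝟙 _ := fun K => by
    ext n
    exact hs (K.X n)
  let θ : chCone (chInr (mapNatFrom g)) ⟶
      chCone (Functor.whiskerRight (mapNatTo b) (chCone (mapNatFrom g))) :=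
    chConeMap (chInr (mapNatFrom g))
      (Functor.whiskerRight (mapNatTo b) (chCone (mapNatFrom g)))
      (s' ≫ Functor.whiskerLeft (mapC U) (chInr (mapNatFrom g))) (Functor.leftUnitor _).inv
      (fun K => by
        have := (chInr (mapNatFrom g)).naturality ((mapNatTo b).app K)
        refine (Category.comp_id _).trans (Eq.trans ?_ (Category.assoc _ _ _).symm)
        refine Eq.trans ?_ (congrArg (fun z => s'.app K ≫ z) this)
        exact ((reassoc_of% (hs' K)) _).symm)
  exact ⟨inducedIso (chRotate (mapNatFrom g) ≫ θ ≫
      (commConeNatIso (chCone (mapNatFrom g)) (mapNatTo b)).inv)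
    (fun K => .comp (isHEquiv_chRotate _ K) (.comp (isHEquiv_chConeMap _ _ _ _ _ K
      (h.isHEquiv K) (isHEquiv_of_isIso (𝟙 _))) (isHEquiv_of_isIso _)))⟩

end

end BraidRelations

/-! ### The braid relation: both sides as the cone of one map. -/

section BraidRelation

open CochainComplex CochainComplex.HomComplex mappingCone

universe v₁ u₁

section
variable {𝓐 : Type u₁} [Category.{v₁} 𝓐] [Preadditive 𝓐] {U : 𝓐 ⥤ 𝓐} [U.Additive] {b : U ⟶ 𝟭 𝓐}
  {s : U ⟶ U ⋙ U} (hs : ∀ X, s.app X ≫ b.app (U.obj X) = 𝟙 _)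
  (hs' : ∀ X, s.app X ≫ U.map (b.app X) = 𝟙 _)

/-- The map of complexes induced by a map to a composite. -/
abbrev mapNatComp {F G H : 𝓐 ⥤ 𝓐} [F.Additive] [G.Additive] [H.Additive] (s : F ⟶ G ⋙ H) :
    mapC F ⟶ mapC G ⋙ mapC H := mapNat s

include hs in
lemma section_comp (K : CochainComplex 𝓐 ℤ) :
    (mapNatComp s).app K ≫ (mapNatTo b).app ((mapC U).obj K) = 𝟙 _ := by
  ext n
  exact hs (K.X n)

include hs in
lemma section_comp_assoc (K : CochainComplex 𝓐 ℤ) {N : CochainComplex 𝓐 ℤ}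
    (h : (mapC U).obj K ⟶ N) :
    (mapNatComp s).app K ≫ (mapNatTo b).app ((mapC U).obj K) ≫ h = h :=
  (Category.assoc _ _ _).symm.trans
    ((congrArg (fun z => z ≫ h) (section_comp hs K)).trans (Category.id_comp h))

include hs' in
lemma section_map_comp (K : CochainComplex 𝓐 ℤ) :
    (mapNatComp s).app K ≫ (mapC U).map ((mapNatTo b).app K) = 𝟙 _ := by
  ext n
  exact hs' (K.X n)

include hs' in
lemma section_map_comp_assoc (K : CochainComplex 𝓐 ℤ) {N : CochainComplex 𝓐 ℤ}
    (h : (mapC U).obj K ⟶ N) :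
    (mapNatComp s).app K ≫ (mapC U).map ((mapNatTo b).app K) ≫ h = h :=
  (Category.assoc _ _ _).symm.trans
    ((congrArg (fun z => z ≫ h) (section_map_comp hs' K)).trans (Category.id_comp h))

end

variable {𝓐 : Type u₁} [Category.{v₁} 𝓐] [Preadditive 𝓐] [HasBinaryBiproducts 𝓐] {U W : 𝓐 ⥤ 𝓐} [U.Additive] [W.Additive] (b : U ⟶ 𝟭 𝓐) (c : W ⟶ 𝟭 𝓐)

/-- The common source of the two sides of the braid relation. -/
abbrev braidSource (U W : 𝓐 ⥤ 𝓐) [U.Additive] [W.Additive] :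
    CochainComplex 𝓐 ℤ ⥤ CochainComplex 𝓐 ℤ :=
  (mapC U ⋙ mapC W) ⋙ CategoryTheory.shiftFunctor (CochainComplex 𝓐 ℤ) (1 : ℤ)

/-- Both composites equal `U K ⟶ K ⟶ cone c`. -/
lemma braidMap_aux (K : CochainComplex 𝓐 ℤ) : inr ((mapNatTo c).app ((mapC U).obj K)) ≫
    (chCone (mapNatTo c)).map ((mapNatTo b).app K) =
      (mapC U).map (inr ((mapNatTo c).app K)) ≫
        (mapNatTo b).app ((chCone (mapNatTo c)).obj K) :=
  ((chInr (mapNatTo c)).naturality ((mapNatTo b).app K)).symm.trans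
      ((mapNatTo b).naturality (inr ((mapNatTo c).app K))).symm

/-- The map from the common source of both sides of the braid relation to the composite of
the two cones. -/
def braidMap : braidSource U W ⟶ chCone (mapNatTo c) ⋙ chCone (mapNatTo b) :=
  (chRotate (Functor.whiskerLeft (mapC U) (mapNatTo c)) :
    _ ⟶ chCone (Functor.whiskerLeft (mapC U) (chInr (mapNatTo c)))) ≫
  (chConeMap (Functor.whiskerLeft (mapC U) (chInr (mapNatTo c)))
    (Functor.whiskerLeft (chCone (mapNatTo c)) (mapNatTo b))
    (Functor.whiskerRight (chInr (mapNatTo c)) (mapC U))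
    (Functor.whiskerRight (mapNatTo b) (chCone (mapNatTo c)))
    (braidMap_aux b c))

section
variable {b} {s : U ⟶ U ⋙ U} (hs : ∀ X, s.app X ≫ b.app (U.obj X) = 𝟙 _)
  (hs' : ∀ X, s.app X ≫ U.map (b.app X) = 𝟙 _)

include hs in
lemma braidLift_aux (K : CochainComplex 𝓐 ℤ) : inr ((mapNatTo c).app ((mapC U).obj K)) ≫ 𝟙 _ =
    ((mapNatComp s).app K ≫ (mapC U).map (inr ((mapNatTo c).app ((mapC U).obj K)))) ≫
      (mapNatTo b).app ((chCone (mapNatTo c)).obj ((mapC U).obj K)) := by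
  refine (Category.comp_id _).trans (Eq.trans ?_ (Category.assoc _ _ _).symm)
  refine Eq.trans ?_ (congrArg (fun z => (mapNatComp s).app K ≫ z)
    ((mapNatTo b).naturality (inr ((mapNatTo c).app ((mapC U).obj K)))).symm)
  exact (section_comp_assoc hs K _).symm

/-- The first lift of `braidMap`. -/
def braidLift : braidSource U W ⟶ mapC U ⋙ chCone (mapNatTo c) ⋙ chCone (mapNatTo b) :=
  (chRotate (Functor.whiskerLeft (mapC U) (mapNatTo c)) :
    _ ⟶ chCone (Functor.whiskerLeft (mapC U) (chInr (mapNatTo c)))) ≫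
  (chConeMap (Functor.whiskerLeft (mapC U) (chInr (mapNatTo c)))
    (Functor.whiskerLeft (mapC U ⋙ chCone (mapNatTo c)) (mapNatTo b))
    (mapNatComp s ≫
      Functor.whiskerLeft (mapC U) (Functor.whiskerRight (chInr (mapNatTo c)) (mapC U)))
    (Functor.rightUnitor (mapC U ⋙ chCone (mapNatTo c))).inv
    (braidLift_aux c hs))

/-- By the splitting, `U` of the cone of `c` over `U K` is equivalent to `U K` itself. So the
composite of the two cone functors at `U K` is the cone of the inclusion of `U K` into the cone of
`W U K ⟶ U K`, that is, `W U K` shifted by one. -/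
lemma isHEquiv_braidLift [HasZeroObject 𝓐] (h : Splits (F := (U ⋙ W) ⋙ U) (G := U ⋙ U)
    (Functor.whiskerRight (Functor.whiskerLeft U c) U) s) (K : CochainComplex 𝓐 ℤ) :
    IsHEquiv ((braidLift c hs).app K) :=
  .comp (isHEquiv_chRotate _ K) (isHEquiv_chConeMap _ _ _ _ _ K
    (Splits.isHEquiv_map (F := U ⋙ W) (G := U) (a := Functor.whiskerLeft U c) h K)
    (isHEquiv_of_isIso (𝟙 ((chCone (mapNatTo c)).obj ((mapC U).obj K)))))

include hs' in
-- The lift duplicates the factor `U` through `s`, and applying `b` inside removes the copy by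
-- `hs'`.
lemma braidLift_comp (K : CochainComplex 𝓐 ℤ) : (braidLift c hs).app K ≫
    (chCone (mapNatTo c) ⋙ chCone (mapNatTo b)).map ((mapNatTo b).app K) =
      (braidMap b c).app K := by
  refine (Category.assoc _ _ _).trans (congrArg
    (fun z => (rotateHomotopyEquiv ((mapNatTo c).app ((mapC U).obj K))).hom ≫ z) ?_)
  refine (coneMap_comp (braidLift_aux c hs K)
    ((mapNatTo b).naturality ((chCone (mapNatTo c)).map ((mapNatTo b).app K))).symm).trans
    (coneMap_congr (φ₁ := inr ((mapNatTo c).app ((mapC U).obj K)))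
      (φ₂ := (mapNatTo b).app ((chCone (mapNatTo c)).obj K)) _ ?_ (Category.id_comp _))
  refine (Category.assoc _ _ _).trans ?_
  refine (congrArg (fun z => (mapNatComp s).app K ≫ z) (((mapC U).map_comp _ _).symm.trans
    ((congrArg (mapC U).map ((chInr (mapNatTo c)).naturality ((mapNatTo b).app K)).symm).trans
      ((mapC U).map_comp _ _)))).trans ?_
  exact section_map_comp_assoc hs' K _

end

section
variable {c} {t : W ⟶ W ⋙ W} (ht : ∀ X, t.app X ≫ c.app (W.obj X) = 𝟙 _)
  (ht' : ∀ X, t.app X ≫ W.map (c.app X) = 𝟙 _)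

include ht' in
lemma braidLift'_aux (K : CochainComplex 𝓐 ℤ) :
    inr ((mapC W).map ((mapNatTo b).app K)) ≫ (coneIso (mapC W) ((mapNatTo b).app K)).inv =
    ((mapNatComp t).app K ≫ (mapC W).map (inr ((mapNatTo b).app ((mapC W).obj K)))) ≫
      (mapC W).map ((chCone (mapNatTo b)).map ((mapNatTo c).app K)) := by
  refine (inr_mapHomologicalComplexIso_inv W ((mapNatTo b).app K)).trans
    (Eq.trans ?_ (Category.assoc _ _ _).symm)
  refine Eq.trans ?_ (congrArg (fun z => (mapNatComp t).app K ≫ z) (((mapC W).map_comp _ _).symm.trans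
    ((congrArg (mapC W).map ((chInr (mapNatTo b)).naturality ((mapNatTo c).app K)).symm).trans
      ((mapC W).map_comp _ _)))).symm
  exact (section_map_comp_assoc ht' K _).symm

/-- The second lift of `braidMap`, up to sign. -/
def braidLift' : braidSource U W ⟶ (chCone (mapNatTo c) ⋙ chCone (mapNatTo b)) ⋙ mapC W :=
  (chRotate (Functor.whiskerRight (mapNatTo b) (mapC W)) :
    _ ⟶ chCone (chInr (Functor.whiskerRight (mapNatTo b) (mapC W)))) ≫
  (chConeMap (chInr (Functor.whiskerRight (mapNatTo b) (mapC W)))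
    (Functor.whiskerRight (Functor.whiskerRight (mapNatTo c) (chCone (mapNatTo b))) (mapC W))
    (mapNatComp t ≫
      Functor.whiskerLeft (mapC W) (Functor.whiskerRight (chInr (mapNatTo b)) (mapC W)))
    (commConeNatIso (mapC W) (mapNatTo b)).inv
    (braidLift'_aux b ht') :
    _ ⟶ chCone (Functor.whiskerRight (Functor.whiskerRight (mapNatTo c) (chCone (mapNatTo b)))
      (mapC W))) ≫
  -- The last two isomorphisms move `W` outside the cone, and then rewrite the cone of the image of
  -- `c` as the cone functor of `b` applied to the cone of `c`.
  ((commConeNatIso (mapC W)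
    (Functor.whiskerRight (mapNatTo c) (chCone (mapNatTo b)))).inv :
    _ ⟶ chCone (Functor.whiskerRight (mapNatTo c) (chCone (mapNatTo b))) ⋙ mapC W) ≫
  Functor.whiskerRight (commConeNatIso (chCone (mapNatTo b)) (mapNatTo c)).inv (mapC W)

/-- Mirror image of `isHEquiv_braidLift`: the splitting makes `W` of the cone of `b` over `W K`
equivalent to `W K`, and what remains is the cone of the inclusion of `W K` into the cone of `W U K
⟶ W K`. -/
lemma isHEquiv_braidLift' [HasZeroObject 𝓐] (h : Splits (F := (W ⋙ U) ⋙ W) (G := W ⋙ W)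
    (Functor.whiskerRight (Functor.whiskerLeft W b) W) t) (K : CochainComplex 𝓐 ℤ) :
    IsHEquiv ((braidLift' b ht').app K) := by
  refine .comp (isHEquiv_chRotate _ K) (.comp (isHEquiv_chConeMap _ _ _ _ _ K ?_ ?_)
    (.comp (isHEquiv_of_isIso _) (isHEquiv_of_isIso _)))
  · exact Splits.isHEquiv_map (F := W ⋙ U) (G := W) (a := Functor.whiskerLeft W b) h K
  · exact isHEquiv_of_isIso (coneIso (mapC W) ((mapNatTo b).app K)).inv

lemma mapNatTo_app_cone {K L : CochainComplex 𝓐 ℤ} (f : K ⟶ L) :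
    (coneIso (mapC W) f).inv ≫ (mapNatTo c).app (mappingCone f) =
      mappingCone.map _ _ ((mapNatTo c).app K) ((mapNatTo c).app L) ((mapNatTo c).naturality f) := by
  rw [Iso.inv_comp_eq]
  exact (Category.comp_id _).symm.trans (CommConeHom.comm (σ := mapNatTo c) f)

lemma braidLift'_aux' (K : CochainComplex 𝓐 ℤ) :
    inr ((mapC W).map ((mapNatTo b).app K)) ≫ mappingCone.map _ _ _ _ ((mapNatTo c).naturality ((mapNatTo b).app K)) =
    inr ((mapNatTo b).app ((mapC W).obj K)) ≫
      (chCone (mapNatTo b)).map ((mapNatTo c).app K) :=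
  (inr_coneMap _).trans ((chInr (mapNatTo b)).naturality ((mapNatTo c).app K))

include ht in
-- The counit `c` passes through the cones by naturality, and cancels the comultiplication `t` by
-- `ht`. What is left is a rotation followed by maps of cones, the form in which `braidMap` can be
-- compared with it.
lemma braidLift'_comp_aux (K : CochainComplex 𝓐 ℤ) : (braidLift' b ht').app K ≫
    (mapNatTo c).app ((chCone (mapNatTo c) ⋙ chCone (mapNatTo b)).obj K) =
    (rotateHomotopyEquiv ((mapC W).map ((mapNatTo b).app K))).hom ≫
      mappingCone.map _ _ (inr ((mapNatTo b).app ((mapC W).obj K)))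
        (mappingCone.map _ _ _ _ ((mapNatTo c).naturality ((mapNatTo b).app K)))
        (braidLift'_aux' b K) ≫ (coneIso (chCone (mapNatTo b)) ((mapNatTo c).app K)).inv := by
  refine (Category.assoc _ _ _).trans (congrArg
    (fun z => (rotateHomotopyEquiv ((mapC W).map ((mapNatTo b).app K))).hom ≫ z) ?_)
  refine (Category.assoc _ _ _).trans ?_
  refine (congrArg (fun z => mappingCone.map _ _ _ _ (braidLift'_aux b ht' K) ≫ z)
    ((Category.assoc _ _ _).trans (congrArg
      (fun z => (coneIso (mapC W) ((chCone (mapNatTo b)).map ((mapNatTo c).app K))).inv ≫ z)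
      ((mapNatTo c).naturality (coneIso (chCone (mapNatTo b)) ((mapNatTo c).app K)).inv)))).trans ?_
  refine (congrArg (fun z => mappingCone.map _ _ _ _ (braidLift'_aux b ht' K) ≫ z)
    ((Category.assoc _ _ _).symm.trans (congrArg
      (fun z => z ≫ (coneIso (chCone (mapNatTo b)) ((mapNatTo c).app K)).inv)
      (mapNatTo_app_cone _)))).trans ?_
  refine (coneMap_comp_assoc (braidLift'_aux b ht' K)
    ((mapNatTo c).naturality ((chCone (mapNatTo b)).map ((mapNatTo c).app K))) _).trans (congrArg
      (fun z => z ≫ (coneIso (chCone (mapNatTo b)) ((mapNatTo c).app K)).inv)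
      (coneMap_congr (φ₁ := inr ((mapC W).map ((mapNatTo b).app K))) _ ?_ ?_))
  · refine (Category.assoc _ _ _).trans ?_
    refine (congrArg (fun z => (mapNatComp t).app K ≫ z)
      ((mapNatTo c).naturality (inr ((mapNatTo b).app ((mapC W).obj K))))).trans ?_
    exact section_comp_assoc ht K _
  · exact mapNatTo_app_cone _

/-- `braidMap` is built from the cone of `c`, the other lift from the cone of `b`. Moving one cone
past the other is a transposition, and `rotate_transposeHom` contributes the sign. -/
lemma braidMap_comp (K : CochainComplex 𝓐 ℤ) :
    (braidMap b c).app K ≫ (coneIso (chCone (mapNatTo b)) ((mapNatTo c).app K)).hom =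
    -((rotateHomotopyEquiv ((mapC W).map ((mapNatTo b).app K))).hom ≫
      mappingCone.map _ _ (inr ((mapNatTo b).app ((mapC W).obj K)))
        (mappingCone.map _ _ _ _ ((mapNatTo c).naturality ((mapNatTo b).app K)))
        (braidLift'_aux' b K)) := by
  refine Eq.trans ?_ (rotate_transposeHom ((mapNatTo b).naturality ((mapNatTo c).app K))
    ((mapNatTo c).app ((mapC U).obj K)) ((mapC W).map ((mapNatTo b).app K))
    ((mapNatTo c).naturality ((mapNatTo b).app K)).symm
    (by
      refine Eq.trans ?_ (inr_coneMap _).symm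
      exact inr_coneMap _) (braidLift'_aux' b K))
  refine (Category.assoc _ _ _).trans (congrArg
    (fun z => (rotateHomotopyEquiv ((mapNatTo c).app ((mapC U).obj K))).hom ≫ z) ?_)
  refine (coneMap_comp_assoc (braidMap_aux b c K) (CommConeHom.comm (σ := mapNatTo b) _) _).trans
    (congrArg (fun z => z ≫ transposeHom ((mapNatTo b).naturality ((mapNatTo c).app K)))
      (coneMap_congr (φ₁ := inr ((mapNatTo c).app ((mapC U).obj K))) _ (map_inr_iso _)
        (Category.comp_id _)))

include ht in
lemma braidLift'_comp (K : CochainComplex 𝓐 ℤ) : (braidLift' b ht').app K ≫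
    (mapNatTo c).app ((chCone (mapNatTo c) ⋙ chCone (mapNatTo b)).obj K) =
      -(braidMap b c).app K := by
  refine (braidLift'_comp_aux b ht ht' K).trans ?_
  rw [← Category.assoc, Iso.comp_inv_eq, Preadditive.neg_comp, braidMap_comp, neg_neg]

end

/-- The braid relation for cones of natural maps to the identity. -/
lemma nonempty_induced_braid [HasZeroObject 𝓐] [U.PreservesProjectiveObjects] [W.PreservesProjectiveObjects]
    {s : U ⟶ U ⋙ U} (hs : ∀ X, s.app X ≫ b.app (U.obj X) = 𝟙 _)
    (hs' : ∀ X, s.app X ≫ U.map (b.app X) = 𝟙 _)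
    (h : Splits (F := (U ⋙ W) ⋙ U) (G := U ⋙ U)
      (Functor.whiskerRight (Functor.whiskerLeft U c) U) s)
    {t : W ⟶ W ⋙ W} (ht : ∀ X, t.app X ≫ c.app (W.obj X) = 𝟙 _)
    (ht' : ∀ X, t.app X ≫ W.map (c.app X) = 𝟙 _)
    (h' : Splits (F := (W ⋙ U) ⋙ W) (G := W ⋙ W)
      (Functor.whiskerRight (Functor.whiskerLeft W b) W) t) :
    Nonempty (induced (chCone (mapNatTo b) ⋙ chCone (mapNatTo c) ⋙ chCone (mapNatTo b)) ≅
      induced (chCone (mapNatTo c) ⋙ chCone (mapNatTo b) ⋙ chCone (mapNatTo c))) := by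
  -- Let Φ be the composite of the two cone functors. The left side is Φ of the cone of `b`, hence
  -- the cone of the image of `b` under Φ, whose source is equivalent to that of `braidMap`.
  let θ₁ : chCone (braidMap b c) ⟶
      chCone (Functor.whiskerRight (mapNatTo b) (chCone (mapNatTo c) ⋙ chCone (mapNatTo b))) :=
    chConeMap (braidMap b c)
      (Functor.whiskerRight (mapNatTo b) (chCone (mapNatTo c) ⋙ chCone (mapNatTo b)))
      (braidLift c hs) (Functor.leftUnitor _).inv
      (fun K => (Category.comp_id _).trans (braidLift_comp c hs hs' K).symm)
  -- The right side is the cone of `c` over the values of Φ. The negated lift cancels the sign in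
  -- `braidLift'_comp`.
  let θ₂ : chCone (braidMap b c) ⟶ chCone (mapNatTo c) ⋙ chCone (mapNatTo b) ⋙ chCone (mapNatTo c) :=
    chConeMap (braidMap b c)
      (Functor.whiskerLeft (chCone (mapNatTo c) ⋙ chCone (mapNatTo b)) (mapNatTo c))
      (-(braidLift' b ht')) (Functor.rightUnitor _).inv
      (fun K => (Category.comp_id _).trans ((Preadditive.neg_comp _ _).trans
        ((congrArg Neg.neg (braidLift'_comp b ht ht' K)).trans (neg_neg _))).symm)
  exact ⟨inducedRoof (θ₁ ≫ (commConeNatIso (chCone (mapNatTo c) ⋙ chCone (mapNatTo b))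
      (mapNatTo b)).inv) θ₂
    (fun K => .comp (isHEquiv_chConeMap _ _ _ _ _ K (isHEquiv_braidLift c hs h K)
      (isHEquiv_of_isIso (𝟙 _))) (isHEquiv_of_isIso _))
    (fun K => isHEquiv_chConeMap _ _ _ _ _ K (isHEquiv_braidLift' b ht' h' K).neg
      (isHEquiv_of_isIso (𝟙 _)))⟩

end BraidRelation

/-! ### The additive basis of A_m and its corners (i)A(j). -/

section ZigCoordinates

variable {m : ℕ}

lemma rep_gen (g : Gen m) : rep m (gen g) = genOp g := zigLift_gen _ _ g

/-- Letting an element act on the unit vector recovers its label. Thus the spanning elements `elt`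
are linearly independent and `coord` is their dual basis. -/
lemma rep_elt (b : Bas m) : rep m (elt b) (unitVec m) = Finsupp.single b 1 := by
  rcases b with i | i | i | i
  · simp only [elt, rep_gen, unitVec, map_sum, genOp_single, act, vec_ite]
    simp
  · simp only [elt, rep_gen, unitVec, map_sum, genOp_single, act, vec_ite]
    simp
  · simp only [elt, rep_gen, unitVec, map_sum, genOp_single, act, vec_ite]
    simp
  · simp only [elt, map_mul, rep_gen, unitVec, map_sum, Module.End.mul_apply, genOp_single, act,
      vec_ite]
    simp [apply_ite (genOp (Gen.dn i)), genOp_single, act, vec]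

lemma coord_elt (b c : Bas m) : coord b (elt c) = if c = b then 1 else 0 := by
  change rep m (elt c) (unitVec m) b = _
  rw [rep_elt, Finsupp.single_apply]

/-- The loop `(i+1|i|i+1)` at the vertex `i + 1`. -/
def loop (i : Fin m) : Zig m := d i * u i

lemma loop_mem (i : Fin m) : loop i ∈ gr m 1 := elt_mem (.inr (.inr (.inr i)))

lemma e_loop (i : Fin m) : e i.succ * loop i = loop i := by rw [loop, ← mul_assoc, e_d]
lemma loop_e (i : Fin m) : loop i * e i.succ = loop i := by rw [loop, mul_assoc, u_e]

lemma e_loop_ne {k : Fin (m + 1)} {i : Fin m} (h : k ≠ i.succ) : e k * loop i = 0 := by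
  rw [loop, ← mul_assoc, e_d_ne h, zero_mul]

/-- The coefficient of `(i)` in `(i) a (i)`. -/
def coeffE (i : Fin m) : Zig m →ₗ[ℤ] ℤ where
  toFun a := coord (.inl i.succ) (e i.succ * a * e i.succ)
  map_add' a b := by rw [mul_add, add_mul, map_add]
  map_smul' c a := by rw [mul_smul_comm, smul_mul_assoc, map_smul]; rfl

/-- The coefficient of the loop at `i` in `(i) a (i)`. -/
def coeffX (i : Fin m) : Zig m →ₗ[ℤ] ℤ where
  toFun a := coord (.inr (.inr (.inr i))) (e i.succ * a * e i.succ)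
  map_add' a b := by rw [mul_add, add_mul, map_add]
  map_smul' c a := by rw [mul_smul_comm, smul_mul_assoc, map_smul]; rfl

lemma e_mul_e_mem {i j : Fin (m + 1)} {a : Zig m} {n : ℤ} (ha : a ∈ gr m n) :
    e i * a * e j ∈ gr m n := by
  simpa using mul_mem_gr (mul_mem_gr (e_mem i) ha) (e_mem j)

lemma coeffE_eq_zero (i : Fin m) {a : Zig m} {n : ℤ} (ha : a ∈ gr m n) (hn : n ≠ 0) :
    coeffE i a = 0 := coord_eq_zero (e_mul_e_mem ha) _ (Ne.symm hn)

lemma coeffX_eq_zero (i : Fin m) {a : Zig m} {n : ℤ} (ha : a ∈ gr m n) (hn : n ≠ 1) :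
    coeffX i a = 0 := coord_eq_zero (e_mul_e_mem ha) _ (Ne.symm hn)

@[simp] lemma coeffE_e_mul (i : Fin m) (a : Zig m) : coeffE i (e i.succ * a) = coeffE i a := by
  change coord _ _ = coord _ _
  rw [← mul_assoc, e_e]

@[simp] lemma coeffX_e_mul (i : Fin m) (a : Zig m) : coeffX i (e i.succ * a) = coeffX i a := by
  change coord _ _ = coord _ _
  rw [← mul_assoc, e_e]

@[simp] lemma coeffE_mul_e (i : Fin m) (a : Zig m) : coeffE i (a * e i.succ) = coeffE i a := by
  change coord _ _ = coord _ _
  rw [mul_assoc, mul_assoc, e_e, mul_assoc]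

@[simp] lemma coeffX_mul_e (i : Fin m) (a : Zig m) : coeffX i (a * e i.succ) = coeffX i a := by
  change coord _ _ = coord _ _
  rw [mul_assoc, mul_assoc, e_e, mul_assoc]

@[simp] lemma coeffE_e (i : Fin m) : coeffE i (e i.succ) = 1 := by
  change coord _ _ = _
  rw [e_e, e_e, show e i.succ = elt (.inl i.succ) from rfl, coord_elt, if_pos rfl]

@[simp] lemma coeffX_e (i : Fin m) : coeffX i (e i.succ) = 0 := coeffX_eq_zero i (e_mem _) (by simp)

@[simp] lemma coeffE_loop (i : Fin m) : coeffE i (loop i) = 0 :=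
  coeffE_eq_zero i (loop_mem i) (by simp)

@[simp] lemma coeffX_loop (i : Fin m) : coeffX i (loop i) = 1 := by
  change coord _ _ = _
  rw [e_loop, loop_e, loop, show d i * u i = elt (.inr (.inr (.inr i))) from rfl, coord_elt,
    if_pos rfl]

/-- To describe `(i) a (j)`, it is enough to consider the elements of the basis. -/
lemma e_mul_e_eq_sum (i j : Fin (m + 1)) (a : Zig m) :
    e i * a * e j = ∑ b, coord b a • (e i * elt b * e j) := by
  conv_lhs => rw [← sum_coord a]
  simp only [Finset.mul_sum, Finset.sum_mul, mul_smul_comm, smul_mul_assoc]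

/-- Among the basis elements only the idempotent and the loop start and end at the vertex `i.succ`.
-/
lemma e_mul_mul_e_self (i : Fin m) (a : Zig m) :
    e i.succ * a * e i.succ = coeffE i a • e i.succ + coeffX i a • loop i := by
  have h : ∀ b : Bas m, e i.succ * elt b * e i.succ =
      coeffE i (elt b) • e i.succ + coeffX i (elt b) • loop i := by
    -- Both coefficients depend only on the corner of `x`, so they vanish with it.
    have h0 : ∀ x : Zig m, e i.succ * x * e i.succ = 0 → e i.succ * x * e i.succ =
      coeffE i x • e i.succ + coeffX i x • loop i := fun x hx => by
        rw [← coeffE_e_mul, ← coeffE_mul_e, ← coeffX_e_mul, ← coeffX_mul_e, hx]; simp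
    rintro (k | k | k | k)
    · by_cases hk : i.succ = k
      · subst hk; simp [elt, e_e]
      · exact h0 _ (by simp only [elt]; rw [e_e_ne hk, zero_mul])
    · exact h0 _ (by
        simp only [elt]
        by_cases hk : i.succ = k.castSucc
        · rw [mul_assoc, u_e_ne, mul_zero]
          rw [hk]; exact fun h => by simp [Fin.ext_iff] at h
        · rw [e_u_ne hk, zero_mul])
    · exact h0 _ (by
        simp only [elt]
        by_cases hk : i = k
        · subst hk
          rw [mul_assoc, d_e_ne, mul_zero]
          exact fun h => by simp [Fin.ext_iff] at h
        · rw [e_d_ne (by simpa using hk), zero_mul])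
    · by_cases hk : k = i
      · subst hk
        rw [show elt (.inr (.inr (.inr k))) = loop k from rfl]
        simp [e_loop, loop_e]
      · exact h0 _ (by
          rw [show elt (.inr (.inr (.inr k))) = loop k from rfl,
            e_loop_ne (by simpa using Ne.symm hk), zero_mul])
  have h' := e_mul_e_eq_sum i.succ i.succ a
  rw [h']
  conv_rhs => rw [← sum_coord a]
  simp only [h, map_sum, map_smul, Finset.sum_smul, smul_add, Finset.sum_add_distrib, smul_smul,
    smul_eq_mul]

/-- `(i) A (i+1)` is spanned by `(i|i+1)`. -/
lemma e_mul_mul_e_up (k : Fin m) (a : Zig m) :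
    ∃ n : ℤ, e k.castSucc * a * e k.succ = n • u k := by
  have h : ∀ b : Bas m, ∃ n : ℤ, e k.castSucc * elt b * e k.succ = n • u k := by
    rintro (l | l | l | l) <;> simp only [elt]
    · refine ⟨0, ?_⟩
      by_cases hl : k.castSucc = l
      · subst hl
        rw [e_e, e_e_ne, zero_smul]
        exact fun h => by simp [Fin.ext_iff] at h
      · rw [e_e_ne hl, zero_mul, zero_smul]
    · by_cases hl : k = l
      · subst hl; exact ⟨1, by rw [e_u, u_e, one_smul]⟩
      · exact ⟨0, by rw [e_u_ne (by simpa using hl), zero_mul, zero_smul]⟩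
    · refine ⟨0, ?_⟩
      by_cases hl : k.castSucc = l.succ
      · rw [mul_assoc, d_e_ne, mul_zero, zero_smul]
        intro h
        simp [Fin.ext_iff] at h hl
        omega
      · rw [e_d_ne hl, zero_mul, zero_smul]
    · refine ⟨0, ?_⟩
      by_cases hl : k.castSucc = l.succ
      · rw [mul_assoc, mul_assoc, u_e_ne, mul_zero, mul_zero, zero_smul]
        rw [← hl]
        exact fun h => by simp [Fin.ext_iff] at h
      · rw [← mul_assoc, e_d_ne hl, zero_mul, zero_mul, zero_smul]
  choose n hn using h
  exact ⟨∑ b, coord b a * n b, by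
    rw [e_mul_e_eq_sum]; simp only [hn, smul_smul, Finset.sum_smul]⟩

/-- `(i+1) A (i)` is spanned by `(i+1|i)`. -/
lemma e_mul_mul_e_down (k : Fin m) (a : Zig m) :
    ∃ n : ℤ, e k.succ * a * e k.castSucc = n • d k := by
  have h : ∀ b : Bas m, ∃ n : ℤ, e k.succ * elt b * e k.castSucc = n • d k := by
    rintro (l | l | l | l) <;> simp only [elt]
    · refine ⟨0, ?_⟩
      by_cases hl : k.succ = l
      · subst hl
        rw [e_e, e_e_ne, zero_smul]
        exact fun h => by simp [Fin.ext_iff] at h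
      · rw [e_e_ne hl, zero_mul, zero_smul]
    · refine ⟨0, ?_⟩
      by_cases hl : k.succ = l.castSucc
      · rw [mul_assoc, u_e_ne, mul_zero, zero_smul]
        intro h
        simp [Fin.ext_iff] at h hl
        omega
      · rw [e_u_ne hl, zero_mul, zero_smul]
    · by_cases hl : k = l
      · subst hl; exact ⟨1, by rw [e_d, d_e, one_smul]⟩
      · exact ⟨0, by rw [e_d_ne (by simpa using hl), zero_mul, zero_smul]⟩
    · refine ⟨0, ?_⟩
      by_cases hl : k = l
      · subst hl
        rw [mul_assoc, mul_assoc, u_e_ne, mul_zero, mul_zero, zero_smul]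
        exact fun h => by simp [Fin.ext_iff] at h
      · rw [← mul_assoc, e_d_ne (by simpa using hl), zero_mul, zero_mul, zero_smul]
  choose n hn using h
  exact ⟨∑ b, coord b a * n b, by
    rw [e_mul_e_eq_sum]; simp only [hn, smul_smul, Finset.sum_smul]⟩

/-- `(i) A (j) = 0` for `|i - j| > 1`. -/
lemma e_mul_mul_e_far {i j : Fin (m + 1)} (h : i.val + 1 < j.val ∨ j.val + 1 < i.val) (a : Zig m) :
    e i * a * e j = 0 := by
  rw [e_mul_e_eq_sum]
  refine Finset.sum_eq_zero fun b _ => ?_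
  suffices H : e i * elt b * e j = 0 by rw [H, smul_zero]
  rcases b with l | l | l | l <;> simp only [elt]
  · by_cases hl : i = l
    · subst hl; rw [e_e, e_e_ne]; rintro rfl; omega
    · rw [e_e_ne hl, zero_mul]
  · by_cases hl : i = l.castSucc
    · rw [mul_assoc, u_e_ne, mul_zero]; rintro rfl; subst hl; simp at h; omega
    · rw [e_u_ne hl, zero_mul]
  · by_cases hl : i = l.succ
    · rw [mul_assoc, d_e_ne, mul_zero]; rintro rfl; subst hl; simp at h; omega
    · rw [e_d_ne hl, zero_mul]
  · by_cases hl : i = l.succ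
    · rw [mul_assoc, mul_assoc, u_e_ne, mul_zero, mul_zero]; rintro rfl; subst hl; omega
    · rw [← mul_assoc, e_d_ne hl, zero_mul, zero_mul]

end ZigCoordinates

/-! ### The universal property of the bimodules P_i ⊗ _iP tensored with a module. -/

section Induction

open GrBimod FinGrMod

variable {m : ℕ}

/-- The additive map `x ↦ b ⊗ x`. -/
def tens {B : GrBimod (gr m)} {M : AMod m} (b : B) : M →ₗ[ℤ] GrBimod.tensor B M :=
  AddMonoidHom.toIntLinearMap (AddMonoidHom.mk' (fun x => (tmul b x : GrBimod.tensor B M))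
    (fun x y => tmul_add b x y))

/-- The homogeneous elements `a • (g ⊗ x)` of total degree `n`, where `g` has degree `r`. -/
def simpleTensors {B : GrBimod (gr m)} (M : AMod m) (g : B) (r n : ℤ) :
    Set (GrBimod.tensor B M) :=
  {t | ∃ k l : ℤ, k + r + l = n ∧ ∃ a ∈ gr m k, ∃ x ∈ M.deg l, t = a • tens g x}

/-- `B` is, as a graded bimodule, freely generated by the element `g` of degree `r` with
`(i) g = g = g (i)`. -/
structure IsGen (i : Fin (m + 1)) (r : ℤ) (B : GrBimod (gr m)) (g : B) : Prop where
  mem : g ∈ B.deg r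
  e_smul : e i • g = g
  op_e_smul : MulOpposite.op (e i) • g = g
  mem_closure : ∀ (M : AMod m) (n : ℤ) (t : GrBimod.tensor B M), t ∈ (GrBimod.tensor B M).deg n →
    t ∈ AddSubgroup.closure (simpleTensors M g r n)
  exists_addHom : ∀ (M : AMod m) {G : Type} [AddCommGroup G] (Λ : Zig m →ₗ[ℤ] M →ₗ[ℤ] G),
    ∃ F : GrBimod.tensor B M →ₗ[ℤ] G, ∀ a x, F (a • tens g x) = Λ (a * e i) (e i • x)

lemma PQ_induction {i : Fin (m + 1)} {C : PQ i → Prop} (zero : C 0)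
    (add : ∀ s t, C s → C t → C (s + t)) (h : ∀ a b, C (pq i a b)) (t : PQ i) : C t := by
  refine TensorProduct.induction_on (motive := C) (show P i ⊗[ℤ] Q i from t) zero (fun p q => ?_) add
  have := h p q
  rwa [pq, toP_coe, toQ_coe] at this

/-- The reason is B ⊗_A M = A(i) ⊗_ℤ (i)M for a freely generated B. An additive map out of the
bimodule with values in Hom(M, G) is paired with M, and balancedness is checked on the elements `a g
b`. -/
lemma exists_addHom_of {i : Fin (m + 1)} {B : GrBimod (gr m)} {g : B}
    (hgen : ∀ t : B, t ∈ AddSubgroup.closure {t : B | ∃ a b : Zig m, t = a • MulOpposite.op b • g})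
    (hlift : ∀ {G : Type} [AddCommGroup G] (Λ : Zig m →ₗ[ℤ] Zig m →ₗ[ℤ] G), ∃ F : B →ₗ[ℤ] G,
      ∀ a b, F (a • MulOpposite.op b • g) = Λ (a * e i) (e i * b))
    (M : AMod m) {G : Type} [AddCommGroup G] (Λ : Zig m →ₗ[ℤ] M →ₗ[ℤ] G) :
    ∃ F : GrBimod.tensor B M →ₗ[ℤ] G, ∀ a x, F (a • tens g x) = Λ (a * e i) (e i • x) := by
  -- The right action on `B` is recorded as an action on the argument: `b` goes to `x ↦ Λ a (b •
  -- x)`.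
  obtain ⟨F, hF⟩ := hlift (G := M →ₗ[ℤ] G) (AddMonoidHom.toIntLinearMap (AddMonoidHom.mk'
    (fun a => AddMonoidHom.toIntLinearMap (AddMonoidHom.mk'
      (fun b => (Λ a).comp (DistribSMul.toAddMonoidHom M b).toIntLinearMap)
      (fun b b' => by ext x; simp [add_smul])))
    (fun a a' => by ext b x; simp)))
  have hF' : ∀ a b x, F (a • MulOpposite.op b • g) x = Λ (a * e i) ((e i * b) • x) :=
    fun a b x => by rw [hF]; rfl
  refine ⟨((tensorRel B M).restrictScalars ℤ).liftQ (TensorProduct.lift F) (fun t ht => ?_),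
    fun a x => ?_⟩
  · change TensorProduct.lift F t = 0
    -- The relations are a left A-span, but the map constructed is only additive; the claim must
    -- therefore be stable under left multiplication before span induction applies.
    suffices h : ∀ a' : Zig m, TensorProduct.lift F (a' • t) = 0 by simpa using h 1
    refine Submodule.span_induction
      (p := fun t _ => ∀ a' : Zig m, TensorProduct.lift F (a' • t) = 0) ?_
      (by simp) (fun x y _ _ hx hy a' => by rw [smul_add, map_add, hx, hy, add_zero])
      (fun c x _ hx a' => by rw [smul_smul]; exact hx _) ht
    rintro _ ⟨b, a, x, rfl⟩ a'
    rw [smul_sub, map_sub, sub_eq_zero, TensorProduct.smul_tmul', TensorProduct.smul_tmul',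
      TensorProduct.lift.tmul, TensorProduct.lift.tmul]
    refine AddSubgroup.closure_induction (p := fun b _ => F (a' • MulOpposite.op a • b) x =
      F (a' • b) (a • x)) ?_ (by simp)
      (fun s t _ _ hs ht => by simp only [smul_add, map_add, LinearMap.add_apply, hs, ht])
      (fun s _ hs => by simp only [smul_neg, map_neg, LinearMap.neg_apply, hs]) (hgen b)
    rintro _ ⟨c, d, rfl⟩
    rw [← smul_comm c, smul_smul, smul_smul, smul_smul, ← MulOpposite.op_mul, hF', hF', smul_smul,
      mul_assoc (e i)]
  · change F (a • g) x = _
    have := hF' a 1 x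
    rwa [MulOpposite.op_one, one_smul, mul_one] at this

lemma exists_lift_PQ (i : Fin (m + 1)) {G : Type} [AddCommGroup G]
    (Λ : Zig m →ₗ[ℤ] Zig m →ₗ[ℤ] G) :
    ∃ F : PQ i →ₗ[ℤ] G, ∀ a b, F (a • MulOpposite.op b • pq i 1 1) = Λ (a * e i) (e i * b) := by
  let F : P i ⊗[ℤ] Q i →ₗ[ℤ] G := TensorProduct.lift
    (AddMonoidHom.toIntLinearMap (AddMonoidHom.mk'
      (fun p : P i => AddMonoidHom.toIntLinearMap (AddMonoidHom.mk' (fun q : Q i => Λ p q)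
        (fun q q' => by simp)))
      (fun p p' => by ext q; simp)))
  refine ⟨F, fun a b => ?_⟩
  rw [op_smul_pq, smul_pq, mul_one, one_mul]
  rfl

lemma PQ_closure (i : Fin (m + 1)) (t : PQ i) :
    t ∈ AddSubgroup.closure {t : PQ i | ∃ a b : Zig m, t = a • MulOpposite.op b • pq i 1 1} :=
  PQ_induction (C := fun t => t ∈ AddSubgroup.closure
    {t : PQ i | ∃ a b : Zig m, t = a • MulOpposite.op b • pq i 1 1}) (zero_mem _)
    (fun _ _ => add_mem) (fun a b => AddSubgroup.subset_closure
      ⟨a, b, by rw [op_smul_pq, smul_pq, mul_one, one_mul]⟩) t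

/-- Right multiplications move across the tensor sign: (a g b) ⊗ x = a (g ⊗ b x). -/
lemma mem_closure_simpleTensors {B : GrBimod (gr m)} (g : B) (r : ℤ) (M : AMod m)
    (h : ∀ n t, t ∈ B.deg n → t ∈ AddSubgroup.closure
      {t : B | ∃ k l : ℤ, k + r + l = n ∧ ∃ a ∈ gr m k, ∃ b ∈ gr m l,
        t = a • MulOpposite.op b • g})
    (n : ℤ) (t : GrBimod.tensor B M) (ht : t ∈ (GrBimod.tensor B M).deg n) :
    t ∈ AddSubgroup.closure (simpleTensors M g r n) := by
  obtain ⟨t, ht, rfl⟩ := ht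
  refine Submodule.span_induction (p := fun t _ => (tensorRel B M).mkQ t ∈
    AddSubgroup.closure (simpleTensors M g r n)) ?_ (by rw [map_zero]; exact zero_mem _)
    (fun x y _ _ hx hy => by rw [map_add]; exact add_mem hx hy)
    (fun c x _ hx => by rw [map_zsmul]; exact zsmul_mem hx c) ht
  rintro _ ⟨k, l, rfl, b, hb, x, hx, rfl⟩
  refine AddSubgroup.closure_induction (p := fun b _ => (tensorRel B M).mkQ (b ⊗ₜ x) ∈
    AddSubgroup.closure (simpleTensors M g r (k + l))) ?_
    (by rw [TensorProduct.zero_tmul, map_zero]; exact zero_mem _)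
    (fun b b' _ _ hb hb' => by rw [TensorProduct.add_tmul, map_add]; exact add_mem hb hb')
    (fun b _ hb => by rw [TensorProduct.neg_tmul, map_neg]; exact neg_mem hb) (h k b hb)
  rintro _ ⟨k, l', rfl, a, ha, b, hb, rfl⟩
  refine AddSubgroup.subset_closure ⟨k, l' + l, by ring, a, ha, b • x, M.smul_mem hb hx, ?_⟩
  exact congrArg (fun t => a • t) (tmul_smul g b x).symm

lemma PQ_deg_closure (i : Fin (m + 1)) (n : ℤ) (t : PQ i) (ht : t ∈ (PQ i).deg n) :
    t ∈ AddSubgroup.closure {t : PQ i | ∃ k l : ℤ, k + l = n ∧ ∃ a ∈ gr m k, ∃ b ∈ gr m l,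
        t = a • MulOpposite.op b • pq i 1 1} := by
  refine Submodule.span_induction (p := fun t _ => t ∈ AddSubgroup.closure {t : PQ i |
    ∃ k l : ℤ, k + l = n ∧ ∃ a ∈ gr m k, ∃ b ∈ gr m l, t = a • MulOpposite.op b • pq i 1 1}) ?_
    (zero_mem _) (fun x y _ _ hx hy => add_mem hx hy) (fun c x _ hx => zsmul_mem hx c) ht
  rintro _ ⟨k, l, rfl, p, hp, q, hq, rfl⟩
  refine AddSubgroup.subset_closure ⟨k, l, rfl, p, hp, q, hq, ?_⟩
  rw [op_smul_pq, smul_pq, mul_one, one_mul, pq, toP_coe, toQ_coe]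

lemma e_smul_pq_one (i : Fin (m + 1)) : e i • pq i 1 1 = pq i 1 1 := by
  rw [smul_pq, mul_one]
  exact congrArg (fun p => (p ⊗ₜ toQ i 1 : P i ⊗[ℤ] Q i))
    (Subtype.ext ((e_e i).trans (one_mul _).symm))

lemma op_e_smul_pq_one (i : Fin (m + 1)) : MulOpposite.op (e i) • pq i 1 1 = pq i 1 1 := by
  rw [op_smul_pq, one_mul]
  exact congrArg (fun p => (toP i 1 ⊗ₜ p : P i ⊗[ℤ] Q i))
    (Subtype.ext ((e_e i).trans (mul_one _).symm))

lemma isGen_PQ (i : Fin (m + 1)) : IsGen i 0 (PQ i) (pq i 1 1) where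
  mem := pq_mem i (add_zero 0) one_mem_gr one_mem_gr
  e_smul := e_smul_pq_one i
  op_e_smul := op_e_smul_pq_one i
  mem_closure M n t ht := mem_closure_simpleTensors _ 0 M
    (fun n t ht => by simpa using PQ_deg_closure i n t ht) n t ht
  exists_addHom M _ _ Λ := exists_addHom_of (PQ_closure i) (exists_lift_PQ i) M Λ

/-- The generator of the shifted bimodule. -/
def pqShift (i : Fin (m + 1)) (r : ℤ) : (PQ i).shift r := pq i 1 1

lemma isGen_shift (i : Fin (m + 1)) (r : ℤ) : IsGen i r ((PQ i).shift r) (pqShift i r) where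
  mem := by
    change pq i 1 1 ∈ (PQ i).deg (r - r)
    rw [sub_self]
    exact (isGen_PQ i).mem
  e_smul := e_smul_pq_one i
  op_e_smul := op_e_smul_pq_one i
  mem_closure M n t ht := mem_closure_simpleTensors (B := (PQ i).shift r) (pqShift i r) r M
    (fun n t ht => by
      have := PQ_deg_closure i (n - r) t ht
      simp only [eq_sub_iff_add_eq, add_right_comm] at this
      exact this) n t ht
  exists_addHom M _ _ Λ := exists_addHom_of (B := (PQ i).shift r) (g := pqShift i r) (PQ_closure i)
    (exists_lift_PQ i) M Λ

namespace IsGen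

variable {i : Fin (m + 1)} {r : ℤ} {B : GrBimod (gr m)} {g : B} (hB : IsGen i r B g) {M N : AMod m}

include hB

lemma induction {C : GrBimod.tensor B M → Prop} (zero : C 0) (add : ∀ s t, C s → C t → C (s + t))
    (neg : ∀ s, C s → C (-s)) (h : ∀ (a : Zig m) (x : M), C (a • tens g x)) (t : GrBimod.tensor B M) : C t := by
  refine grading_induction (GrBimod.tensor B M).isInternal (fun n t ht => ?_) zero add t
  refine AddSubgroup.closure_induction (p := fun t _ => C t) ?_ zero (fun _ _ _ _ => add _ _)
    (fun _ _ => neg _) (hB.mem_closure M n t ht)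
  rintro _ ⟨_, _, _, a, _, x, _, rfl⟩
  exact h a x

lemma hom_ext {f f' : GrBimod.tensor B M ⟶ N} (h : ∀ x : M, lin f (tens g x) = lin f' (tens g x)) :
    f = f' := by
  ext t
  exact hB.induction (C := fun t => lin f t = lin f' t) (by simp)
    (fun s t hs ht => by simp only [map_add, hs, ht]) (fun s hs => by simp only [map_neg, hs])
    (fun a x => by simp only [map_smul, h]) t

lemma tens_e_smul (x : M) : tens g (e i • x) = tens g x :=
  (tmul_smul g (e i) x).trans (by rw [hB.op_e_smul]; rfl)

lemma e_smul_tens (x : M) : e i • tens g x = tens g x := by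
  change (tmul (e i • g) x : GrBimod.tensor B M) = _
  rw [hB.e_smul]; rfl

lemma mul_e_smul_tens (a : Zig m) (x : M) : (a * e i) • tens g x = a • tens g x := by
  rw [mul_smul, hB.e_smul_tens]

lemma tens_mem {n : ℤ} {x : M} (hx : x ∈ M.deg n) :
    (tens g x : GrBimod.tensor B M) ∈ (GrBimod.tensor B M).deg (n + r) :=
  ⟨g ⊗ₜ x, tmul_mem_tensorDeg (add_comm r n) hB.mem hx, rfl⟩

lemma map_mem {φ : GrBimod.tensor B M →ₗ[ℤ] N} {s : ℤ}
    (h : ∀ k l : ℤ, ∀ a ∈ gr m k, ∀ x ∈ M.deg l, φ (a • tens g x) ∈ N.deg (k + r + l + s))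
    {n : ℤ} {t : GrBimod.tensor B M} (ht : t ∈ (GrBimod.tensor B M).deg n) :
    φ t ∈ N.deg (n + s) := by
  refine AddSubgroup.closure_induction (p := fun t _ => φ t ∈ N.deg (n + s)) ?_ (by simp)
    (fun _ _ _ _ hx hy => by rw [map_add]; exact add_mem hx hy)
    (fun _ _ hx => by rw [map_neg]; exact neg_mem hx) (hB.mem_closure M n t ht)
  rintro _ ⟨k, l, rfl, a, ha, x, hx, rfl⟩
  exact h k l a ha x hx

/-- A morphism out of A(i) ⊗_ℤ (i)M is the same as an additive map (i)M → (i)N. This allows maps to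
be defined from data, such as coefficient functionals, that are not A-linear. -/
lemma exists_hom (φ : M →ₗ[ℤ] N) (hφ : ∀ n, ∀ x ∈ M.deg n, φ x ∈ N.deg (n + r)) :
    ∃ f : GrBimod.tensor B M ⟶ N, ∀ x : M, lin f (tens g x) = e i • φ (e i • x) := by
  obtain ⟨F, hF⟩ := hB.exists_addHom M (AddMonoidHom.toIntLinearMap (AddMonoidHom.mk'
    (fun a => (DistribSMul.toAddMonoidHom N a).toIntLinearMap.comp φ)
    (fun a b => by ext x; simp [add_smul])))
  have hF' : ∀ (a : Zig m) (x : M), F (a • tens g x) = (a * e i) • φ (e i • x) := hF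
  have hsmul : ∀ (a : Zig m) (t : GrBimod.tensor B M), F (a • t) = a • F t := fun a t => hB.induction
    (C := fun t => F (a • t) = a • F t) (by simp)
    (fun s t hs ht => by simp only [smul_add, map_add, hs, ht])
    (fun s hs => by simp only [smul_neg, map_neg, hs])
    (fun b x => by rw [smul_smul, hF', hF', smul_smul, mul_assoc]) t
  refine ⟨ofLin { toFun := F, map_add' := map_add F, map_smul' := hsmul } (fun n t ht => ?_),
    fun x => ?_⟩
  · have := hB.map_mem (φ := F) (s := 0) (N := N) (fun k l a ha x hx => ?_) ht
    · rwa [add_zero] at this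
    · rw [hF']
      have h₁ := M.smul_mem (e_mem i) hx
      have h₂ := N.smul_mem (mul_mem_gr ha (e_mem i)) (hφ _ _ h₁)
      rwa [show k + 0 + (0 + l + r) = k + r + l + 0 by ring] at h₂
  · have := hF' 1 x
    rwa [one_smul, one_mul] at this

/-- The morphism induced by an additive map of degree `r`. -/
def lift (φ : M →ₗ[ℤ] N) (hφ : ∀ n, ∀ x ∈ M.deg n, φ x ∈ N.deg (n + r)) :
    GrBimod.tensor B M ⟶ N := (hB.exists_hom φ hφ).choose

lemma lift_tens (φ : M →ₗ[ℤ] N) (hφ : ∀ n, ∀ x ∈ M.deg n, φ x ∈ N.deg (n + r)) (x : M) :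
    lin (hB.lift φ hφ) (tens g x) = e i • φ (e i • x) := (hB.exists_hom φ hφ).choose_spec x

/-- The additive map `a ⊗ x ↦ c (a) x`. -/
def trace (c : Zig m →ₗ[ℤ] ℤ) (M : AMod m) : GrBimod.tensor B M →ₗ[ℤ] M :=
  (hB.exists_addHom M (LinearMap.lsmul ℤ M ∘ₗ c)).choose

lemma trace_smul_tens (c : Zig m →ₗ[ℤ] ℤ) (a : Zig m) (x : M) :
    hB.trace c M (a • tens g x) = c (a * e i) • e i • x :=
  (hB.exists_addHom M (LinearMap.lsmul ℤ M ∘ₗ c)).choose_spec a x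

lemma trace_tens (c : Zig m →ₗ[ℤ] ℤ) (x : M) :
    hB.trace c M (tens g x) = c (e i) • e i • x := by
  have := hB.trace_smul_tens c 1 x
  rwa [one_smul, one_mul] at this

/-- If `c` is concentrated in degree `s`, only `a` of degree `s` contributes to `a • (g ⊗ x)`, and
`x` then has degree `n - r - s`. -/
lemma trace_mem {c : Zig m →ₗ[ℤ] ℤ} {s : ℤ} (hc : ∀ n, ∀ a ∈ gr m n, n ≠ s → c a = 0) {n : ℤ}
    {t : GrBimod.tensor B M} (ht : t ∈ (GrBimod.tensor B M).deg n) :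
    hB.trace c M t ∈ M.deg (n + (-r - s)) := by
  refine hB.map_mem (fun k l a ha x hx => ?_) ht
  rw [trace_smul_tens]
  have ha' : a * e i ∈ gr m k := by simpa using mul_mem_gr ha (e_mem i)
  by_cases hk : k = s
  · subst hk
    have := M.smul_mem (e_mem i) hx
    rw [show k + r + l + (-r - k) = 0 + l by ring]
    exact Submodule.smul_mem _ _ this
  · rw [hc k _ ha' hk, zero_smul]
    exact zero_mem _

lemma trace_e_smul {c : Zig m →ₗ[ℤ] ℤ} {f : Zig m} (hc : ∀ a, c (f * a) = c a)
    (t : GrBimod.tensor B M) : hB.trace c M (f • t) = hB.trace c M t := by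
  refine hB.induction (C := fun t => hB.trace c M (f • t) = hB.trace c M t) (by simp)
    (fun s t hs ht => by simp only [smul_add, map_add, hs, ht])
    (fun s hs => by simp only [smul_neg, map_neg, hs]) (fun a x => ?_) t
  rw [smul_smul, trace_smul_tens, trace_smul_tens, mul_assoc, hc]

end IsGen

end Induction

/-! ### Natural additive maps of nonzero degree; the counit and the unit. -/

section AdditiveNaturalMaps

open GrBimod FinGrMod

variable {m : ℕ}

/-- A natural additive map of degree `r`. -/
structure AddNat (F G : AMod m ⥤ AMod m) (r : ℤ) where
  app (M : AMod m) : F.obj M →ₗ[ℤ] G.obj M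
  app_mem (M : AMod m) {n : ℤ} {x : F.obj M} : x ∈ (F.obj M).deg n → app M x ∈ (G.obj M).deg (n + r)
  naturality {M N : AMod m} (f : M ⟶ N) (x : F.obj M) :
    lin (G.map f) (app M x) = app N (lin (F.map f) x)

namespace AddNat

variable {F G H : AMod m ⥤ AMod m} {r s t : ℤ}

/-- Composition. -/
def comp (φ : AddNat F G r) (ψ : AddNat G H s) (h : r + s = t) : AddNat F H t where
  app M := ψ.app M ∘ₗ φ.app M
  app_mem M n x hx := by
    have := ψ.app_mem M (φ.app_mem M hx)
    rwa [add_assoc, h] at this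
  naturality f x := by simp only [LinearMap.comp_apply, ψ.naturality, φ.naturality]

/-- Difference. -/
def sub (φ ψ : AddNat F G r) : AddNat F G r where
  app M := φ.app M - ψ.app M
  app_mem M n x hx := sub_mem (φ.app_mem M hx) (ψ.app_mem M hx)
  naturality f x := by simp only [LinearMap.sub_apply, map_sub, ψ.naturality, φ.naturality]

/-- The negative. -/
def neg (φ : AddNat F G r) : AddNat F G r where
  app M := - φ.app M
  app_mem M n x hx := neg_mem (φ.app_mem M hx)
  naturality f x := by simp only [LinearMap.neg_apply, map_neg, φ.naturality]

/-- Multiplication by a homogeneous element. -/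
def smul (F : AMod m ⥤ AMod m) {a : Zig m} (ha : a ∈ gr m r) : AddNat F F r where
  app M := (DistribSMul.toAddMonoidHom (F.obj M) a).toIntLinearMap
  app_mem M n x hx := by
    rw [add_comm]
    exact (F.obj M).smul_mem ha hx
  naturality f x := by simp

end AddNat

variable {i : Fin (m + 1)} {r : ℤ} {B : GrBimod (gr m)} {g : B}

namespace IsGen

/-- The natural map `x ↦ g ⊗ x`. -/
def tensNat (hB : IsGen i r B g) (F : AMod m ⥤ AMod m) : AddNat F (F ⋙ tensorFunctor B) r where
  app M := tens g
  app_mem M n x hx := hB.tens_mem hx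
  naturality f x := rfl

lemma lin_trace (hB : IsGen i r B g) (c : Zig m →ₗ[ℤ] ℤ) {M N : AMod m} (f : M ⟶ N)
    (t : GrBimod.tensor B M) :
    lin f (hB.trace c M t) = hB.trace c N (lin (tensorMap (Hom.id B) f) t) := by
  refine hB.induction (C := fun t => lin f (hB.trace c M t) =
      hB.trace c N (lin (tensorMap (Hom.id B) f) t)) (by simp)
      (fun s t hs ht => by simp only [map_add, hs, ht])
      (fun s hs => by simp only [map_neg, hs]) (fun a x => ?_) t
  rw [trace_smul_tens, map_smul (lin (tensorMap (Hom.id B) f)), map_zsmul (lin f),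
    map_smul (lin f)]
  exact (hB.trace_smul_tens c a (lin f x)).symm

/-- The trace as a natural map. -/
def traceNat (hB : IsGen i r B g) {c : Zig m →ₗ[ℤ] ℤ} {s t : ℤ}
    (hc : ∀ n, ∀ a ∈ gr m n, n ≠ s → c a = 0) (h : -r - s = t) (F : AMod m ⥤ AMod m) :
    AddNat (F ⋙ tensorFunctor B) F t where
  app M := hB.trace c (F.obj M)
  app_mem M n x hx := h ▸ hB.trace_mem hc hx
  naturality f x := hB.lin_trace c (F.map f) x

/-- The natural transformation induced by a natural additive map of degree `r`. -/
def liftNat (hB : IsGen i r B g) {F G : AMod m ⥤ AMod m} (φ : AddNat F G r) :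
    F ⋙ tensorFunctor B ⟶ G where
  app M := hB.lift (φ.app M) (fun _ _ hx => φ.app_mem M hx)
  naturality {M N} f := hB.hom_ext fun x => by
    refine (hB.lift_tens (φ.app N) _ (lin (F.map f) x)).trans ?_
    refine Eq.trans ?_ (congrArg (lin (G.map f)) (hB.lift_tens (φ.app M) _ x)).symm
    rw [map_smul (lin (G.map f)), φ.naturality, map_smul (lin (F.map f))]

end IsGen

/-- `A ⊗_A M = M`. -/
def regularHom (M : AMod m) : GrBimod.tensor (regular (gr m)) M ⟶ M :=
  ofLin (M := GrBimod.tensor (regular (gr m)) M)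
    ((tensorRel (regular (gr m)) M).liftQ (TensorProduct.AlgebraTensorModule.lift
      { toFun := fun a : Zig m => (DistribSMul.toAddMonoidHom M a).toIntLinearMap
        map_add' := fun a b => LinearMap.ext fun x => add_smul (show Zig m from a) (show Zig m from b) x
        map_smul' := fun a b => LinearMap.ext fun x => mul_smul a (show Zig m from b) x }) (by
      rw [tensorRel, Submodule.span_le]
      rintro _ ⟨b, a, x, rfl⟩
      change _ = _
      rw [map_sub, sub_eq_zero]
      exact mul_smul (show Zig m from b) a x)) (by
      rintro n _ ⟨t, ht, rfl⟩
      refine Submodule.span_induction (p := fun t _ => (tensorRel (regular (gr m)) M).liftQ _ _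
        ((tensorRel (regular (gr m)) M).mkQ t) ∈ M.deg n) ?_ (by simp)
        (fun x y _ _ hx hy => by rw [map_add, map_add]; exact add_mem hx hy)
        (fun c x _ hx => by rw [map_zsmul, map_zsmul]; exact Submodule.smul_mem _ _ hx) ht
      rintro _ ⟨k, l, rfl, a, ha, x, hx, rfl⟩
      exact M.smul_mem ha hx)

/-- The unit `1` of the regular bimodule. -/
def regularOne : regular (gr m) := (1 : Zig m)

/-- The isomorphism `A ⊗_A M ≅ M`. -/
def regularIso : tensorFunctor (regular (gr m)) ≅ 𝟭 (AMod m) :=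
  NatIso.ofComponents (fun M =>
    { hom := regularHom M
      inv := ofLin (N := GrBimod.tensor (regular (gr m)) M)
        { toFun := fun x => tens regularOne x
          map_add' := map_add _
          map_smul' := fun a x => (tmul_smul regularOne a x).trans
            (congrArg (fun b => tmul b x) (show (1 : Zig m) * a = a * 1 by rw [one_mul, mul_one])) }
        (fun n x hx => ⟨regularOne ⊗ₜ x, tmul_mem_tensorDeg (zero_add n) one_mem_gr hx, rfl⟩)
      hom_inv_id := tensor_lin_ext fun a x => (tmul_smul regularOne (show Zig m from a) x).trans
            (congrArg (fun b => tmul b x) (one_mul (show Zig m from a)))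
      inv_hom_id := by
        ext x
        exact one_smul (Zig m) x })
    (fun f => tensor_lin_ext fun a x => (map_smul (lin f) (show Zig m from a) x).symm)

/-- The map `P_i ⊗ _iP ⊗ M ⟶ M`. -/
def evalNat (i : Fin (m + 1)) : tensorFunctor (PQ i) ⟶ 𝟭 (AMod m) :=
  tensorNat (β i) ≫ regularIso.hom

lemma evalNat_tens (i : Fin (m + 1)) (M : AMod m) (x : M) :
    lin ((evalNat i).app M) (tens (pq i 1 1) x) = e i • x := by
  change (1 * e i * (e i * 1)) • x = _
  rw [one_mul, mul_one, e_e]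

/-- The map `M ⟶ P_v ⊗ _vP {-1} ⊗ M`, up to sign, where `v = i + 1`. -/
def coevalNat (i : Fin m) : 𝟭 (AMod m) ⟶ tensorFunctor ((PQ i.succ).shift (-1)) :=
  regularIso.inv ≫ tensorNat (γ i).neg

/-- Left multiplication by the idempotent kills the terms of γ(1) whose first factor starts at a
neighbouring vertex. The other two are the loop placed to the right and to the left of the
generator, and only these matter in what follows. -/
lemma e_smul_γElt (i : Fin m) : e i.succ • γElt i =
    MulOpposite.op (loop i) • pq i.succ 1 1 + loop i • pq i.succ 1 1 := by
  rw [smul_γElt, ← mul_assoc, e_d, e_e, e_u_ne (by simp [Fin.ext_iff]), pq_zero_left, op_smul_pq,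
    smul_pq, one_mul, mul_one]
  have h1 : pq i.succ (e i.succ) (d i * u i) = pq i.succ 1 (loop i) :=
    congrArg (fun p => (p ⊗ₜ toQ i.succ (loop i) : P i.succ ⊗[ℤ] Q i.succ))
      (Subtype.ext ((e_e _).trans (one_mul _).symm))
  have h2 : pq i.succ (d i * u i) (e i.succ) = pq i.succ (loop i) 1 :=
    congrArg (fun p => (toP i.succ (loop i) ⊗ₜ p : P i.succ ⊗[ℤ] Q i.succ))
      (Subtype.ext ((e_e _).trans (mul_one _).symm))
  rw [h1, h2]
  split_ifs with h
  · rw [e_d_ne (by simp [Fin.ext_iff]), pq_zero_left, zero_add, zero_add]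
  · rw [zero_add, zero_add]

lemma tmul_eq_neg {M : AMod m} {b b' : B} (a : Zig m)
    (h : b' = -(MulOpposite.op a • b + a • b)) (x : M) :
    (tmul b' x : GrBimod.tensor B M) = -(tens b (a • x) + a • tens b x) := by
  have h : (tmul b' x : GrBimod.tensor B M) =
      -(tmul (MulOpposite.op a • b) x + tmul (a • b) x) := by
    rw [← add_tmul]
    refine eq_neg_of_add_eq_zero_left ?_
    rw [← add_tmul, h, neg_add_cancel]
    exact (congrArg (tensorRel B M).mkQ (TensorProduct.zero_tmul B x)).trans (map_zero _)
  rw [h, ← tmul_smul]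
  rfl

/-- The element `-γ_v(1)`. -/
def coevalElt (i : Fin m) : (PQ i.succ).shift (-1) := (-((1 : Zig m) • γElt i) : PQ i.succ)

lemma e_smul_coevalElt (i : Fin m) : e i.succ • coevalElt i =
    -(MulOpposite.op (loop i) • pqShift i.succ (-1) + loop i • pqShift i.succ (-1)) := by
  change e i.succ • (-((1 : Zig m) • γElt i) : PQ i.succ) =
    -(MulOpposite.op (loop i) • pq i.succ 1 1 + loop i • pq i.succ 1 1)
  rw [one_smul, smul_neg, e_smul_γElt]

lemma lin_coevalNat (i : Fin m) (M : AMod m) (x : M) :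
    lin ((coevalNat i).app M) x = tmul (coevalElt i) x := rfl

lemma e_smul_coevalNat (i : Fin m) (M : AMod m) (x : M) :
    e i.succ • lin ((coevalNat i).app M) x = -(tens (pqShift i.succ (-1)) (loop i • x) +
      loop i • tens (pqShift i.succ (-1)) x) := by
  rw [lin_coevalNat]
  exact tmul_eq_neg (loop i) (e_smul_coevalElt i) x

end AdditiveNaturalMaps

/-! ### Temperley–Lieb relations between the functors. -/

section TemperleyLieb

open GrBimod FinGrMod

variable {m : ℕ} {i j : Fin m} {r r' : ℤ} {B C : GrBimod (gr m)} {g : B} {h : C}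

namespace IsGen

lemma hom_ext₂ {v w : Fin (m + 1)} (hB : IsGen v r B g) (hC : IsGen w r' C h) {M N : AMod m}
    {f f' : GrBimod.tensor B (GrBimod.tensor C M) ⟶ N}
    (H : ∀ (a : Zig m) (x : M), lin f (tens g (a • tens h x)) = lin f' (tens g (a • tens h x))) :
    f = f' :=
  hB.hom_ext fun y => hC.induction (C := fun y => lin f (tens g y) = lin f' (tens g y)) (by simp)
    (fun s t hs ht => by simp only [map_add, hs, ht]) (fun s hs => by simp only [map_neg, hs]) H y

lemma hom_ext₃ {v w : Fin (m + 1)} (hB : IsGen v r B g) (hC : IsGen w r' C h) {M N : AMod m}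
    {f f' : GrBimod.tensor B (GrBimod.tensor C (GrBimod.tensor B M)) ⟶ N}
    (H : ∀ (a a' : Zig m) (x : M), lin f (tens g (a • tens h (a' • tens g x))) =
      lin f' (tens g (a • tens h (a' • tens g x)))) : f = f' :=
  hB.hom_ext₂ hC fun a y => hB.induction
    (C := fun y => lin f (tens g (a • tens h y)) = lin f' (tens g (a • tens h y))) (by simp)
    (fun s t hs ht => by simp only [map_add, smul_add, hs, ht])
    (fun s hs => by simp only [map_neg, smul_neg, hs]) (H a) y

/-- Between two generators only the corner of the middle coefficient matters. Here the ranks of the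
groups (v)A(w) enter. -/
lemma tens_mul_e {v w : Fin (m + 1)} (hB : IsGen v r B g) (hC : IsGen w r' C h) {M : AMod m}
    (a : Zig m) (x : M) :
    (tens g (a • tens h x) : GrBimod.tensor B (GrBimod.tensor C M)) =
      tens g ((e v * a * e w) • tens h x) := by
  rw [hC.mul_e_smul_tens, mul_smul, hB.tens_e_smul]

/-- The coefficient of `e`. -/
abbrev trE (hB : IsGen i.succ r B g) (M : AMod m) : GrBimod.tensor B M →ₗ[ℤ] M :=
  hB.trace (coeffE i) M

/-- The coefficient of the loop. -/
abbrev trX (hB : IsGen i.succ r B g) (M : AMod m) : GrBimod.tensor B M →ₗ[ℤ] M :=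
  hB.trace (coeffX i) M

/-- The coefficient of `e`, as a natural map. -/
abbrev trENat (hB : IsGen i.succ r B g) (F : AMod m ⥤ AMod m) :
    AddNat (F ⋙ tensorFunctor B) F (-r) :=
  hB.traceNat (c := coeffE i) (s := 0) (fun _ _ ha hn => coeffE_eq_zero i ha hn) (by ring) F

/-- The coefficient of the loop, as a natural map. -/
abbrev trXNat (hB : IsGen i.succ r B g) (F : AMod m ⥤ AMod m) :
    AddNat (F ⋙ tensorFunctor B) F (-r - 1) :=
  hB.traceNat (c := coeffX i) (s := 1) (fun _ _ ha hn => coeffX_eq_zero i ha hn) rfl F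

variable (hB : IsGen i.succ r B g) {M : AMod m}

include hB

lemma trE_e_smul (t : GrBimod.tensor B M) : hB.trE M (e i.succ • t) = hB.trE M t :=
  hB.trace_e_smul (fun a => coeffE_e_mul i a) t

lemma trX_e_smul (t : GrBimod.tensor B M) : hB.trX M (e i.succ • t) = hB.trX M t :=
  hB.trace_e_smul (fun a => coeffX_e_mul i a) t

lemma trE_tens (x : M) : hB.trE M (tens g x) = e i.succ • x := by
  rw [trace_tens, coeffE_e, one_smul]

lemma trX_tens (x : M) : hB.trX M (tens g x) = 0 := by
  rw [trace_tens, coeffX_e, zero_smul]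

lemma trE_loop_smul_tens (x : M) : hB.trE M (loop i • tens g x) = 0 := by
  rw [trace_smul_tens, coeffE_mul_e, coeffE_loop, zero_smul]

lemma trX_loop_smul_tens (x : M) : hB.trX M (loop i • tens g x) = e i.succ • x := by
  rw [trace_smul_tens, coeffX_mul_e, coeffX_loop, one_smul]

/-- The decomposition of (i)A(i) along the idempotent and the loop, transported to the tensor
product: the two traces are dual to the two ways of rebuilding an element. -/
lemma loop_smul_tens_trX_add (y : GrBimod.tensor B M) :
    loop i • tens g (hB.trX M y) + tens g (hB.trE M y) = e i.succ • y := by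
  refine hB.induction (C := fun y => loop i • tens g (hB.trX M y) + tens g (hB.trE M y) =
    e i.succ • y) (by simp) (fun s t hs ht => ?_) (fun s hs => ?_) (fun a x => ?_) y
  · rw [smul_add, ← hs, ← ht]
    simp only [map_add, smul_add]
    abel
  · rw [smul_neg, ← hs]
    simp only [map_neg, smul_neg]
    abel
  · rw [trace_smul_tens, trace_smul_tens, coeffE_mul_e, coeffX_mul_e, map_zsmul, map_zsmul,
      hB.tens_e_smul, smul_smul, ← hB.mul_e_smul_tens (e i.succ * a), e_mul_mul_e_self, add_smul,
      add_comm, smul_comm (loop i)]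
    simp only [smul_assoc]
    rw [hB.e_smul_tens]

end IsGen

lemma IsGen.liftNat_tens {v : Fin (m + 1)} (hB : IsGen v r B g) {F G : AMod m ⥤ AMod m}
    (φ : AddNat F G r) (M : AMod m) (x : F.obj M) :
    lin ((hB.liftNat φ).app M) (tens g x) = e v • φ.app M (e v • x) :=
  hB.lift_tens (φ.app M) (fun _ _ hx => φ.app_mem M hx) x

/-- The components of a natural transformation `C ⊗ - ⟶ 𝟭`. -/
def counit (c : tensorFunctor C ⟶ 𝟭 (AMod m)) (M : AMod m) : GrBimod.tensor C M ⟶ M := c.app M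

/-- The components of a natural transformation `𝟭 ⟶ C ⊗ -`. -/
def unit (c : 𝟭 (AMod m) ⟶ tensorFunctor C) (M : AMod m) : M ⟶ GrBimod.tensor C M := c.app M

section Comultiplication

variable {v : Fin (m + 1)} (hB : IsGen v r B g) (hC : IsGen v 0 C h)

/-- The comultiplication `x ↦ (i) ⊗ (i) ⊗ x`. -/
def dup : tensorFunctor B ⟶ tensorFunctor B ⋙ tensorFunctor C :=
  hB.liftNat (F := 𝟭 _) ((hB.tensNat (𝟭 _)).comp (hC.tensNat (tensorFunctor B)) (add_zero r))

/-- The components of `dup`. -/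
def dupHom (M : AMod m) : GrBimod.tensor B M ⟶ GrBimod.tensor C (GrBimod.tensor B M) :=
  (dup hB hC).app M

lemma dupHom_tens (M : AMod m) (x : M) :
    lin (dupHom hB hC M) (tens g x) = tens h (tens g x) := by
  refine (hB.liftNat_tens (F := 𝟭 _) ((hB.tensNat (𝟭 _)).comp (hC.tensNat (tensorFunctor B))
    (add_zero r)) M x).trans ?_
  change e v • tens h (tens g (e v • x)) = _
  rw [hC.e_smul_tens, hB.tens_e_smul]

/-- The comultiplication `x ↦ (i) ⊗ (i) ⊗ x`, in the other order. -/
def dup' : tensorFunctor B ⟶ tensorFunctor C ⋙ tensorFunctor B :=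
  hB.liftNat (F := 𝟭 _) ((hC.tensNat (𝟭 _)).comp (hB.tensNat (tensorFunctor C)) (zero_add r))

/-- The components of `dup'`. -/
def dupHom' (M : AMod m) : GrBimod.tensor B M ⟶ GrBimod.tensor B (GrBimod.tensor C M) :=
  (dup' hB hC).app M

lemma dupHom'_tens (M : AMod m) (x : M) :
    lin (dupHom' hB hC M) (tens g x) = tens g (tens h x) := by
  refine (hB.liftNat_tens (F := 𝟭 _) ((hC.tensNat (𝟭 _)).comp (hB.tensNat (tensorFunctor C))
    (zero_add r)) M x).trans ?_
  change e v • tens g (tens h (e v • x)) = _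
  rw [hB.e_smul_tens, hC.tens_e_smul]

variable {b : tensorFunctor C ⟶ 𝟭 (AMod m)}
    (hb : ∀ (M : AMod m) (x : M), lin (counit b M) (tens h x) = e v • x)

include hb

/-- The counit law: evaluating the outer copy undoes the duplication, as the generator is fixed by
its idempotent. -/
lemma dup_eval (M : AMod m) :
    (dup hB hC).app M ≫ b.app ((tensorFunctor B).obj M) = 𝟙 _ := hB.hom_ext fun x => by
  change lin (counit b (GrBimod.tensor B M)) (lin (dupHom hB hC M) (tens g x)) = tens g x
  rw [dupHom_tens, hb, hB.e_smul_tens]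

lemma dup'_eval (M : AMod m) :
    (dup' hB hC).app M ≫ (tensorFunctor B).map (b.app M) = 𝟙 _ := hB.hom_ext fun x => by
  change lin (tensorMap (Hom.id B) (counit b M)) (lin (dupHom' hB hC M) (tens g x)) = tens g x
  rw [dupHom'_tens]
  change tens g (lin (counit b M) (tens h x)) = _
  rw [hb, hB.tens_e_smul]

lemma dup_map_eval (M : AMod m) :
    (dup hC hC).app M ≫ (tensorFunctor C).map (b.app M) = 𝟙 _ := hC.hom_ext fun x => by
  change lin (tensorMap (Hom.id C) (counit b M)) (lin (dupHom hC hC M) (tens h x)) = tens h x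
  rw [dupHom_tens]
  change tens h (lin (counit b M) (tens h x)) = _
  rw [hb, hC.tens_e_smul]

end Comultiplication

section Braid

variable {v w : Fin (m + 1)} {p q : Zig m} {s t : ℤ}

/-- Elements `p`, `q` spanning `(v)A(w)` and `(w)A(v)`. -/
structure IsPathPair (v w : Fin (m + 1)) (p q : Zig m) (s t : ℤ) : Prop where
  mem_left : p ∈ gr m s
  mem_right : q ∈ gr m t
  add_eq : s + t = 1
  mul_e : p * e w = p
  exists_left : ∀ a : Zig m, ∃ n : ℤ, e v * a * e w = n • p
  exists_right : ∀ a : Zig m, ∃ n : ℤ, e w * a * e v = n • q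

variable (hB : IsGen i.succ 0 B g) (hC : IsGen j.succ 0 C h)
  (hpq : IsPathPair i.succ j.succ p q s t)

/-- The map `y ↦ g ⊗ p (h ⊗ q (g ⊗ T y))`. -/
def jNat : AddNat (tensorFunctor B) ((tensorFunctor B ⋙ tensorFunctor C) ⋙ tensorFunctor B) 0 :=
  (((((hB.trXNat (𝟭 _)).comp (hB.tensNat (𝟭 _)) rfl).comp
    (AddNat.smul (tensorFunctor B) hpq.mem_right) rfl).comp
    (hC.tensNat (tensorFunctor B)) rfl).comp
    (AddNat.smul (tensorFunctor B ⋙ tensorFunctor C) hpq.mem_left) rfl).comp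
    -- The total degree is zero: the loop coefficient lowers the degree by one, and `p`, `q`
    -- together raise it by one.
    (hB.tensNat (tensorFunctor B ⋙ tensorFunctor C)) (by have := hpq.add_eq; omega)

/-- The components of the natural transformation induced by `jNat`. -/
def jHom (M : AMod m) : GrBimod.tensor B (GrBimod.tensor B M) ⟶
    GrBimod.tensor B (GrBimod.tensor C (GrBimod.tensor B M)) :=
  (hB.liftNat (jNat hB hC hpq)).app M

lemma jHom_tens (M : AMod m) (y : GrBimod.tensor B M) : lin (jHom hB hC hpq M) (tens g y) =
    tens g (p • tens h (q • tens g (hB.trX M y))) := by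
  refine (hB.liftNat_tens (jNat hB hC hpq) M y).trans ?_
  change e i.succ • tens g (p • tens h (q • tens g (hB.trX M (e i.succ • y)))) = _
  rw [hB.trX_e_smul, hB.e_smul_tens]

/-- The map `y ↦ g ⊗ T y`. -/
def kNat : AddNat (tensorFunctor B) (tensorFunctor B) 0 :=
  (hB.trENat (𝟭 _)).comp (hB.tensNat (𝟭 _)) (by norm_num)

/-- The components of the natural transformation induced by `kNat`. -/
def kHom (M : AMod m) : GrBimod.tensor B (GrBimod.tensor B M) ⟶ GrBimod.tensor B M :=
  (hB.liftNat (kNat hB)).app M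

lemma kHom_tens (M : AMod m) (y : GrBimod.tensor B M) :
    lin (kHom hB M) (tens g y) = tens g (hB.trE M y) := by
  refine (hB.liftNat_tens (kNat hB) M y).trans ?_
  change e i.succ • tens g (hB.trE M (e i.succ • y)) = _
  rw [hB.e_smul_tens, hB.trE_e_smul]

include hB hC hpq

/-- In B ⊗ B ⊗ M the middle coefficient lies in (i)A(i), which is free on the idempotent and the
loop. The idempotent part is the image of the comultiplication. The loop part is the image of B ⊗ C
⊗ B ⊗ M, whose middle coefficients are multiples of `p` and `q`, because the counit of `C`
multiplies them to `p * q`. -/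
lemma splits_braid (hl : p * q = loop i) {c : tensorFunctor C ⟶ 𝟭 (AMod m)}
    (hc : ∀ (M : AMod m) (x : M), lin (counit c M) (tens h x) = e j.succ • x) :
    Splits (F := (tensorFunctor B ⋙ tensorFunctor C) ⋙ tensorFunctor B)
      (G := tensorFunctor B ⋙ tensorFunctor B)
      (Functor.whiskerRight (Functor.whiskerLeft (tensorFunctor B) c) (tensorFunctor B))
      (dup hB hB) := by
  -- Every generator of the triple product is an integer multiple of the one with coefficients `p`
  -- and `q`, and the same integer multiplies the loop in its image.
  have key : ∀ (M : AMod m) (a a' : Zig m) (x : M), ∃ n : ℤ,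
      (tens g (a • tens h (a' • tens g x)) : GrBimod.tensor B (GrBimod.tensor C
        (GrBimod.tensor B M))) = n • tens g (p • tens h (q • tens g x)) ∧
      (tens g (lin (counit c (GrBimod.tensor B M)) (a • tens h (a' • tens g x))) :
        GrBimod.tensor B (GrBimod.tensor B M)) = n • tens g (loop i • tens g x) := by
    intro M a a' x
    obtain ⟨n, hn⟩ := hpq.exists_left a
    obtain ⟨n', hn'⟩ := hpq.exists_right a'
    refine ⟨n * n', ?_, ?_⟩
    · rw [hB.tens_mul_e hC, hn, smul_assoc, map_zsmul, hC.tens_mul_e hB, hn', smul_assoc,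
        map_zsmul, smul_comm p, map_zsmul, smul_smul]
    · rw [map_smul, hc, smul_smul, smul_smul, hB.tens_mul_e hB]
      have : e i.succ * (a * e j.succ * a') * e i.succ = (n * n') • loop i := by
        rw [← hl, ← smul_mul_smul_comm, ← hn, ← hn']
        simp only [mul_assoc]
        rw [← mul_assoc (e j.succ) (e j.succ), e_e]
      rw [this, smul_assoc, map_zsmul]
  -- The retractions read off the coefficient of the loop and that of the idempotent.
  refine ⟨hB.liftNat (jNat hB hC hpq), hB.liftNat (kNat hB), ?_, ?_, ?_, ?_⟩
  · refine NatTrans.ext (funext fun M => hB.hom_ext₃ hC fun a a' x => ?_)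
    obtain ⟨n, -, hn⟩ := key M a a' x
    change lin (kHom hB M) (tens g (lin (counit c (GrBimod.tensor B M))
      (a • tens h (a' • tens g x)))) = 0
    rw [hn, map_zsmul, kHom_tens, hB.trE_loop_smul_tens, map_zero, smul_zero]
  · refine NatTrans.ext (funext fun M => hB.hom_ext fun x => ?_)
    change lin (kHom hB M) (lin (dupHom hB hB M) (tens g x)) = tens g x
    rw [dupHom_tens, kHom_tens, hB.trE_tens, hB.tens_e_smul]
  · refine NatTrans.ext (funext fun M => hB.hom_ext fun (y : GrBimod.tensor B M) => ?_)
    change lin (tensorMap (Hom.id B) (counit c (GrBimod.tensor B M)))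
      (lin (jHom hB hC hpq M) (tens g y)) + lin (dupHom hB hB M) (lin (kHom hB M) (tens g y)) =
        tens g y
    rw [kHom_tens, dupHom_tens, jHom_tens]
    change tens g (lin (counit c (GrBimod.tensor B M)) (p • tens h (q • tens g (hB.trX M y)))) +
      _ = _
    rw [map_smul, hc, smul_smul, smul_smul, hpq.mul_e, hl, ← map_add,
      hB.loop_smul_tens_trX_add, hB.tens_e_smul]
  · refine NatTrans.ext (funext fun M => hB.hom_ext₃ hC fun a a' x => ?_)
    obtain ⟨n, hn, hn'⟩ := key M a a' x
    change lin (jHom hB hC hpq M) (tens g (lin (counit c (GrBimod.tensor B M))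
      (a • tens h (a' • tens g x)))) = tens g (a • tens h (a' • tens g x))
    rw [hn, hn', map_zsmul, jHom_tens, hB.trX_loop_smul_tens, hB.tens_e_smul]

end Braid

section Inverse

variable (hB : IsGen i.succ 0 B g) (hC : IsGen i.succ (-1) C h)

/-- The map `y ↦ -(g ⊗ T y)`. -/
def rhoNat : AddNat (tensorFunctor C) (tensorFunctor B) 0 :=
  ((hC.trXNat (𝟭 _)).comp (hB.tensNat (𝟭 _)) (by norm_num)).neg

/-- The components of the natural transformation induced by `rhoNat`. -/
def rhoHom (M : AMod m) : GrBimod.tensor B (GrBimod.tensor C M) ⟶ GrBimod.tensor B M :=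
  (hB.liftNat (rhoNat hB hC)).app M

lemma rhoHom_tens (M : AMod m) (y : GrBimod.tensor C M) :
    lin (rhoHom hB hC M) (tens g y) = -tens g (hC.trX M y) := by
  refine (hB.liftNat_tens (rhoNat hB hC) M y).trans ?_
  change e i.succ • -tens g (hC.trX M (e i.succ • y)) = _
  rw [smul_neg, hB.e_smul_tens, hC.trX_e_smul]

/-- The map `y ↦ h ⊗ T y - h ⊗ loop (T' y)`. -/
def piNat : AddNat (tensorFunctor C) (tensorFunctor C) 0 :=
  ((hC.trENat (𝟭 _)).comp (hC.tensNat (𝟭 _)) (by norm_num)).sub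
    (((hC.trXNat (𝟭 _)).comp (AddNat.smul (𝟭 _) (loop_mem i)) rfl).comp (hC.tensNat (𝟭 _))
      (by norm_num))

/-- The components of the natural transformation induced by `piNat`. -/
def piHom (M : AMod m) : GrBimod.tensor B (GrBimod.tensor C M) ⟶ GrBimod.tensor C M :=
  (hB.liftNat (piNat hC)).app M

lemma piHom_tens (M : AMod m) (y : GrBimod.tensor C M) :
    lin (piHom hB hC M) (tens g y) = tens h (hC.trE M y) - tens h (loop i • hC.trX M y) := by
  refine (hB.liftNat_tens (piNat hC) M y).trans ?_
  change e i.succ • (tens h (hC.trE M (e i.succ • y)) -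
    tens h (loop i • hC.trX M (e i.succ • y))) = _
  rw [smul_sub, hC.e_smul_tens, hC.e_smul_tens, hC.trX_e_smul, hC.trE_e_smul]

/-- The map `y ↦ -(g ⊗ T y)`, of degree `-1`. -/
def rhoNat' : AddNat (tensorFunctor B) (tensorFunctor B) (-1) :=
  ((hB.trXNat (𝟭 _)).comp (hB.tensNat (𝟭 _)) (by norm_num)).neg

/-- The components of the natural transformation induced by `rhoNat'`. -/
def rhoHom' (M : AMod m) : GrBimod.tensor C (GrBimod.tensor B M) ⟶ GrBimod.tensor B M :=
  (hC.liftNat (rhoNat' hB)).app M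

lemma rhoHom'_tens (M : AMod m) (y : GrBimod.tensor B M) :
    lin (rhoHom' hB hC M) (tens h y) = -tens g (hB.trX M y) := by
  refine (hC.liftNat_tens (rhoNat' hB) M y).trans ?_
  change e i.succ • -tens g (hB.trX M (e i.succ • y)) = _
  rw [smul_neg, hB.e_smul_tens, hB.trX_e_smul]

/-- The map `y ↦ h ⊗ T y - loop (h ⊗ T' y)`. -/
def piNat' : AddNat (tensorFunctor B) (tensorFunctor C) (-1) :=
  ((hB.trENat (𝟭 _)).comp (hC.tensNat (𝟭 _)) (by norm_num)).sub
    (((hB.trXNat (𝟭 _)).comp (hC.tensNat (𝟭 _)) rfl).comp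
      (AddNat.smul (tensorFunctor C) (loop_mem i)) (by norm_num))

/-- The components of the natural transformation induced by `piNat'`. -/
def piHom' (M : AMod m) : GrBimod.tensor C (GrBimod.tensor B M) ⟶ GrBimod.tensor C M :=
  (hC.liftNat (piNat' hB hC)).app M

lemma piHom'_tens (M : AMod m) (y : GrBimod.tensor B M) :
    lin (piHom' hB hC M) (tens h y) = tens h (hB.trE M y) - loop i • tens h (hB.trX M y) := by
  refine (hC.liftNat_tens (piNat' hB hC) M y).trans ?_
  change e i.succ • (tens h (hB.trE M (e i.succ • y)) -
    loop i • tens h (hB.trX M (e i.succ • y))) = _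
  rw [smul_sub, hC.e_smul_tens, hB.trX_e_smul, hB.trE_e_smul, smul_smul, e_loop]

variable {c : 𝟭 (AMod m) ⟶ tensorFunctor C}
  (hc : ∀ (M : AMod m) (x : M), e i.succ • lin (unit c M) x =
    -(tens h (loop i • x) + loop i • tens h x))

include hB hC hc

/-- With middle coefficient split into idempotent and loop, the image of `c` sends g ⊗ x to -(g ⊗ h
⊗ loop x) - (g ⊗ loop h ⊗ x), and the comultiplication sends h ⊗ x to g ⊗ h ⊗ x. This is a
triangular matrix with entries ±1 on the diagonal, and the retractions are the rows of its inverse.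
-/
lemma splits_whiskerRight : Splits (G := tensorFunctor C ⋙ tensorFunctor B)
    (Functor.whiskerRight c (tensorFunctor B)) (dup hC hB) := by
  refine ⟨hB.liftNat (rhoNat hB hC), hB.liftNat (piNat hC), ?_, ?_, ?_, ?_⟩
  · refine NatTrans.ext (funext fun M => hB.hom_ext fun (x : M) => ?_)
    change lin (piHom hB hC M) (tens g (lin (unit c M) x)) = 0
    rw [piHom_tens, ← hC.trE_e_smul, ← hC.trX_e_smul, hc]
    simp only [map_neg, map_add, hC.trE_tens, hC.trX_tens, hC.trE_loop_smul_tens,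
      hC.trX_loop_smul_tens, smul_neg, smul_smul, loop_e, e_loop, add_zero, zero_add]
    exact sub_self _
  · refine NatTrans.ext (funext fun M => hC.hom_ext fun (x : M) => ?_)
    change lin (piHom hB hC M) (lin (dupHom hC hB M) (tens h x)) = tens h x
    rw [dupHom_tens, piHom_tens, hC.trE_tens, hC.trX_tens, hC.tens_e_smul, smul_zero, map_zero,
      sub_zero]
  · refine NatTrans.ext (funext fun M => hB.hom_ext fun (y : GrBimod.tensor C M) => ?_)
    change lin (tensorMap (Hom.id B) (unit c M)) (lin (rhoHom hB hC M) (tens g y)) +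
      lin (dupHom hC hB M) (lin (piHom hB hC M) (tens g y)) = tens g y
    rw [rhoHom_tens, piHom_tens, map_neg, map_sub, dupHom_tens, dupHom_tens]
    change -tens g (lin (unit c M) (hC.trX M y)) + _ = _
    rw [← hB.tens_e_smul (lin (unit c M) _), hc, ← hB.tens_e_smul y, ← hC.loop_smul_tens_trX_add]
    simp only [map_add, map_neg]
    abel
  · refine NatTrans.ext (funext fun M => hB.hom_ext fun (x : M) => ?_)
    change lin (rhoHom hB hC M) (tens g (lin (unit c M) x)) = tens g x
    rw [rhoHom_tens, ← hC.trX_e_smul, hc, map_neg, map_add, hC.trX_tens, hC.trX_loop_smul_tens,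
      zero_add, map_neg, neg_neg, hB.tens_e_smul]

/-- The same triangular matrix with the two factors in the other order; the off-diagonal loop now
acts on the outside instead of on M. -/
lemma splits_whiskerLeft : Splits (G := tensorFunctor B ⋙ tensorFunctor C)
    (Functor.whiskerLeft (tensorFunctor B) c) (dup' hC hB) := by
  -- The idempotent needed in `hc` is already contained in the generator `g`, and the unit is
  -- A-linear.
  have hc' : ∀ (M : AMod m) (x : M), lin (unit c (GrBimod.tensor B M)) (tens g x) =
      -(tens h (loop i • tens g x) + loop i • tens h (tens g x)) := fun M x => by
    rw [← hc, ← map_smul, hB.e_smul_tens]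
  refine ⟨hC.liftNat (rhoNat' hB), hC.liftNat (piNat' hB hC), ?_, ?_, ?_, ?_⟩
  · refine NatTrans.ext (funext fun M => hB.hom_ext fun (x : M) => ?_)
    change lin (piHom' hB hC M) (lin (unit c (GrBimod.tensor B M)) (tens g x)) = 0
    rw [hc', map_neg, map_add, map_smul (lin _), piHom'_tens, piHom'_tens, hB.trE_tens, hB.trX_tens,
      hB.trE_loop_smul_tens, hB.trX_loop_smul_tens, hC.tens_e_smul, map_zero, smul_zero, zero_sub, sub_zero,
      neg_add_cancel, neg_zero]
  · refine NatTrans.ext (funext fun M => hC.hom_ext fun (x : M) => ?_)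
    change lin (piHom' hB hC M) (lin (dupHom' hC hB M) (tens h x)) = tens h x
    rw [dupHom'_tens, piHom'_tens, hB.trE_tens, hB.trX_tens, hC.tens_e_smul, map_zero, smul_zero,
      sub_zero]
  · refine NatTrans.ext (funext fun M => hC.hom_ext fun (y : GrBimod.tensor B M) => ?_)
    change lin (unit c (GrBimod.tensor B M)) (lin (rhoHom' hB hC M) (tens h y)) +
      lin (dupHom' hC hB M) (lin (piHom' hB hC M) (tens h y)) = tens h y
    rw [rhoHom'_tens, piHom'_tens, map_neg, map_sub, map_smul (lin _), dupHom'_tens, dupHom'_tens, hc',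
      ← hC.tens_e_smul y, ← hB.loop_smul_tens_trX_add]
    simp only [map_add]
    abel
  · refine NatTrans.ext (funext fun M => hB.hom_ext fun (x : M) => ?_)
    change lin (rhoHom' hB hC M) (lin (unit c (GrBimod.tensor B M)) (tens g x)) = tens g x
    rw [hc', map_neg, map_add, map_smul (lin _), rhoHom'_tens, rhoHom'_tens, hB.trX_tens,
      hB.trX_loop_smul_tens, map_zero, neg_zero, smul_zero, add_zero, neg_neg, hB.tens_e_smul]

end Inverse

section Concrete

/-- The functor with index `i` sits at the vertex `i.succ`. Hence for `j = i + 1` it is the arrows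
with index `j`, not `i`, that join the two vertices. -/
lemma isPathPair {i j : Fin m} (hij : j.val = i.val + 1) :
    IsPathPair i.succ j.succ (u j) (d j) 0 1 where
  mem_left := gen_mem (.up j)
  mem_right := gen_mem (.dn j)
  add_eq := zero_add 1
  mul_e := u_e j
  exists_left a := by
    rw [show i.succ = j.castSucc from Fin.ext hij.symm]
    exact e_mul_mul_e_up j a
  exists_right a := by
    rw [show i.succ = j.castSucc from Fin.ext hij.symm]
    exact e_mul_mul_e_down j a

lemma isPathPair' {i j : Fin m} (hij : j.val = i.val + 1) :
    IsPathPair j.succ i.succ (d j) (u j) 1 0 where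
  mem_left := gen_mem (.dn j)
  mem_right := gen_mem (.up j)
  add_eq := add_zero 1
  mul_e := by
    rw [show i.succ = j.castSucc from Fin.ext hij.symm]
    exact d_e j
  exists_left a := by
    rw [show i.succ = j.castSucc from Fin.ext hij.symm]
    exact e_mul_mul_e_down j a
  exists_right a := by
    rw [show i.succ = j.castSucc from Fin.ext hij.symm]
    exact e_mul_mul_e_up j a

/-- The middle coefficient lies in a corner (v)A(w) between distant vertices, which is zero. -/
lemma isZero_tensor_tensor {i j : Fin m} (h : i.val + 1 < j.val ∨ j.val + 1 < i.val) (M : AMod m) :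
    IsZero ((tensorFunctor (PQ i.succ)).obj ((tensorFunctor (PQ j.succ)).obj M)) := by
  rw [IsZero.iff_id_eq_zero]
  refine (isGen_PQ i.succ).hom_ext₂ (isGen_PQ j.succ) fun a x => ?_
  rw [(isGen_PQ i.succ).tens_mul_e (isGen_PQ j.succ),
    e_mul_mul_e_far (by simpa only [Fin.val_succ, add_lt_add_iff_right] using h), zero_smul,
    map_zero, map_zero, map_zero]

instance (v : Fin (m + 1)) : (tensorFunctor (PQ v)).PreservesProjectiveObjects :=
  ⟨fun {X} _ => projective_tensor (PQ v) (PQ_hasDualBasis v) X⟩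

instance (v : Fin (m + 1)) (r : ℤ) :
    (tensorFunctor ((PQ v).shift r)).PreservesProjectiveObjects :=
  ⟨fun {X} _ => projective_tensor ((PQ v).shift r)
    (shift_hasDualBasis (B := PQ v) r (PQ_hasDualBasis v)) X⟩

lemma counit_evalNat_tens (v : Fin (m + 1)) (M : AMod m) (x : M) :
    lin (counit (evalNat v) M) (tens (pq v 1 1) x) = e v • x := evalNat_tens v M x

lemma e_smul_unit_coevalNat (i : Fin m) (M : AMod m) (x : M) :
    e i.succ • lin (unit (coevalNat i) M) x = -(tens (pqShift i.succ (-1)) (loop i • x) +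
      loop i • tens (pqShift i.succ (-1)) x) := e_smul_coevalNat i M x

end Concrete

end TemperleyLieb

/-! ### Comparison with the functors R and R'. -/

section Comparison

open GrBimod FinGrMod

universe v₁ u₁

variable {𝓐 : Type u₁} [Category.{v₁} 𝓐] [Preadditive 𝓐] [HasBinaryBiproducts 𝓐] [HasZeroObject 𝓐]

section

variable {F G : 𝓐 ⥤ 𝓐} [F.Additive] [G.Additive] (τ : F ⟶ G)

/-- Replaces the tensor product with the regular bimodule by the identity functor, so that the
formal results for cones of maps to the identity apply. -/
lemma nonempty_coneEndofunctor_iso_to [F.PreservesProjectiveObjects] (θ : G ≅ 𝟭 𝓐)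
    (hF : ∀ X, Projective X → Projective (F.obj X)) (hG : ∀ X, Projective X → Projective (G.obj X)) :
    Nonempty (coneEndofunctor τ hF hG ≅ induced (chCone (mapNatTo (τ ≫ θ.hom)))) := by
  let _ : Descends (coneFunctor τ) :=
    ⟨coneFunctor_homotopy τ, coneFunctor_isBoundedProjective τ hF hG⟩
  refine ⟨inducedIso (Φ := coneFunctor τ) (chConeMap (mapNat τ) (mapNatTo (τ ≫ θ.hom)) (𝟙 _)
    (mapNatTo θ.hom) fun K => ?_) fun K => isHEquiv_chConeMap _ _ _ _ _ K ?_ ?_⟩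
  · refine Eq.trans ?_ (Category.id_comp _).symm
    ext n
    rfl
  · exact isHEquiv_of_isIso (𝟙 _)
  · exact @isHEquiv_of_isIso _ _ _ _ _ _ ((NatIso.mapHomologicalComplex θ (ComplexShape.up ℤ)).app K).isIso_hom

lemma nonempty_shiftedConeEndofunctor_iso_from [G.PreservesProjectiveObjects] (θ : F ≅ 𝟭 𝓐)
    (hF : ∀ X, Projective X → Projective (F.obj X)) (hG : ∀ X, Projective X → Projective (G.obj X)) :
    Nonempty (shiftedConeEndofunctor τ hF hG ≅ induced (chCone (mapNatFrom (θ.inv ≫ τ))) ⋙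
      induced (CategoryTheory.shiftFunctor (CochainComplex 𝓐 ℤ) (-1 : ℤ))) := by
  let _ : Descends (coneFunctor τ) :=
    ⟨coneFunctor_homotopy τ, coneFunctor_isBoundedProjective τ hF hG⟩
  have e : induced (coneFunctor τ) ≅ induced (chCone (mapNatFrom (θ.inv ≫ τ))) := by
    refine inducedIso (Φ := coneFunctor τ) (chConeMap (mapNat τ) (mapNatFrom (θ.inv ≫ τ))
      (mapNatTo θ.hom) (𝟙 _) fun K => ?_) fun K => isHEquiv_chConeMap _ _ _ _ _ K ?_ ?_
    · refine (Category.comp_id _).trans ?_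
      ext n
      change τ.app (K.X n) = θ.hom.app (K.X n) ≫ θ.inv.app (K.X n) ≫ τ.app (K.X n)
      rw [Iso.hom_inv_id_app_assoc]
    · exact @isHEquiv_of_isIso _ _ _ _ _ _ ((NatIso.mapHomologicalComplex θ (ComplexShape.up ℤ)).app K).isIso_hom
    · exact isHEquiv_of_isIso (𝟙 _)
  exact ⟨(inducedComp (coneFunctor τ) _).symm ≪≫ Functor.isoWhiskerRight e _⟩

end

variable {m : ℕ}

/-- The functor on complexes underlying `R i`. -/
abbrev chR (i : Fin m) : CochainComplex (AMod m) ℤ ⥤ CochainComplex (AMod m) ℤ :=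
  chCone (mapNatTo (evalNat i.succ))

/-- The functor on complexes underlying `R' i`, up to a shift. -/
abbrev chR' (i : Fin m) : CochainComplex (AMod m) ℤ ⥤ CochainComplex (AMod m) ℤ :=
  chCone (mapNatFrom (coevalNat i))

lemma nonempty_R_iso (i : Fin m) : Nonempty (R i ≅ induced (chR i)) :=
  nonempty_coneEndofunctor_iso_to (tensorNat (β i.succ)) regularIso _ _

lemma nonempty_R'_iso (i : Fin m) : Nonempty (R' i ≅ induced (chR' i) ⋙
    induced (CategoryTheory.shiftFunctor (CochainComplex (AMod m) ℤ) (-1 : ℤ))) :=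
  nonempty_shiftedConeEndofunctor_iso_from (tensorNat (γ i).neg) regularIso _ _

lemma nonempty_chR_braid {i j : Fin m} (h : j.val = i.val + 1) :
    Nonempty (induced (chR i ⋙ chR j ⋙ chR i) ≅ induced (chR j ⋙ chR i ⋙ chR j)) :=
  nonempty_induced_braid _ _
    (dup_eval (isGen_PQ i.succ) (isGen_PQ i.succ) (counit_evalNat_tens i.succ))
    (dup_map_eval (isGen_PQ i.succ) (counit_evalNat_tens i.succ))
    -- The loop at `i.succ` factors through `j.succ` by the defining relation of A_m; the loop at
    -- `j.succ` factors through `i.succ` by its definition.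
    (splits_braid (isGen_PQ i.succ) (isGen_PQ j.succ) (isPathPair h) (loop_eq h)
      (counit_evalNat_tens j.succ))
    (dup_eval (isGen_PQ j.succ) (isGen_PQ j.succ) (counit_evalNat_tens j.succ))
    (dup_map_eval (isGen_PQ j.succ) (counit_evalNat_tens j.succ))
    (splits_braid (isGen_PQ j.succ) (isGen_PQ i.succ) (isPathPair' h) rfl
      (counit_evalNat_tens i.succ))

lemma nonempty_chR_comm {i j : Fin m} (h : i.val + 1 < j.val ∨ j.val + 1 < i.val) :
    Nonempty (induced (chR j ⋙ chR i) ≅ induced (chR i ⋙ chR j)) :=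
  nonempty_induced_comm _ _ (isZero_tensor_tensor h) (isZero_tensor_tensor h.symm)

lemma nonempty_shift_iso_chR'_chR (i : Fin m) :
    Nonempty (induced (CategoryTheory.shiftFunctor (CochainComplex (AMod m) ℤ) (1 : ℤ)) ≅
      induced (chR' i ⋙ chR i)) :=
  nonempty_shift_iso_induced_comp _ _ _
    (dup_eval (isGen_shift i.succ (-1)) (isGen_PQ i.succ) (counit_evalNat_tens i.succ))
    (splits_whiskerRight (isGen_PQ i.succ) (isGen_shift i.succ (-1)) (e_smul_unit_coevalNat i))

lemma nonempty_shift_iso_chR_chR' (i : Fin m) :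
    Nonempty (induced (CategoryTheory.shiftFunctor (CochainComplex (AMod m) ℤ) (1 : ℤ)) ≅
      induced (chR i ⋙ chR' i)) :=
  nonempty_shift_iso_induced_comp' _ _ _
    (dup'_eval (isGen_shift i.succ (-1)) (isGen_PQ i.succ) (counit_evalNat_tens i.succ))
    (splits_whiskerLeft (isGen_PQ i.succ) (isGen_shift i.succ (-1)) (e_smul_unit_coevalNat i))

end Comparison

/-! ### The monoid of isomorphism classes of endofunctors. -/

section IsomorphismClasses

universe v u

/-- Isomorphism classes of endofunctors. -/
def EndoClass (𝓠 : Type u) [Category.{v} 𝓠] : Type max u v := Quotient (isIsomorphicSetoid (𝓠 ⥤ 𝓠))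

variable {𝓠 : Type u} [Category.{v} 𝓠]

namespace EndoClass

/-- The isomorphism class of a functor. -/
def mk (F : 𝓠 ⥤ 𝓠) : EndoClass 𝓠 := Quotient.mk (isIsomorphicSetoid (𝓠 ⥤ 𝓠)) F

lemma mk_eq_mk {F G : 𝓠 ⥤ 𝓠} : mk F = mk G ↔ Nonempty (F ≅ G) :=
  ⟨fun h => Quotient.exact h, fun h => Quotient.sound h⟩

/-- A representative. -/
def out (x : EndoClass 𝓠) : 𝓠 ⥤ 𝓠 := Quotient.out x

lemma mk_out (x : EndoClass 𝓠) : mk x.out = x := Quotient.out_eq x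

instance : Monoid (EndoClass 𝓠) where
  mul := Quotient.map₂ (fun F G => G ⋙ F)
    (fun _ _ ⟨e⟩ _ _ ⟨e'⟩ => ⟨Functor.isoWhiskerRight e' _ ≪≫ Functor.isoWhiskerLeft _ e⟩)
  one := mk (𝟭 𝓠)
  mul_assoc := by
    rintro ⟨F⟩ ⟨G⟩ ⟨H⟩
    rfl
  one_mul := by
    rintro ⟨F⟩
    rfl
  mul_one := by
    rintro ⟨F⟩
    rfl

lemma mk_comp (F G : 𝓠 ⥤ 𝓠) : mk (F ⋙ G) = mk G * mk F := rfl

lemma mk_id : mk (𝟭 𝓠) = 1 := rfl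

end EndoClass

open Classical in
/-- Representatives of the classes in the image of a homomorphism, the unit being represented by
the identity functor. -/
def homFunctor {G : Type*} [Group G] (f : G →* (EndoClass 𝓠)ˣ) (g : G) : 𝓠 ⥤ 𝓠 :=
  if g = 1 then 𝟭 𝓠 else (f g : EndoClass 𝓠).out

lemma mk_homFunctor {G : Type*} [Group G] (f : G →* (EndoClass 𝓠)ˣ) (g : G) :
    EndoClass.mk (homFunctor f g) = f g := by
  unfold homFunctor
  split_ifs with h
  · rw [h, map_one, Units.val_one, EndoClass.mk_id]
  · exact EndoClass.mk_out _

/-- A homomorphism to the units of the monoid of isomorphism classes of endofunctors gives a weak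
action. -/
def weakActionOfHom {G : Type*} [Group G] (f : G →* (EndoClass 𝓠)ˣ) : WeakAction G 𝓠 where
  functor := homFunctor f
  functor_one := if_pos rfl
  functor_mul g h := by
    rw [← EndoClass.mk_eq_mk, EndoClass.mk_comp, mk_homFunctor, mk_homFunctor, mk_homFunctor,
      map_mul, Units.val_mul]

lemma mk_weakActionOfHom {G : Type*} [Group G] (f : G →* (EndoClass 𝓠)ˣ) (g : G) :
    EndoClass.mk ((weakActionOfHom f).functor g) = f g := mk_homFunctor f g

end IsomorphismClasses

/-- Reading `r * q * r` in two ways shows that `t` commutes with `r`, hence so does its inverse.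
With `t` the shift, no separate proof that shifts commute with the cone functors is required. -/
lemma mul_mul_eq_one_of_mul_eq {N : Type*} [Monoid N] {r q t t' : N} (h₁ : r * q = t)
    (h₂ : q * r = t) (h₃ : t * t' = 1) (h₄ : t' * t = 1) :
    r * (t' * q) = 1 ∧ t' * q * r = 1 := by
  have h : t * r = r * t := by rw [← h₂, ← mul_assoc, h₁, h₂, ← h₁]
  have h' : r * t' = t' * r := by
    calc r * t' = t' * t * r * t' := by rw [h₄, one_mul]
      _ = t' * r * (t * t') := by rw [mul_assoc t', h]; simp only [mul_assoc]
      _ = t' * r := by rw [h₃, mul_one]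
  exact ⟨by rw [← mul_assoc, h', mul_assoc, h₁, h₄], by rw [mul_assoc, h₂, h₄]⟩

/-! ### The relations between classes and the action of the braid group. -/

section Action

variable {m : ℕ}

lemma mk_R (i : Fin m) : EndoClass.mk (R i) = EndoClass.mk (induced (chR i)) :=
  EndoClass.mk_eq_mk.2 (nonempty_R_iso i)

lemma mk_R' (i : Fin m) : EndoClass.mk (R' i) = EndoClass.mk (induced
    (CategoryTheory.shiftFunctor (CochainComplex (AMod m) ℤ) (-1 : ℤ))) *
      EndoClass.mk (induced (chR' i)) :=
  EndoClass.mk_eq_mk.2 (nonempty_R'_iso i)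

lemma mk_induced_comp (Φ Ψ : CochainComplex (AMod m) ℤ ⥤ CochainComplex (AMod m) ℤ)
    [Descends Φ] [Descends Ψ] : EndoClass.mk (induced (Φ ⋙ Ψ)) =
      EndoClass.mk (induced Ψ) * EndoClass.mk (induced Φ) :=
  EndoClass.mk_eq_mk.2 ⟨(inducedComp Φ Ψ).symm⟩

lemma mk_shift_mul_mk_shift (a b : ℤ) (h : b + a = 0) : EndoClass.mk (induced
    (CategoryTheory.shiftFunctor (CochainComplex (AMod m) ℤ) a)) * EndoClass.mk (induced
      (CategoryTheory.shiftFunctor (CochainComplex (AMod m) ℤ) b)) = 1 := by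
  rw [← mk_induced_comp, ← EndoClass.mk_id, EndoClass.mk_eq_mk]
  exact ⟨inducedIso (shiftFunctorCompIsoId _ b a h).hom (fun K => isHEquiv_of_isIso _) ≪≫
    inducedId⟩

lemma mk_R_mul_mk_R' (i : Fin m) : EndoClass.mk (R i) * EndoClass.mk (R' i) = 1 ∧
    EndoClass.mk (R' i) * EndoClass.mk (R i) = 1 := by
  rw [mk_R, mk_R']
  refine mul_mul_eq_one_of_mul_eq ?_ ?_ (mk_shift_mul_mk_shift 1 (-1) (by norm_num))
    (mk_shift_mul_mk_shift (-1) 1 (by norm_num))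
  · rw [← mk_induced_comp]
    exact (EndoClass.mk_eq_mk.2 (nonempty_shift_iso_chR'_chR i)).symm
  · rw [← mk_induced_comp]
    exact (EndoClass.mk_eq_mk.2 (nonempty_shift_iso_chR_chR' i)).symm

lemma mk_R_braid {i j : Fin m} (h : j.val = i.val + 1) :
    EndoClass.mk (R i) * EndoClass.mk (R j) * EndoClass.mk (R i) =
      EndoClass.mk (R j) * EndoClass.mk (R i) * EndoClass.mk (R j) := by
  have := EndoClass.mk_eq_mk.2 (nonempty_chR_braid h)
  rwa [mk_induced_comp, mk_induced_comp, mk_induced_comp, mk_induced_comp, ← mk_R, ← mk_R] at this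

lemma mk_R_comm {i j : Fin m} (h : i.val + 1 < j.val ∨ j.val + 1 < i.val) :
    EndoClass.mk (R i) * EndoClass.mk (R j) = EndoClass.mk (R j) * EndoClass.mk (R i) := by
  have := EndoClass.mk_eq_mk.2 (nonempty_chR_comm h)
  rwa [mk_induced_comp, mk_induced_comp, ← mk_R, ← mk_R] at this

/-- The class of `R i`, as a unit. -/
def unitR (i : Fin m) : (EndoClass (CCat m))ˣ :=
  ⟨EndoClass.mk (R i), EndoClass.mk (R' i), (mk_R_mul_mk_R' i).1, (mk_R_mul_mk_R' i).2⟩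

lemma unitR_rel (w : FreeGroup (Fin m)) (hw : w ∈ {w | BraidRel m w}) :
    FreeGroup.lift unitR w = 1 := by
  rcases hw with ⟨i, j, h⟩ | ⟨i, j, h⟩
  · rw [map_mul, map_inv, mul_inv_eq_one]
    simp only [map_mul, FreeGroup.lift_apply_of]
    exact Units.ext (mk_R_braid h)
  · rw [map_mul, map_inv, mul_inv_eq_one]
    simp only [map_mul, FreeGroup.lift_apply_of]
    exact Units.ext (mk_R_comm (.inl h))

/-- The homomorphism from the braid group to the units of the monoid of isomorphism classes. -/
def braidHom (m : ℕ) : Braid m →* (EndoClass (CCat m))ˣ := PresentedGroup.toGroup unitR_rel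

lemma braidHom_σ (i : Fin m) : braidHom m (σ i) = unitR i := PresentedGroup.toGroup.of unitR_rel

end Action

end KS
end
theorem mainTheorem6 (m : ℕ) (hm : 1 ≤ m) :
    (∀ i j : Fin m, j.val = i.val + 1 →
      Nonempty (KS.R i ⋙ KS.R j ⋙ KS.R i ≅ KS.R j ⋙ KS.R i ⋙ KS.R j)) ∧
    (∀ i j : Fin m, i.val + 1 < j.val ∨ j.val + 1 < i.val →
      Nonempty (KS.R j ⋙ KS.R i ≅ KS.R i ⋙ KS.R j)) ∧
    (∀ i : Fin m,
      Nonempty (KS.R' i ⋙ KS.R i ≅ 𝟭 (KS.CCat m)) ∧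
      Nonempty (KS.R i ⋙ KS.R' i ≅ 𝟭 (KS.CCat m))) ∧
    (∃ F : KS.WeakAction (KS.Braid m) (KS.CCat m),
      ∀ i : Fin m, Nonempty (F.functor (KS.σ i) ≅ KS.R i) ∧
        Nonempty (F.functor (KS.σ i)⁻¹ ≅ KS.R' i)) := by
  refine ⟨fun i j h => KS.EndoClass.mk_eq_mk.1 (KS.mk_R_braid h),
    fun i j h => KS.EndoClass.mk_eq_mk.1 (KS.mk_R_comm h),
    fun i => ⟨KS.EndoClass.mk_eq_mk.1 (KS.mk_R_mul_mk_R' i).1,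
      KS.EndoClass.mk_eq_mk.1 (KS.mk_R_mul_mk_R' i).2⟩,
    KS.weakActionOfHom (KS.braidHom m), fun i => ⟨?_, ?_⟩⟩
  · rw [← KS.EndoClass.mk_eq_mk, KS.mk_weakActionOfHom, KS.braidHom_σ]
    rfl
  -- The inverse of the unit `unitR i` has the class of `R' i` as its value by construction.
  · rw [← KS.EndoClass.mk_eq_mk, KS.mk_weakActionOfHom, map_inv, KS.braidHom_σ]
    rfl
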